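/- Let $\Bbbk$ be a commutative ring. A partial Brauer partition of rank $n$ is a partition $d$ of $\{1,\dots,n\}\cup\{1',\dots,n'\}$ into parts of size one or two; it is a Brauer partition if all its parts are pairs. The composition $d\circ d'$ is obtained by putting $d$ to the left of $d'$, identifying the primed points of $d$ with the unprimed points of $d'$, and joining two outer points if they are connected. The partial Brauer algebra $\mathfrak R_n(\delta,\delta')$ is the free $\Bbbk$-module on the partial Brauer partitions with $d\,d'=\delta^{k}(\delta')^{m}\,d\circ d'$, where $k$ and $m$ are the numbers of closed loops and of open strings that are removed in the middle; the Brauer algebra $\mathfrak B_n(\delta)$ is the free $\Bbbk$-module on the Brauer partitions with $d\,d'=\delta^{k}\,d\circ d'$. Let $\delta=\delta'=1$ and $\mathfrak R_n=\mathfrak R_n(1,1)$. Let $u_{n,i}$ be the identity diagram with the part $\{i,i'\}$ split into two singletons, $\hat u_{n,i}=1-u_{n,i}$, $\hat u_X=\prod_{i\in X}\hat u_{n,i}$ and $\hat u_n=\hat u_{\{1,\dots,n\}}$. For a partial Brauer partition $d$ put $\langle d\rangle=\hat u_{l(d)}\,d\,\hat u_{r(d)}$, where $l(d)$ (resp. $r(d)$)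 is the set of $i$ such that $\{i\}$ (resp. $\{i'\}$) is not a part of $d$, and for $n\ge 1$ let $\omega=\langle u_{n,1}\rangle$. Call $d$ even if $n$ minus the number of parts of $d$ meeting both $\{1,\dots,n\}$ and $\{1',\dots,n'\}$ is even, and odd otherwise. Let $\mathfrak R_n^0$ and $\mathfrak R_n^1$ be the $\Bbbk$-spans of all $\langle d\rangle$ with $d$ even, respectively odd. These are two-sided ideals of $\mathfrak R_n$, each having an identity element, so that they are direct ring summands of $\mathfrak R_n$ and their modules are $\mathfrak R_n$-modules; moreover $\hat u_n$ and $\omega$ are idempotents. (i) Let $n$ be odd. Then $d\mapsto\langle d\rangle$ extends to an isomorphism of $\Bbbk$-algebras $\mathfrak B_n(0)\cong\hat u_n\mathfrak R_n\hat u_n$, and, with this identification, the functor $\mathrm F=\mathrm{Hom}_{\mathfrak R_n}(\mathfrak R_n\hat u_n,-)\cong\hat u_n\mathfrak R_n\otimes_{\mathfrak R_n}-$ induces an equivalence $\mathfrak R_n^0\text{-mod}\cong\mathfrak B_n(0)\text{-mod}$. (ii) Let $n\geq 2$ be even. Then $d\mapsto\langle\varphi(d)\rangle$, where $\varphi(d)$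 is obtained from $d$ by shifting all indices by one and adding the singletons $\{1\}$ and $\{1'\}$, extends to an isomorphism of $\Bbbk$-algebras $\mathfrak B_{n-1}(0)\cong\omega\mathfrak R_n\omega$, and, with this identification, the functor $\mathrm F_\omega=\mathrm{Hom}_{\mathfrak R_n}(\mathfrak R_n\omega,-)$ induces an equivalence $\mathfrak R_n^1\text{-mod}\cong\mathfrak B_{n-1}(0)\text{-mod}$. Both statements hold for the categories of all left modules, and a module is finitely generated if and only if its image under the functor is, so they also hold for the categories of finitely generated left modules. -/

import Mathlib

universe u

namespace PartialBrauer

section Gluing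
variable {P V V₁ V₂ : Type*}

/-- All parts of the set partition `r` have at most two elements. -/
def SmallParts (r : Setoid V) : Prop :=
  ∀ a b c, r a b → r a c → a = b ∨ a = c ∨ b = c

/-- `{v}` is a part of the set partition `r`. -/
def IsolatedIn (r : Setoid V) (v : V) : Prop := ∀ u, r v u → u = v

/-- The parts of `r` that contain no element of `B`. -/
def innerParts (r : Setoid V) (B : Set V) : Set (Quotient r) :=
  {c | ∀ v ∈ B, Quotient.mk r v ≠ c}

/-- The parts of `r` that contain an element of `E`. -/
def partsMeeting (r : Setoid V) (E : Set V) : Set (Quotient r) :=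
  {c | ∃ v ∈ E, Quotient.mk r v = c}

theorem map_apply_of_injective {W : Type*} {f : V → W} (hf : Function.Injective f) (r : Setoid V)
    {x y : W} : r.map f x y ↔ (∃ a b, r a b ∧ f a = x ∧ f b = y) ∨ x = y := by
  have := Setoid.coe_map_of_ker_le r f (Setoid.ker_eq_bot_iff.2 hf ▸ bot_le)
  rw [this]; rfl

theorem map_le_iff {W : Type*} {f : V → W} {r : Setoid V} {s : Setoid W} :
    r.map f ≤ s ↔ r ≤ s.comap f := by
  constructor
  · intro h x y hxy
    exact h (Setoid.le_comap_map hxy)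
  · intro h
    refine Setoid.eqvGen_le ?_
    rintro x y ⟨a, b, hab, rfl, rfl⟩
    exact h hab

theorem map_sup {W : Type*} (f : V → W) (r s : Setoid V) :
    (r ⊔ s).map f = r.map f ⊔ s.map f :=
  GaloisConnection.l_sup (u := fun t : Setoid W => t.comap f) (l := fun r : Setoid V => r.map f)
    (fun _ _ => map_le_iff)

theorem map_map {W U : Type*} (f : V → W) (g : W → U) (r : Setoid V) :
    (r.map f).map g = r.map (g ∘ f) :=
  eq_of_forall_ge_iff fun t => by simp only [map_le_iff]; rfl

theorem SmallParts.map {W : Type*} {f : V → W} (hf : Function.Injective f) {r : Setoid V}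
    (hr : SmallParts r) : SmallParts (r.map f) := by
  intro x y z hxy hxz
  rw [map_apply_of_injective hf] at hxy hxz
  rcases hxy with ⟨a, b, hab, rfl, rfl⟩ | rfl
  · rcases hxz with ⟨a', c, hac, h, rfl⟩ | rfl
    · obtain rfl := hf h
      rcases hr _ _ _ hab hac with h | h | h <;> simp [h]
    · simp
  · simp

theorem isolatedIn_map {W : Type*} {f : V → W} (hf : Function.Injective f) {r : Setoid V} {v : V} :
    IsolatedIn (r.map f) (f v) ↔ IsolatedIn r v := by
  constructor
  · intro h u hu
    exact hf (h _ (Setoid.le_comap_map hu))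
  · intro h u hu
    rw [map_apply_of_injective hf] at hu
    rcases hu with ⟨a, b, hab, h', rfl⟩ | h'
    · obtain rfl := hf h'
      rw [h _ hab]
    · exact h'.symm

theorem isolatedIn_map_of_notMem {W : Type*} {f : V → W} (hf : Function.Injective f) {r : Setoid V}
    {w : W} (hw : w ∉ Set.range f) : IsolatedIn (r.map f) w := by
  intro u hu
  rw [map_apply_of_injective hf] at hu
  rcases hu with ⟨a, b, hab, h', rfl⟩ | h'
  · exact absurd ⟨a, h'⟩ hw
  · exact h'.symm

/-! Two set partitions with parts of size at most two: every part of their join is a path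
or a cycle. -/

theorem exists_partner {r : Setoid V} (hr : SmallParts r) :
    ∃ a : Equiv.Perm V, (∀ v, a (a v) = v) ∧ (∀ u v, r u v ↔ v = u ∨ v = a u) := by
  classical
  have h1 : ∀ v, ∃ w, r v w ∧ ∀ u, r v u → u = v ∨ u = w := by
    intro v
    by_cases h : IsolatedIn r v
    · exact ⟨v, r.refl' v, fun u hu => Or.inl (h u hu)⟩
    · simp only [IsolatedIn, not_forall] at h
      obtain ⟨w, hw, hne⟩ := h
      refine ⟨w, hw, fun u hu => ?_⟩
      rcases hr _ _ _ hu hw with h | h | h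
      · exact Or.inl h.symm
      · exact absurd h.symm hne
      · exact Or.inr h
  choose a ha hau using h1
  have inv : ∀ v, a (a v) = v := by
    intro v
    by_cases hv : a v = v
    · rw [hv, hv]
    · rcases hau (a v) v (r.symm' (ha v)) with h | h
      · exact absurd h.symm hv
      · exact h.symm
  refine ⟨⟨a, a, inv, inv⟩, inv, fun u v => ⟨hau u v, ?_⟩⟩
  rintro (rfl | rfl)
  · exact r.refl' _
  · exact ha u

theorem orbit_aux [Finite V] {a b : Equiv.Perm V} (ha : ∀ v, a (a v) = v) (hb : ∀ v, b (b v) = v)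
    {e : V} (he : a e = e) :
    ∃ (N : ℕ) (w : ℤ → V), 0 < N ∧ w 0 = e ∧ (∀ i j, w i = w j ↔ (N : ℤ) ∣ i - j) ∧
      (∀ i, a (w i) = w (-i)) ∧ (∀ i, b (w i) = w (-i - 1)) := by
  set r : Equiv.Perm V := a * b
  have haa : a * a = 1 := Equiv.ext ha
  have hbb : b * b = 1 := Equiv.ext hb
  have hai : a⁻¹ = a := inv_eq_of_mul_eq_one_left haa
  have hbi : b⁻¹ = b := inv_eq_of_mul_eq_one_left hbb
  have hri : r⁻¹ = b * a := by simp [r, hai, hbi]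
  have hconj : a * r * a⁻¹ = r⁻¹ := by
    rw [hri, hai]; simp only [r]; rw [← mul_assoc, haa, one_mul]
  have hz : ∀ i : ℤ, a * r ^ i = r ^ (-i) * a := by
    intro i
    have := conj_zpow (i := i) (a := a) (b := r)
    rw [hconj, inv_zpow'] at this
    rw [this, hai, mul_assoc, haa, mul_one]
  have hbr : b = r⁻¹ * a := by rw [hri, mul_assoc, haa, mul_one]
  refine ⟨Function.minimalPeriod (fun v => r • v) e, fun i => (r ^ i) e, ?_, by simp, ?_, ?_, ?_⟩
  · apply Function.minimalPeriod_pos_of_mem_periodicPts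
    exact (Function.Injective.mem_periodicPts (MulAction.injective r) e)
  · intro i j
    have := MulAction.zpow_smul_eq_iff_minimalPeriod_dvd (a := r) (b := e) (n := i - j)
    rw [← this, Equiv.Perm.smul_def, sub_eq_neg_add, zpow_add, Equiv.Perm.mul_apply, zpow_neg,
      Equiv.Perm.inv_eq_iff_eq]
  · intro i
    rw [← Equiv.Perm.mul_apply, hz, Equiv.Perm.mul_apply, he]
  · intro i
    have : b * r ^ i = r ^ (-i - 1) * a := by
      rw [hbr, mul_assoc, hz, ← mul_assoc]
      congr 1
      rw [show -i - 1 = -1 + -i by ring, zpow_add, zpow_neg_one]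
    rw [← Equiv.Perm.mul_apply, this, Equiv.Perm.mul_apply, he]

/-- The ends of the paths: `v` is an end in direction `σ` if it is isolated in `r` (`σ = true`)
or in `s` (`σ = false`). -/
def EndAt (r s : Setoid V) (v : V) (σ : Bool) : Prop := IsolatedIn (if σ then r else s) v

theorem ends_aux [Finite V] {r s : Setoid V} (hr : SmallParts r) (hs : SmallParts s) {e : V}
    (he : IsolatedIn r e) :
    (∃ v σ, EndAt r s v σ ∧ (r ⊔ s) e v ∧ ¬(v = e ∧ σ = true)) ∧
    (∀ v σ v' σ', EndAt r s v σ → EndAt r s v' σ' → (r ⊔ s) e v → (r ⊔ s) e v' →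
      (v = e ∧ σ = true) ∨ (v' = e ∧ σ' = true) ∨ (v = v' ∧ σ = σ')) := by
  obtain ⟨a, ha, hra⟩ := exists_partner hr
  obtain ⟨b, hb, hsb⟩ := exists_partner hs
  have iso_a : ∀ v, IsolatedIn r v ↔ a v = v := fun v =>
    ⟨fun h => h _ ((hra _ _).2 (Or.inr rfl)), fun h u hu => by
      rcases (hra _ _).1 hu with h' | h' <;> simp [h', h]⟩
  have iso_b : ∀ v, IsolatedIn s v ↔ b v = v := fun v =>
    ⟨fun h => h _ ((hsb _ _).2 (Or.inr rfl)), fun h u hu => by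
      rcases (hsb _ _).1 hu with h' | h' <;> simp [h', h]⟩
  obtain ⟨N, w, hN, h0, hw, wa, wb⟩ := orbit_aux ha hb ((iso_a e).1 he)
  have stepa : ∀ v, (r ⊔ s) v (a v) := fun v => 
    (le_sup_left : r ≤ r ⊔ s) ((hra _ _).2 (Or.inr rfl))
  have stepb : ∀ v, (r ⊔ s) v (b v) := fun v => 
    (le_sup_right : s ≤ r ⊔ s) ((hsb _ _).2 (Or.inr rfl))
  have conn : ∀ i : ℤ, (r ⊔ s) (w 0) (w i) := by
    have step : ∀ i, (r ⊔ s) (w i) (w (i + 1)) := by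
      intro i
      have h1 := stepa (w i)
      have h2 := stepb (w (-i - 1))
      rw [wb, show -(-i-1)-1 = i by ring] at h2
      have h3 := stepa (w (-i - 1))
      rw [wa, show -(-i-1) = i + 1 by ring] at h3
      exact (r ⊔ s).trans' ((r ⊔ s).symm' h2) h3
    intro i
    induction i with
    | zero => exact (r ⊔ s).refl' _
    | succ i ih => exact (r ⊔ s).trans' ih (step _)
    | pred i ih =>
      have := step (-(i:ℤ) - 1)
      rw [sub_add_cancel] at this
      exact (r ⊔ s).trans' ih ((r ⊔ s).symm' this)
  have fixa : ∀ i, a (w i) = w i ↔ (N : ℤ) ∣ 2 * i := fun i => by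
    rw [wa, hw, show -i - i = -(2 * i) by ring, dvd_neg]
  have fixb : ∀ i, b (w i) = w i ↔ (N : ℤ) ∣ 2 * i + 1 := fun i => by
    rw [wb, hw, show -i - 1 - i = -(2 * i + 1) by ring, dvd_neg]
  have onorbit : ∀ v, (r ⊔ s) e v → ∃ i : ℤ, 0 ≤ i ∧ i < N ∧ v = w i := by
    have h1 : ∀ u v, (r ⊔ s) u v → ((∃ i, u = w i) ↔ ∃ i, v = w i) := by
      let t : Setoid V := ⟨fun u v => ((∃ i, u = w i) ↔ ∃ i, v = w i),
        ⟨fun _ => Iff.rfl, fun h => h.symm, fun h h' => h.trans h'⟩⟩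
      suffices r ⊔ s ≤ t from fun u v h => this h
      have key : ∀ c : Equiv.Perm V, (∀ v, c (c v) = v) → (∀ i, ∃ j, c (w i) = w j) →
          ∀ u v, (v = u ∨ v = c u) → t u v := by
        rintro c hc hcw u v (rfl | rfl)
        · exact Iff.rfl
        · constructor
          · rintro ⟨i, rfl⟩; exact hcw i
          · rintro ⟨i, hi⟩
            obtain ⟨j, hj⟩ := hcw i
            exact ⟨j, by rw [← hj, ← hi, hc]⟩
      refine sup_le (fun u v h => ?_) (fun u v h => ?_)
      · exact key a ha (fun i => ⟨_, wa i⟩) u v ((hra _ _).1 h)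
      · exact key b hb (fun i => ⟨_, wb i⟩) u v ((hsb _ _).1 h)
    intro v hv
    obtain ⟨i, rfl⟩ := (h1 _ _ hv).1 ⟨0, h0.symm⟩
    refine ⟨i % N, Int.emod_nonneg _ (by omega), Int.emod_lt_of_pos _ (by omega), ?_⟩
    rw [hw]
    exact Int.dvd_self_sub_emod
  constructor
  · rcases Nat.even_or_odd' N with ⟨m, hm | hm⟩
    · refine ⟨w m, true, ?_, ?_, ?_⟩
      · simp only [EndAt, if_true]
        rw [iso_a, fixa, hm]; push_cast; exact dvd_rfl
      · rw [← h0]; exact conn _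
      · rintro ⟨h, -⟩
        rw [← h0, hw] at h
        have := Int.le_of_dvd (by omega) h
        omega
    · refine ⟨w m, false, ?_, ?_, by simp⟩
      · simp only [EndAt]
        rw [if_neg (by simp), iso_b, fixb, hm]; push_cast; exact dvd_rfl
      · rw [← h0]; exact conn _
  · intro v σ v' σ' hv hv' hev hev'
    obtain ⟨i, hi0, hiN, rfl⟩ := onorbit v hev
    obtain ⟨j, hj0, hjN, rfl⟩ := onorbit v' hev'
    have d1 : ∀ x : ℤ, 0 ≤ x → x < N → (N : ℤ) ∣ 2 * x → x = 0 ∨ 2 * x = N := by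
      rintro x h0 h1 ⟨c, hc⟩
      have : c = 0 ∨ c = 1 := by
        have : 0 ≤ c := by by_contra h; nlinarith
        have : c < 2 := by by_contra h; nlinarith
        omega
      rcases this with rfl | rfl <;> omega
    have d2 : ∀ x : ℤ, 0 ≤ x → x < N → (N : ℤ) ∣ 2 * x + 1 → 2 * x + 1 = N := by
      rintro x h0 h1 ⟨c, hc⟩
      have : c = 1 := by
        have : 0 < c := by by_contra h; nlinarith
        have : c < 2 := by by_contra h; nlinarith
        omega
      subst this; omega
    have ea : ∀ x : ℤ, 0 ≤ x → x < N → ∀ τ, EndAt r s (w x) τ →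
        (x = 0 ∧ τ = true) ∨ (2 * x = N ∧ τ = true) ∨ (2 * x + 1 = N ∧ τ = false) := by
      intro x hx0 hxN τ h
      cases τ
      · right; right
        simp only [EndAt] at h
        rw [if_neg (by simp), iso_b, fixb] at h
        exact ⟨d2 x hx0 hxN h, rfl⟩
      · simp only [EndAt, if_true] at h
        rw [iso_a, fixa] at h
        rcases d1 x hx0 hxN h with h | h <;> simp [h]
    rcases ea i hi0 hiN σ hv with ⟨h, rfl⟩ | ⟨h, rfl⟩ | ⟨h, rfl⟩
    · left; rw [h]; exact ⟨h0, rfl⟩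
    all_goals
      rcases ea j hj0 hjN σ' hv' with ⟨h', rfl⟩ | ⟨h', rfl⟩ | ⟨h', rfl⟩
    · right; left; rw [h']; exact ⟨h0, rfl⟩
    · right; right; rw [show i = j by omega]; simp
    · omega
    · right; left; rw [h']; exact ⟨h0, rfl⟩
    · omega
    · right; right; rw [show i = j by omega]; simp

theorem endAt_swap {r s : Setoid V} {v : V} {σ : Bool} : EndAt s r v (!σ) ↔ EndAt r s v σ := by
  cases σ <;> simp [EndAt]

theorem exists_other_end [Finite V] {r s : Setoid V} (hr : SmallParts r) (hs : SmallParts s) {e : V}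
    {τ : Bool} (he : EndAt r s e τ) :
    ∃ v σ, EndAt r s v σ ∧ (r ⊔ s) e v ∧ ¬(v = e ∧ σ = τ) := by
  cases τ
  · obtain ⟨v, σ, h1, h2, h3⟩ := (ends_aux hs hr (e := e) (by simpa [EndAt] using he)).1
    refine ⟨v, !σ, by rw [← endAt_swap]; simpa using h1, by rwa [sup_comm], ?_⟩
    simpa using h3
  · exact (ends_aux hr hs (e := e) (by simpa [EndAt] using he)).1

theorem two_ends [Finite V] {r s : Setoid V} (hr : SmallParts r) (hs : SmallParts s) {e v v' : V}
    {τ σ σ' : Bool} (he : EndAt r s e τ) (hv : EndAt r s v σ) (hv' : EndAt r s v' σ')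
    (h : (r ⊔ s) e v) (h' : (r ⊔ s) e v') :
    (v = e ∧ σ = τ) ∨ (v' = e ∧ σ' = τ) ∨ (v = v' ∧ σ = σ') := by
  cases τ
  · have := (ends_aux hs hr (e := e) (by simpa [EndAt] using he)).2 v (!σ) v' (!σ')
      (endAt_swap.2 hv) (endAt_swap.2 hv') (by rwa [sup_comm]) (by rwa [sup_comm])
    simpa using this
  · exact (ends_aux hr hs (e := e) (by simpa [EndAt] using he)).2 v σ v' σ' hv hv' h h'

section Cocycle

variable {h : P → V₁} {k : P → V₂} {f : V₁ → V} {g : V₂ → V}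

theorem pushout_aux (hf : Function.Injective f) (hg : Function.Injective g)
    (pb : ∀ x y, f x = g y → ∃ p, h p = x ∧ k p = y)
    (G : Setoid V₁) (S : Setoid V₂) {w : V₂} {t : V}
    (ht : (G.map f ⊔ S.map g) (g w) t) :
    ∃ w', ((G.comap h).map k ⊔ S) w w' ∧ (t = g w' ∨ ∃ v p, f v = t ∧ G v (h p) ∧ k p = w') := by
  set G' := (G.comap h).map k ⊔ S
  let Q : V → Prop := fun t => ∃ w', G' w w' ∧ (t = g w' ∨ ∃ v p, f v = t ∧ G v (h p) ∧ k p = w')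
  have hG : ∀ p q, G (h p) (h q) → G' (k p) (k q) := fun p q hpq =>
    (le_sup_left : (G.comap h).map k ≤ G') (Setoid.le_comap_map (r := G.comap h) hpq)
  let T : Setoid V := ⟨fun t t' => (Q t ↔ Q t'),
        ⟨fun _ => Iff.rfl, fun h => h.symm, fun h h' => h.trans h'⟩⟩
  have hT : G.map f ⊔ S.map g ≤ T := by
    have hsymm : ∀ (r : Setoid V), (∀ x y, r x y → Q x → Q y) → r ≤ T := fun r H x y hxy =>
      ⟨H _ _ hxy, H _ _ (r.symm' hxy)⟩
    refine sup_le (hsymm _ ?_) (hsymm _ ?_)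
    · intro x y hxy
      rw [map_apply_of_injective hf] at hxy
      rcases hxy with ⟨a, b, hab, rfl, rfl⟩ | rfl
      · rintro ⟨w', hw', h1 | ⟨v, p, hv, hvp, rfl⟩⟩
        · obtain ⟨p, rfl, rfl⟩ := pb _ _ h1
          exact ⟨_, hw', Or.inr ⟨b, p, rfl, G.symm' hab, rfl⟩⟩
        · obtain rfl := hf hv
          exact ⟨_, hw', Or.inr ⟨b, p, rfl, G.trans' (G.symm' hab) hvp, rfl⟩⟩
      · exact id
    · intro x y hxy
      rw [map_apply_of_injective hg] at hxy
      rcases hxy with ⟨a, b, hab, rfl, rfl⟩ | rfl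
      · have hab' : G' a b := (le_sup_right : S ≤ G') hab
        rintro ⟨w', hw', h1 | ⟨v, p, hv, hvp, rfl⟩⟩
        · obtain rfl := hg h1
          exact ⟨b, G'.trans' hw' hab', Or.inl rfl⟩
        · obtain ⟨q, rfl, rfl⟩ := pb _ _ hv
          exact ⟨b, G'.trans' (G'.trans' hw' (hG _ _ (G.symm' hvp))) hab', Or.inl rfl⟩
      · exact id
  exact (hT ht).1 ⟨w, G'.refl' _, Or.inl rfl⟩

theorem comap_pushout (hf : Function.Injective f) (hg : Function.Injective g)
    (comm : ∀ p, f (h p) = g (k p)) (pb : ∀ x y, f x = g y → ∃ p, h p = x ∧ k p = y)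
    (G : Setoid V₁) (S : Setoid V₂) :
    (G.map f ⊔ S.map g).comap g = (G.comap h).map k ⊔ S := by
  apply le_antisymm
  · intro w w' hw
    obtain ⟨w'', h1, h2 | ⟨v, p, h2, h3, rfl⟩⟩ := pushout_aux hf hg pb G S hw
    · rwa [hg h2]
    · obtain ⟨q, rfl, rfl⟩ := pb _ _ h2
      refine Setoid.trans' _ h1 ?_
      exact (le_sup_left : (G.comap h).map k ≤ _)
        (Setoid.le_comap_map (r := G.comap h) (G.symm' h3))
  · refine sup_le ?_ ?_
    · rw [map_le_iff]
      intro p q hpq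
      change (G.map f ⊔ S.map g) (g (k p)) (g (k q))
      rw [← comm, ← comm]
      exact (le_sup_left : G.map f ≤ _) (Setoid.le_comap_map hpq)
    · intro x y hxy
      exact (le_sup_right : S.map g ≤ _) (Setoid.le_comap_map hxy)

theorem isolated_pushout (hf : Function.Injective f) (hg : Function.Injective g)
    (pb : ∀ x y, f x = g y → ∃ p, h p = x ∧ k p = y)
    (G : Setoid V₁) (S : Setoid V₂) {v : V₁} (hv : ∀ p, ¬ G v (h p)) {t : V}
    (ht : (G.map f ⊔ S.map g) (f v) t) : ∃ v', f v' = t ∧ G v v' := by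
  let Q : V → Prop := fun t => ∃ v', f v' = t ∧ G v v'
  let T : Setoid V := ⟨fun t t' => (Q t ↔ Q t'),
        ⟨fun _ => Iff.rfl, fun h => h.symm, fun h h' => h.trans h'⟩⟩
  have hT : G.map f ⊔ S.map g ≤ T := by
    have hsymm : ∀ (r : Setoid V), (∀ x y, r x y → Q x → Q y) → r ≤ T := fun r H x y hxy =>
      ⟨H _ _ hxy, H _ _ (r.symm' hxy)⟩
    refine sup_le (hsymm _ ?_) (hsymm _ ?_)
    · intro x y hxy
      rw [map_apply_of_injective hf] at hxy
      rcases hxy with ⟨a, b, hab, rfl, rfl⟩ | rfl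
      · rintro ⟨v', h1, h2⟩
        obtain rfl := hf h1
        exact ⟨b, rfl, G.trans' h2 hab⟩
      · exact id
    · intro x y hxy
      rw [map_apply_of_injective hg] at hxy
      rcases hxy with ⟨a, b, hab, rfl, rfl⟩ | rfl
      · rintro ⟨v', h1, h2⟩
        obtain ⟨p, rfl, rfl⟩ := pb _ _ h1
        exact absurd h2 (hv p)
      · exact id
  exact (hT ht).1 ⟨v, rfl, G.refl' _⟩

theorem count_pushout [Finite V] (hf : Function.Injective f) (hg : Function.Injective g)
    (comm : ∀ p, f (h p) = g (k p)) (pb : ∀ x y, f x = g y → ∃ p, h p = x ∧ k p = y)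
    (cover : ∀ t, (∃ x, f x = t) ∨ ∃ y, g y = t)
    (G : Setoid V₁) (S : Setoid V₂) (B : Set V₂) (E₁ : Set V₁) (E₂ : Set V₂) (Sg : Set P)
    (hSg : ∀ p, p ∈ Sg ↔ ∃ e ∈ E₁, G e (h p)) (c : Bool) :
    (innerParts (G.map f ⊔ S.map g) (g '' B) ∩ 
      {x | x ∈ partsMeeting (G.map f ⊔ S.map g) (f '' E₁ ∪ g '' E₂) ↔ c = true}).ncard =
    (innerParts G (Set.range h) ∩ {x | x ∈ partsMeeting G E₁ ↔ c = true}).ncard +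
    (innerParts ((G.comap h).map k ⊔ S) B ∩
      {x | x ∈ partsMeeting ((G.comap h).map k ⊔ S) (k '' Sg ∪ E₂) ↔ c = true}).ncard := by
  set R := G.map f ⊔ S.map g with hR
  set G' := (G.comap h).map k ⊔ S with hG'
  have Rg : ∀ w w', R (g w) (g w') ↔ G' w w' := by
    intro w w'
    rw [hG', ← comap_pushout hf hg comm pb G S]
    rfl
  have Rf : ∀ v v', G v v' → R (f v) (f v') := fun v v' hv =>
    (le_sup_left : G.map f ≤ R) (Setoid.le_comap_map hv)
  have Riso : ∀ v, (∀ p, ¬ G v (h p)) → ∀ t, R (f v) t → ∃ v', f v' = t ∧ G v v' :=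
    fun v hv t ht => isolated_pushout hf hg pb G S hv ht
  let φ₁ : Quotient G → Quotient R := Quotient.map' f Rf
  let φ₂ : Quotient G' → Quotient R := Quotient.map' g (fun w w' hw => (Rg w w').2 hw)
  have mkR : ∀ x y, Quotient.mk R x = Quotient.mk R y ↔ R x y := fun x y => Quotient.eq
  have mkG : ∀ x y, Quotient.mk G x = Quotient.mk G y ↔ G x y := fun x y => Quotient.eq
  have mkG' : ∀ x y, Quotient.mk G' x = Quotient.mk G' y ↔ G' x y := fun x y => Quotient.eq
  have e1 : ∀ v, φ₁ (Quotient.mk G v) = Quotient.mk R (f v) := fun _ => rfl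
  have e2 : ∀ v, φ₂ (Quotient.mk G' v) = Quotient.mk R (g v) := fun _ => rfl
  have in1 : ∀ v, Quotient.mk G v ∈ innerParts G (Set.range h) ↔ ∀ p, ¬ G v (h p) := by
    intro v
    simp only [innerParts, Set.mem_ofPred_eq, Set.forall_mem_range, ne_eq, mkG]
    exact forall_congr' fun p => not_congr G.comm'
  have fin1 : Finite V₁ := Finite.of_injective f hf
  have fin2 : Finite V₂ := Finite.of_injective g hg
  -- colours
  have col1 : ∀ v, (∀ p, ¬ G v (h p)) → (Quotient.mk R (f v) ∈ partsMeeting R (f '' E₁ ∪ g '' E₂) ↔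
      Quotient.mk G v ∈ partsMeeting G E₁) := by
    intro v hv
    constructor
    · rintro ⟨t, ht, htv⟩
      obtain ⟨v', rfl, hv'⟩ := Riso v hv t (R.symm' ((mkR _ _).1 htv))
      rcases ht with ⟨e, he, h1⟩ | ⟨e, he, h1⟩
      · obtain rfl := hf h1
        exact ⟨e, he, (mkG _ _).2 (G.symm' hv')⟩
      · obtain ⟨p, rfl, rfl⟩ := pb _ _ h1.symm
        exact absurd hv' (hv p)
    · rintro ⟨e, he, hev⟩
      exact ⟨f e, Or.inl ⟨e, he, rfl⟩, (mkR _ _).2 (Rf _ _ ((mkG _ _).1 hev))⟩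
  have col2 : ∀ w, (Quotient.mk R (g w) ∈ partsMeeting R (f '' E₁ ∪ g '' E₂) ↔
      Quotient.mk G' w ∈ partsMeeting G' (k '' Sg ∪ E₂)) := by
    intro w
    constructor
    · rintro ⟨t, ht, htv⟩
      obtain ⟨w', h1, h2⟩ := pushout_aux hf hg pb G S (R.symm' ((mkR _ _).1 htv))
      rcases ht with ⟨e, he, rfl⟩ | ⟨e, he, rfl⟩
      · obtain ⟨p, hp, rfl⟩ : ∃ p, G e (h p) ∧ k p = w' := by
          rcases h2 with h2 | ⟨v, p, hv, hvp, rfl⟩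
          · obtain ⟨p, rfl, rfl⟩ := pb _ _ h2
            exact ⟨p, G.refl' _, rfl⟩
          · obtain rfl := hf hv
            exact ⟨p, hvp, rfl⟩
        exact ⟨k p, Or.inl ⟨p, (hSg p).2 ⟨e, he, hp⟩, rfl⟩, (mkG' _ _).2 (G'.symm' h1)⟩
      · exact ⟨e, Or.inr he, (mkG' _ _).2 ((Rg _ _).1 ((mkR _ _).1 htv))⟩
    · rintro ⟨w', (⟨p, hp, rfl⟩ | hw'), hw⟩
      · obtain ⟨e, he, hep⟩ := (hSg p).1 hp
        refine ⟨f e, Or.inl ⟨e, he, rfl⟩, (mkR _ _).2 ?_⟩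
        refine R.trans' (Rf _ _ hep) ?_
        rw [comm]
        exact (Rg _ _).2 ((mkG' _ _).1 hw)
      · exact ⟨g w', Or.inr ⟨w', hw', rfl⟩, (mkR _ _).2 ((Rg _ _).2 ((mkG' _ _).1 hw))⟩
  have inj1 : Set.InjOn φ₁ (innerParts G (Set.range h)) := by
    rintro ⟨v⟩ hv ⟨v'⟩ hv' hvv
    change Quotient.mk G v = Quotient.mk G v'
    obtain ⟨v'', h1, h2⟩ := Riso v ((in1 v).1 hv) (f v') ((mkR _ _).1 hvv)
    obtain rfl := hf h1
    exact (mkG _ _).2 h2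
  have inj2 : Function.Injective φ₂ := by
    rintro ⟨v⟩ ⟨v'⟩ hvv
    exact (mkG' _ _).2 ((Rg _ _).1 ((mkR _ _).1 hvv))
  have key : innerParts R (g '' B) ∩ {x | x ∈ partsMeeting R (f '' E₁ ∪ g '' E₂) ↔ c = true} =
      φ₁ '' (innerParts G (Set.range h) ∩ {x | x ∈ partsMeeting G E₁ ↔ c = true}) ∪
      φ₂ '' (innerParts G' B ∩ {x | x ∈ partsMeeting G' (k '' Sg ∪ E₂) ↔ c = true}) := by
    have case2 : ∀ w, Quotient.mk R (g w) ∈ innerParts R (g '' B) ↔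
        Quotient.mk G' w ∈ innerParts G' B := by
      intro w
      simp only [innerParts, Set.mem_ofPred_eq, Set.forall_mem_image, ne_eq, mkR, mkG', Rg]
    ext ⟨t⟩
    change Quotient.mk R t ∈ _ ↔ Quotient.mk R t ∈ _
    constructor
    · rintro ⟨h1, h2⟩
      have viag : ∀ w, R (g w) t → Quotient.mk R t ∈ φ₂ '' (innerParts G' B ∩
          {x | x ∈ partsMeeting G' (k '' Sg ∪ E₂) ↔ c = true}) := by
        intro w hw
        rw [← (mkR _ _).2 hw] at h1 h2 ⊢
        exact ⟨Quotient.mk G' w, ⟨(case2 w).1 h1, (col2 w).symm.trans h2⟩, rfl⟩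
      rcases cover t with ⟨v, rfl⟩ | ⟨w, rfl⟩
      · by_cases hv : ∀ p, ¬ G v (h p)
        · exact Or.inl ⟨Quotient.mk G v, ⟨(in1 v).2 hv, (col1 v hv).symm.trans h2⟩, rfl⟩
        · push Not at hv
          obtain ⟨p, hp⟩ := hv
          refine Or.inr (viag (k p) ?_)
          rw [← comm]
          exact R.symm' (Rf _ _ hp)
      · exact Or.inr (viag w (R.refl' _))
    · rintro (⟨⟨v⟩, ⟨h1, h2⟩, h3⟩ | ⟨⟨w⟩, ⟨h1, h2⟩, h3⟩)
      · have hv := (in1 v).1 h1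
        rw [← h3]
        refine ⟨?_, (col1 v hv).trans h2⟩
        rintro _ ⟨b, hb, rfl⟩ h4
        obtain ⟨v', h5, h6⟩ := Riso v hv _ (R.symm' ((mkR _ _).1 h4))
        obtain ⟨p, rfl, rfl⟩ := pb _ _ h5
        exact hv p h6
      · rw [← h3]
        exact ⟨(case2 w).2 h1, (col2 w).trans h2⟩
  rw [key, Set.ncard_union_eq ?_ (Set.toFinite _) (Set.toFinite _),
    (inj1.mono Set.inter_subset_left).ncard_image, Set.ncard_image_of_injective _ inj2]
  rw [Set.disjoint_left]
  rintro _ ⟨⟨v⟩, ⟨h1, -⟩, rfl⟩ ⟨⟨w⟩, -, h3⟩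
  have hv := (in1 v).1 h1
  obtain ⟨v', h5, h6⟩ := Riso v hv _ (R.symm' ((mkR _ _).1 h3))
  obtain ⟨p, rfl, rfl⟩ := pb _ _ h5
  exact hv p h6

end Cocycle

end Gluing

/-- A partial Brauer partition of `{1, …, n} ∪ {1', …, n'}`: a set partition (encoded by its
equivalence relation) into parts of size one or two.  The vertex `i` is `Sum.inl i` (left side),
the vertex `i'` is `Sum.inr i` (right side). -/
@[ext]
structure Diagram (n : ℕ) where
  rel : Setoid (Fin n ⊕ Fin n)
  small : SmallParts rel

namespace Diagram

variable {n : ℕ}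

/-- The vertex `p` is a singleton part of `d`. -/
def IsSingleton (d : Diagram n) (p : Fin n ⊕ Fin n) : Prop := IsolatedIn d.rel p

/-- `d` is a Brauer partition: all parts are pairs. -/
def IsBrauer (d : Diagram n) : Prop := ∀ p, ¬ d.IsSingleton p

/-- The vertices of the juxtaposition `d|d'` are `Fin n ⊕ Fin n ⊕ Fin n`: left side, equator,
right side.  The vertices of `d` are on the left side and on the equator. -/
def onLeft : Fin n ⊕ Fin n → Fin n ⊕ Fin n ⊕ Fin n := Sum.elim Sum.inl (fun j => Sum.inr (Sum.inl j))

/-- The vertices of `d'` in `d|d'`: equator and right side. -/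
def onRight : Fin n ⊕ Fin n → Fin n ⊕ Fin n ⊕ Fin n := Sum.inr

/-- The exterior vertices of `d|d'`: left side and right side. -/
def exterior : Fin n ⊕ Fin n → Fin n ⊕ Fin n ⊕ Fin n :=
  Sum.elim Sum.inl (fun j => Sum.inr (Sum.inr j))

/-- The juxtaposition `d|d'` (`d` on the left, `d'` on the right): its parts are the connected
components of the concatenated diagram. -/
def juxtapose (d d' : Diagram n) : Setoid (Fin n ⊕ Fin n ⊕ Fin n) :=
  d.rel.map onLeft ⊔ d'.rel.map onRight

/-- The vertices of `d|d'` that come from a singleton part of `d` or of `d'`. -/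
def strandEnds (d d' : Diagram n) : Set (Fin n ⊕ Fin n ⊕ Fin n) :=
  onLeft '' {p | d.IsSingleton p} ∪ onRight '' {p | d'.IsSingleton p}

/-- The number of closed loops in `d|d'`: components that do not reach the exterior and contain
no singleton of `d` or `d'`. -/
noncomputable def loops (d d' : Diagram n) : ℕ :=
  (innerParts (juxtapose d d') (Set.range exterior) \
    partsMeeting (juxtapose d d') (strandEnds d d')).ncard

/-- The number of open strings in `d|d'`: components that do not reach the exterior and contain
a singleton of `d` or `d'` (these singletons are the end points of the string). -/
noncomputable def strings (d d' : Diagram n) : ℕ :=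
  (innerParts (juxtapose d d') (Set.range exterior) ∩
    partsMeeting (juxtapose d d') (strandEnds d d')).ncard

theorem onLeft_injective : Function.Injective (onLeft (n := n)) := by
  rintro (x | x) (y | y) h <;> simp_all [onLeft]

theorem onRight_injective : Function.Injective (onRight (n := n)) := Sum.inr_injective

theorem exterior_injective : Function.Injective (exterior (n := n)) := by
  rintro (x | x) (y | y) h <;> simp_all [exterior]

theorem exists_end (d d' : Diagram n) (p : Fin n ⊕ Fin n) :
    ∃ σ, EndAt (d.rel.map onLeft) (d'.rel.map onRight) (exterior p) σ ∧
      ∀ e ∈ strandEnds d d', ∃ τ, EndAt (d.rel.map onLeft) (d'.rel.map onRight) e τ ∧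
        ¬(e = exterior p ∧ τ = σ) := by
  have hs : ∀ e ∈ strandEnds d d', ∃ τ, EndAt (d.rel.map onLeft) (d'.rel.map onRight) e τ ∧
      (τ = true → e ∈ Set.range onLeft) ∧ (τ = false → e ∈ Set.range onRight) := by
    rintro _ (⟨q, hq, rfl⟩ | ⟨q, hq, rfl⟩)
    · exact ⟨true, by simpa [EndAt] using (isolatedIn_map onLeft_injective).2 hq, by simp⟩
    · exact ⟨false, by simpa [EndAt] using (isolatedIn_map onRight_injective).2 hq, by simp⟩
  rcases p with x | z
  · have h : exterior (n := n) (Sum.inl x) ∉ Set.range onRight := by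
      rintro ⟨q, hq⟩; simp [exterior, onRight] at hq
    refine ⟨false, by simpa [EndAt] using isolatedIn_map_of_notMem onRight_injective h, ?_⟩
    intro e he
    obtain ⟨τ, h1, -, h3⟩ := hs e he
    exact ⟨τ, h1, fun ⟨h4, h5⟩ => h (h4 ▸ h3 h5)⟩
  · have h : exterior (n := n) (Sum.inr z) ∉ Set.range onLeft := by
      rintro ⟨q | q, hq⟩ <;> simp [exterior, onLeft] at hq
    refine ⟨true, by simpa [EndAt] using isolatedIn_map_of_notMem onLeft_injective h, ?_⟩
    intro e he
    obtain ⟨τ, h1, h2, -⟩ := hs e he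
    exact ⟨τ, h1, fun ⟨h4, h5⟩ => h (h4 ▸ h2 h5)⟩

/-- The composition `d ∘ d'`: the exterior vertices are joined if and only if they are connected
in `d|d'`. -/
def comp (d d' : Diagram n) : Diagram n where
  rel := (juxtapose d d').comap exterior
  small := by
    intro x y z hxy hxz
    obtain ⟨σ, hσ, -⟩ := exists_end d d' x
    obtain ⟨σ', hσ', -⟩ := exists_end d d' y
    obtain ⟨σ'', hσ'', -⟩ := exists_end d d' z
    rcases two_ends (d.small.map onLeft_injective) (d'.small.map onRight_injective) hσ hσ' hσ''
      hxy hxz with h | h | h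
    · exact Or.inl (exterior_injective h.1).symm
    · exact Or.inr (Or.inl (exterior_injective h.1).symm)
    · exact Or.inr (Or.inr (exterior_injective h.1))

theorem isSingleton_comp (d d' : Diagram n) (p : Fin n ⊕ Fin n) :
    (comp d d').IsSingleton p ↔ ∃ e ∈ strandEnds d d', juxtapose d d' e (exterior p) := by
  obtain ⟨σ, hσ, hσe⟩ := exists_end d d' p
  constructor
  · intro hp
    obtain ⟨v, τ, h1, h2, h3⟩ := exists_other_end (d.small.map onLeft_injective)
      (d'.small.map onRight_injective) hσ
    by_cases hv : v ∈ strandEnds d d'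
    · exact ⟨v, hv, (juxtapose d d').symm' h2⟩
    · exfalso
      have hext : ∃ q, exterior q = v ∧ ((∃ x, q = Sum.inl x ∧ τ = false) ∨
          ∃ z, q = Sum.inr z ∧ τ = true) := by
        cases τ
        · simp only [EndAt, Bool.false_eq_true, if_false] at h1
          rcases v with x | v
          · exact ⟨Sum.inl x, rfl, by simp⟩
          · exact absurd (Or.inr ⟨v, (isolatedIn_map onRight_injective).1 h1, rfl⟩) hv
        · simp only [EndAt, if_true] at h1
          rcases v with x | y | z
          · exact absurd (Or.inl ⟨Sum.inl x, (isolatedIn_map onLeft_injective).1 h1, rfl⟩) hv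
          · exact absurd (Or.inl ⟨Sum.inr y, (isolatedIn_map onLeft_injective).1 h1, rfl⟩) hv
          · exact ⟨Sum.inr z, rfl, by simp⟩
      obtain ⟨q, rfl, hq⟩ := hext
      have hqp : q = p := hp q h2
      subst hqp
      apply h3
      refine ⟨rfl, ?_⟩
      rcases hq with ⟨x, rfl, rfl⟩ | ⟨z, rfl, rfl⟩
      · cases σ
        · rfl
        · exfalso
          simp only [EndAt, if_true] at hσ
          exact hv (Or.inl ⟨Sum.inl x, (isolatedIn_map onLeft_injective).1 hσ, rfl⟩)
      · cases σ
        · exfalso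
          simp only [EndAt, Bool.false_eq_true, if_false] at hσ
          exact hv (Or.inr ⟨Sum.inr z, (isolatedIn_map onRight_injective).1 hσ, rfl⟩)
        · rfl
  · rintro ⟨e, he, hep⟩ q hq
    obtain ⟨σ', hσ', hσe'⟩ := exists_end d d' q
    obtain ⟨τ, hτ, hne⟩ := hσe e he
    rcases two_ends (d.small.map onLeft_injective) (d'.small.map onRight_injective) hσ hσ' hτ
      hq ((juxtapose d d').symm' hep) with h | h | h
    · exact exterior_injective h.1
    · exact absurd h hne
    · obtain ⟨τ', hτ', hne'⟩ := hσe' e he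
      rcases two_ends (d.small.map onLeft_injective) (d'.small.map onRight_injective) hσ hσ' hτ'
        hq ((juxtapose d d').symm' hep) with h' | h' | h'
      · exact exterior_injective h'.1
      · exact exterior_injective (h.1.trans h'.1)
      · exact absurd ⟨h'.1.symm, h'.2.symm⟩ hne'

theorem IsBrauer.comp {d d' : Diagram n} (hd : d.IsBrauer) (hd' : d'.IsBrauer) :
    (comp d d').IsBrauer := by
  intro p hp
  obtain ⟨e, ⟨q, hq, -⟩ | ⟨q, hq, -⟩, -⟩ := (isSingleton_comp d d' p).1 hp
  · exact hd q hq
  · exact hd' q hq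

/-- The partition with `i` and `i'` joined for `i ∉ X`, and `{i}`, `{i'}` singletons for `i ∈ X`. -/
def cut (X : Set (Fin n)) : Diagram n where
  rel :=
    { r := fun p q => p = q ∨ (Sum.elim id id p = Sum.elim id id q ∧ Sum.elim id id p ∉ X)
      iseqv := by
        refine ⟨fun _ => Or.inl rfl, ?_, ?_⟩
        · rintro p q (h | ⟨h, h'⟩)
          · exact Or.inl h.symm
          · exact Or.inr ⟨h.symm, h ▸ h'⟩
        · rintro p q s (rfl | ⟨h, h'⟩) (rfl | ⟨h1, h1'⟩)
          · exact Or.inl rfl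
          · exact Or.inr ⟨h1, h1'⟩
          · exact Or.inr ⟨h, h'⟩
          · exact Or.inr ⟨h.trans h1, h'⟩ }
  small := by
    rintro p q s (rfl | ⟨h, -⟩) (rfl | ⟨h1, -⟩)
    · simp
    · simp
    · simp
    · rcases p with p | p <;> rcases q with q | q <;> rcases s with s | s <;> simp_all

/-- The identity diagram, with parts `{i, i'}`. -/
def identity (n : ℕ) : Diagram n := cut ∅

theorem identity_rel {p q : Fin n ⊕ Fin n} :
    (identity n).rel p q ↔ Sum.elim id id p = Sum.elim id id q := by
  change (p = q ∨ (_ ∧ _)) ↔ _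
  constructor
  · rintro (rfl | h)
    · rfl
    · exact h.1
  · intro h
    exact Or.inr ⟨h, by simp⟩

theorem identity_isBrauer : (identity n).IsBrauer := by
  rintro (x | x) h
  · have := h (Sum.inr x) (identity_rel.2 rfl); simp at this
  · have := h (Sum.inl x) (identity_rel.2 rfl); simp at this

theorem juxtapose_left (d d' : Diagram n) {p q : Fin n ⊕ Fin n} (h : d.rel p q) :
    juxtapose d d' (onLeft p) (onLeft q) :=
  (le_sup_left : d.rel.map onLeft ≤ juxtapose d d') (Setoid.le_comap_map h)

theorem juxtapose_right (d d' : Diagram n) {p q : Fin n ⊕ Fin n} (h : d'.rel p q) :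
    juxtapose d d' (onRight p) (onRight q) :=
  (le_sup_right : d'.rel.map onRight ≤ juxtapose d d') (Setoid.le_comap_map h)

theorem one_comp (d : Diagram n) : comp (identity n) d = d := by
  ext1
  let ρ : Fin n ⊕ Fin n ⊕ Fin n → Fin n ⊕ Fin n := Sum.elim Sum.inl id
  have hle : juxtapose (identity n) d ≤ d.rel.comap ρ := by
    refine sup_le ?_ ?_
    · rw [map_le_iff]
      rintro p q hpq
      rw [identity_rel] at hpq
      change d.rel (ρ (onLeft p)) (ρ (onLeft q))
      have : ρ (onLeft p) = ρ (onLeft q) := by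
        rcases p with p | p <;> rcases q with q | q <;> simp_all [ρ, onLeft]
      rw [this]
    · rw [map_le_iff]
      exact fun p q hpq => hpq
  have hρ : ∀ p, ρ (exterior p) = p := by rintro (p | p) <;> rfl
  have hc : ∀ p, juxtapose (identity n) d (exterior p) (onRight p) := by
    rintro (p | p)
    · exact juxtapose_left (identity n) d (p := Sum.inl p) (q := Sum.inr p) (identity_rel.2 rfl)
    · exact Setoid.refl' _ _
  apply le_antisymm
  · intro p q hpq
    have := hle hpq
    change d.rel (ρ (exterior p)) (ρ (exterior q)) at this
    rwa [hρ, hρ] at this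
  · intro p q hpq
    change juxtapose (identity n) d (exterior p) (exterior q)
    exact Setoid.trans' _ (hc p) (Setoid.trans' _ (juxtapose_right _ _ hpq)
      (Setoid.symm' _ (hc q)))

theorem comp_one (d : Diagram n) : comp d (identity n) = d := by
  ext1
  let ρ : Fin n ⊕ Fin n ⊕ Fin n → Fin n ⊕ Fin n := Sum.elim Sum.inl (Sum.elim Sum.inr Sum.inr)
  have hle : juxtapose d (identity n) ≤ d.rel.comap ρ := by
    refine sup_le ?_ ?_
    · rw [map_le_iff]
      intro p q hpq
      have h : ∀ p, ρ (onLeft p) = p := by rintro (p | p) <;> rfl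
      change d.rel (ρ (onLeft p)) (ρ (onLeft q))
      rwa [h, h]
    · rw [map_le_iff]
      rintro p q hpq
      rw [identity_rel] at hpq
      change d.rel (ρ (onRight p)) (ρ (onRight q))
      have : ρ (onRight p) = ρ (onRight q) := by
        rcases p with p | p <;> rcases q with q | q <;> simp_all [ρ, onRight]
      rw [this]
  have hρ : ∀ p, ρ (exterior p) = p := by rintro (p | p) <;> rfl
  have hc : ∀ p, juxtapose d (identity n) (exterior p) (onLeft p) := by
    rintro (p | p)
    · exact Setoid.refl' _ _
    · exact juxtapose_right d (identity n) (p := Sum.inr p) (q := Sum.inl p) (identity_rel.2 rfl)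
  apply le_antisymm
  · intro p q hpq
    have := hle hpq
    change d.rel (ρ (exterior p)) (ρ (exterior q)) at this
    rwa [hρ, hρ] at this
  · intro p q hpq
    change juxtapose d (identity n) (exterior p) (exterior q)
    exact Setoid.trans' _ (hc p) (Setoid.trans' _ (juxtapose_left _ _ hpq)
      (Setoid.symm' _ (hc q)))

theorem inner_eq_empty {d d' : Diagram n}
    (h : ∀ j : Fin n, ∃ p, juxtapose d d' (exterior p) (Sum.inr (Sum.inl j))) :
    innerParts (juxtapose d d') (Set.range exterior) = ∅ := by
  rw [Set.eq_empty_iff_forall_notMem]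
  rintro ⟨v⟩ hv
  have hex : ∃ p, juxtapose d d' (exterior p) v := by
    rcases v with x | y | z
    · exact ⟨Sum.inl x, Setoid.refl' _ _⟩
    · exact h y
    · exact ⟨Sum.inr z, Setoid.refl' _ _⟩
  obtain ⟨p, hp⟩ := hex
  exact hv _ ⟨p, rfl⟩ (Quotient.sound hp)

theorem inner_one_left (d : Diagram n) :
    innerParts (juxtapose (identity n) d) (Set.range exterior) = ∅ :=
  inner_eq_empty fun j => ⟨Sum.inl j,
    juxtapose_left (identity n) d (p := Sum.inl j) (q := Sum.inr j) (identity_rel.2 rfl)⟩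

theorem inner_one_right (d : Diagram n) :
    innerParts (juxtapose d (identity n)) (Set.range exterior) = ∅ :=
  inner_eq_empty fun j => ⟨Sum.inr j,
    juxtapose_right d (identity n) (p := Sum.inr j) (q := Sum.inl j) (identity_rel.2 rfl)⟩

/-! Associativity of composition, by comparison with the triple juxtaposition `d|d'|d''`. -/

/-- Triple juxtaposition. -/
def triple (d d' d'' : Diagram n) : Setoid (Fin n ⊕ Fin n ⊕ Fin n ⊕ Fin n) :=
  (juxtapose d' d'').map Sum.inr ⊔ d.rel.map (Sum.map id Sum.inl)

/-- The first three layers of a triple juxtaposition. -/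
def firstThree : Fin n ⊕ Fin n ⊕ Fin n → Fin n ⊕ Fin n ⊕ Fin n ⊕ Fin n :=
  Sum.map id (Sum.map id Sum.inl)

/-- Layers one, three and four. -/
def skipSecond : Fin n ⊕ Fin n ⊕ Fin n → Fin n ⊕ Fin n ⊕ Fin n ⊕ Fin n :=
  Sum.map id Sum.inr

/-- Layers one, two and four. -/
def skipThird : Fin n ⊕ Fin n ⊕ Fin n → Fin n ⊕ Fin n ⊕ Fin n ⊕ Fin n :=
  Sum.map id (Sum.map id Sum.inr)

theorem firstThree_injective : Function.Injective (firstThree (n := n)) := by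
  rintro (x | x | x) (y | y | y) h <;> simp_all [firstThree]

theorem skipSecond_injective : Function.Injective (skipSecond (n := n)) := by
  rintro (x | x | x) (y | y | y) h <;> simp_all [skipSecond]

theorem skipThird_injective : Function.Injective (skipThird (n := n)) := by
  rintro (x | x | x) (y | y | y) h <;> simp_all [skipThird]

theorem triple_eq_right (d d' d'' : Diagram n) : triple d d' d'' =
    (juxtapose d' d'').map Sum.inr ⊔ (d.rel.map onLeft).map skipThird := by
  rw [triple, map_map]
  congr 2
  ext1 (x | x) <;> rfl

theorem triple_eq_left (d d' d'' : Diagram n) : triple d d' d'' =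
    (juxtapose d d').map firstThree ⊔ (d''.rel.map onRight).map skipSecond := by
  simp only [triple, juxtapose, map_sup, map_map]
  have h1 : firstThree ∘ onLeft = (Sum.map id Sum.inl : _ → Fin n ⊕ Fin n ⊕ Fin n ⊕ Fin n) := by
    ext1 (x | x) <;> rfl
  have h2 : firstThree ∘ onRight = (Sum.inr ∘ onLeft : _ → Fin n ⊕ Fin n ⊕ Fin n ⊕ Fin n) := by
    ext1 (x | x) <;> rfl
  have h3 : skipSecond ∘ onRight = (Sum.inr ∘ onRight : _ → Fin n ⊕ Fin n ⊕ Fin n ⊕ Fin n) := by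
    ext1 (x | x) <;> rfl
  rw [h1, h2, h3]
  ac_rfl

theorem pb_left : ∀ x y : Fin n ⊕ Fin n ⊕ Fin n, firstThree x = skipSecond y →
    ∃ p, exterior p = x ∧ onLeft p = y := by
  rintro (x | x | x) (y | y | y) h <;> simp_all [firstThree, skipSecond, exterior, onLeft]

theorem pb_right : ∀ x y : Fin n ⊕ Fin n ⊕ Fin n,
    (Sum.inr x : Fin n ⊕ Fin n ⊕ Fin n ⊕ Fin n) = skipThird y →
    ∃ p, exterior p = x ∧ onRight p = y := by
  rintro (x | x | x) (y | y | y) h <;> simp_all [skipThird, exterior, onRight]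

theorem juxtapose_comp_left (d d' d'' : Diagram n) :
    juxtapose (comp d d') d'' = (triple d d' d'').comap skipSecond := by
  rw [triple_eq_left, comap_pushout firstThree_injective skipSecond_injective
    (h := exterior) (k := onLeft) (by rintro (x | x) <;> rfl) pb_left]
  rfl

theorem juxtapose_comp_right (d d' d'' : Diagram n) :
    juxtapose d (comp d' d'') = (triple d d' d'').comap skipThird := by
  rw [triple_eq_right, comap_pushout Sum.inr_injective skipThird_injective
    (h := exterior) (k := onRight) (by rintro (x | x) <;> rfl) pb_right, sup_comm]
  rfl

theorem comp_assoc (d d' d'' : Diagram n) : comp (comp d d') d'' = comp d (comp d' d'') := by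
  ext1
  change (juxtapose (comp d d') d'').comap exterior = (juxtapose d (comp d' d'')).comap exterior
  rw [juxtapose_comp_left, juxtapose_comp_right, ← Setoid.comap_comp, ← Setoid.comap_comp]
  have h : skipSecond ∘ exterior = skipThird ∘ exterior (n := n) := by
    ext1 (x | x) <;> rfl
  rw [h]
  rfl

/-- The singletons of the three diagrams of a triple juxtaposition. -/
def tripleEnds (d d' d'' : Diagram n) : Set (Fin n ⊕ Fin n ⊕ Fin n ⊕ Fin n) :=
  Sum.inr '' strandEnds d' d'' ∪ skipThird '' (onLeft '' {p | d.IsSingleton p})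

theorem tripleEnds_eq (d d' d'' : Diagram n) : tripleEnds d d' d'' =
    firstThree '' strandEnds d d' ∪ skipSecond '' (onRight '' {p | d''.IsSingleton p}) := by
  simp only [tripleEnds, strandEnds, Set.image_union, Set.image_image]
  have h1 : ∀ p, firstThree (n := n) (onLeft p) = skipThird (onLeft p) := by
    rintro (x | x) <;> rfl
  have h2 : ∀ p, firstThree (n := n) (onRight p) = Sum.inr (onLeft p) := by
    rintro (x | x) <;> rfl
  have h3 : ∀ p, skipSecond (n := n) (onRight p) = Sum.inr (onRight p) := by
    rintro (x | x) <;> rfl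
  simp only [h1, h2, h3]
  ac_rfl

/-- Loops (`c = false`) or strings (`c = true`). -/
noncomputable def floating (c : Bool) (d d' : Diagram n) : ℕ :=
  (innerParts (juxtapose d d') (Set.range exterior) ∩
    {x | x ∈ partsMeeting (juxtapose d d') (strandEnds d d') ↔ c = true}).ncard

theorem floating_false (d d' : Diagram n) : floating false d d' = loops d d' := by
  simp only [floating, loops, Bool.false_eq_true, iff_false]; rfl

theorem floating_true (d d' : Diagram n) : floating true d d' = strings d d' := by
  simp only [floating, strings, iff_true]; rfl

theorem floating_cocycle (c : Bool) (d d' d'' : Diagram n) :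
    floating c d d' + floating c (comp d d') d'' =
      floating c d' d'' + floating c d (comp d' d'') := by
  have hl := count_pushout firstThree_injective skipSecond_injective
    (h := exterior) (k := onLeft) (by rintro (x | x) <;> rfl) pb_left
    (by rintro (x | x | x | x) <;> simp [firstThree, skipSecond])
    (juxtapose d d') (d''.rel.map onRight) (Set.range exterior) (strandEnds d d')
    (onRight '' {p | d''.IsSingleton p}) {p | (comp d d').IsSingleton p}
    (fun p => isSingleton_comp d d' p) c
  have hr := count_pushout Sum.inr_injective skipThird_injective
    (h := exterior) (k := onRight) (by rintro (x | x) <;> rfl) pb_right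
    (by rintro (x | x | x | x) <;> simp [skipThird])
    (juxtapose d' d'') (d.rel.map onLeft) (Set.range exterior) (strandEnds d' d'')
    (onLeft '' {p | d.IsSingleton p}) {p | (comp d' d'').IsSingleton p}
    (fun p => isSingleton_comp d' d'' p) c
  rw [← triple_eq_left, ← tripleEnds_eq] at hl
  rw [← triple_eq_right, sup_comm, Set.union_comm (onRight '' _)] at hr
  have hB : skipSecond '' Set.range (exterior (n := n)) = skipThird '' Set.range exterior := by
    have h : skipSecond ∘ exterior = skipThird ∘ exterior (n := n) := by
      ext1 (x | x) <;> rfl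
    rw [← Set.range_comp, ← Set.range_comp, h]
  rw [hB] at hl
  exact hl.symm.trans hr

instance : Monoid (Diagram n) where
  mul := comp
  one := identity n
  mul_assoc := comp_assoc
  one_mul := one_comp
  mul_one := comp_one

/-- The number of propagating lines of `d`, counted by their end points on the left side. -/
noncomputable def propagatingNumber (d : Diagram n) : ℕ :=
  {i : Fin n | ∃ j, d.rel (Sum.inl i) (Sum.inr j)}.ncard

/-- `d` is even if `n` minus the propagating number is even, otherwise it is odd. -/
def IsEven (d : Diagram n) : Prop := Even (n - d.propagatingNumber)

/-- The submonoid of Brauer partitions. -/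
def brauer (n : ℕ) : Submonoid (Diagram n) where
  carrier := {d | d.IsBrauer}
  mul_mem' := IsBrauer.comp
  one_mem' := identity_isBrauer

/-- The map `d ↦ (u ⊗ u⋆) ⊗ d`: adjoin singletons `{1}` and `{1'}` and shift `d`. -/
def adjoin {m : ℕ} (d : Diagram m) : Diagram (m + 1) where
  rel := d.rel.map (Sum.map Fin.succ Fin.succ)
  small := d.small.map (Sum.map_injective.2 ⟨Fin.succ_injective _, Fin.succ_injective _⟩)

end Diagram

/-! ### Twisted monoid algebras -/

/-- A normalized two-cocycle on a monoid with values in a commutative ring. -/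
structure Cocycle (S : Type*) [Monoid S] (k : Type*) [CommRing k] where
  val : S → S → k
  one_left : ∀ a, val 1 a = 1
  one_right : ∀ a, val a 1 = 1
  assoc : ∀ a b c, val a b * val (a * b) c = val b c * val a (b * c)

/-- The twisted monoid algebra: the free module on `S` with product
`a · b = val a b • (a * b)` on basis elements. -/
def TwistedAlgebra {S : Type*} [Monoid S] {k : Type*} [CommRing k] (_ : Cocycle S k) : Type _ :=
  S →₀ k

namespace TwistedAlgebra

variable {S : Type*} [Monoid S] {k : Type*} [CommRing k] (c : Cocycle S k)

noncomputable instance : AddCommGroup (TwistedAlgebra c) :=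
  inferInstanceAs (AddCommGroup (S →₀ k))

noncomputable instance : Module k (TwistedAlgebra c) := inferInstanceAs (Module k (S →₀ k))

/-- The basis element of `a : S`. -/
noncomputable def of (a : S) : TwistedAlgebra c := Finsupp.single a 1

/-- The multiplication as a bilinear map. -/
noncomputable def mulMap : TwistedAlgebra c →ₗ[k] TwistedAlgebra c →ₗ[k] TwistedAlgebra c :=
  Finsupp.linearCombination k fun a => Finsupp.linearCombination k fun b =>
    c.val a b • of c (a * b)

noncomputable instance : Mul (TwistedAlgebra c) := ⟨fun x y => mulMap c x y⟩

noncomputable instance : One (TwistedAlgebra c) := ⟨of c 1⟩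

theorem mul_def (x y : TwistedAlgebra c) : x * y = mulMap c x y := rfl

theorem one_def : (1 : TwistedAlgebra c) = of c 1 := rfl

theorem of_mul_of (a b : S) : of c a * of c b = c.val a b • of c (a * b) := by
  rw [mul_def, mulMap]
  erw [Finsupp.linearCombination_single, one_smul, Finsupp.linearCombination_single, one_smul]

theorem induction {p : TwistedAlgebra c → Prop} (x : TwistedAlgebra c) (h0 : p 0)
    (hadd : ∀ x y, p x → p y → p (x + y)) (hof : ∀ (r : k) a, p (r • of c a)) : p x := by
  refine Finsupp.induction_linear (motive := p) x h0 hadd ?_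
  intro a r
  have := hof r a
  rwa [show r • of c a = (Finsupp.single a r : S →₀ k) by
    exact (Finsupp.smul_single r a (1 : k)).trans (by rw [smul_eq_mul, mul_one])] at this

noncomputable instance : Ring (TwistedAlgebra c) :=
  { (inferInstance : AddCommGroup (TwistedAlgebra c)),
    (inferInstance : Mul (TwistedAlgebra c)),
    (inferInstance : One (TwistedAlgebra c)) with
    left_distrib := fun x y z => (mulMap c x).map_add y z
    right_distrib := fun x y z => by simp [mul_def]
    zero_mul := fun x => by simp [mul_def]
    mul_zero := fun x => by simp [mul_def]
    mul_assoc := fun x y z => by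
      induction x using induction c with
      | h0 => simp [mul_def]
      | hadd x x' hx hx' => simp only [mul_def, map_add, LinearMap.add_apply] at *; rw [hx, hx']
      | hof r a =>
        induction y using induction c with
        | h0 => simp [mul_def]
        | hadd y y' hy hy' => simp only [mul_def, map_add, LinearMap.add_apply] at *; rw [hy, hy']
        | hof s b =>
          induction z using induction c with
          | h0 => simp [mul_def]
          | hadd z z' hz hz' => simp only [mul_def, map_add] at *; rw [hz, hz']
          | hof t d =>
            have h : of c a * of c b * of c d = of c a * (of c b * of c d) := by
              rw [of_mul_of, of_mul_of, mul_def, mul_def, map_smul, map_smul, LinearMap.smul_apply,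
                ← mul_def, ← mul_def, of_mul_of, of_mul_of, smul_smul, smul_smul, c.assoc,
                mul_assoc]
            simp only [mul_def, map_smul, LinearMap.smul_apply] at *
            rw [h]
    one_mul := fun x => by
      induction x using induction c with
      | h0 => simp [mul_def]
      | hadd x y hx hy => simp only [mul_def, map_add] at *; rw [hx, hy]
      | hof r a =>
        rw [mul_def, map_smul, ← mul_def, one_def, of_mul_of, c.one_left, one_mul, one_smul]
    mul_one := fun x => by
      induction x using induction c with
      | h0 => simp [mul_def]
      | hadd x y hx hy => simp only [mul_def, map_add, LinearMap.add_apply] at *; rw [hx, hy]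
      | hof r a =>
        rw [mul_def, map_smul, LinearMap.smul_apply, ← mul_def, one_def, of_mul_of, c.one_right,
          mul_one, one_smul] }

noncomputable instance : Algebra k (TwistedAlgebra c) :=
  Algebra.ofModule (fun r x y => by simp [mul_def]) (fun r x y => by simp [mul_def])

end TwistedAlgebra

/-! ### Partial Brauer algebras and Brauer algebras -/

section Algebras

variable {k : Type u} [CommRing k]

/-- The straightening factor of `R_n(δ, δ')`: `δ` for every loop, `δ'` for every open string. -/
noncomputable def straightening (n : ℕ) (δ δ' : k) : Cocycle (Diagram n) k where
  val d d' := δ ^ d.loops d' * δ' ^ d.strings d'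
  one_left d := by
    have h := Diagram.inner_one_left d
    change δ ^ (Diagram.identity n).loops d * δ' ^ (Diagram.identity n).strings d = 1
    simp [Diagram.loops, Diagram.strings, h]
  one_right d := by
    have h := Diagram.inner_one_right d
    change δ ^ d.loops (Diagram.identity n) * δ' ^ d.strings (Diagram.identity n) = 1
    simp [Diagram.loops, Diagram.strings, h]
  assoc a b c := by
    have h1 := Diagram.floating_cocycle false a b c
    have h2 := Diagram.floating_cocycle true a b c
    simp only [Diagram.floating_false, Diagram.floating_true] at h1 h2
    change δ ^ a.loops b * δ' ^ a.strings b *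
        (δ ^ (a.comp b).loops c * δ' ^ (a.comp b).strings c) =
      δ ^ b.loops c * δ' ^ b.strings c *
        (δ ^ a.loops (b.comp c) * δ' ^ a.strings (b.comp c))
    rw [mul_mul_mul_comm, ← pow_add, ← pow_add, h1, h2, pow_add, pow_add, mul_mul_mul_comm]

/-- The partial Brauer algebra `R_n(δ, δ')`. -/
abbrev PartialBrauerAlgebra (n : ℕ) (δ δ' : k) : Type u := TwistedAlgebra (straightening n δ δ')

/-- The straightening factor of the Brauer algebra `B_n(δ)`: `δ` for every loop. -/
noncomputable def brauerStraightening (n : ℕ) (δ : k) : Cocycle (Diagram.brauer n) k where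
  val d d' := δ ^ d.1.loops d'.1
  one_left d := by simpa [straightening] using (straightening n δ 1).one_left d.1
  one_right d := by simpa [straightening] using (straightening n δ 1).one_right d.1
  assoc a b c := by simpa [straightening] using (straightening n δ 1).assoc a.1 b.1 c.1

/-- The Brauer algebra `B_n(δ)`. -/
abbrev BrauerAlgebra (n : ℕ) (δ : k) : Type u := TwistedAlgebra (brauerStraightening n δ)

end Algebras

/-! ### The partial Brauer algebra with `δ = δ' = 1` -/

section Degenerate

variable (k : Type u) [CommRing k] (n : ℕ)

/-- `R_n = R_n(1, 1)`. -/
abbrev R : Type u := PartialBrauerAlgebra n (1 : k) (1 : k)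

variable {n}

/-- A diagram as a basis element of `R_n`. -/
noncomputable abbrev diag (d : Diagram n) : R k n := TwistedAlgebra.of _ d

/-- The idempotent `û_{n,i} = 1 - u_{n,i}` (recall that `δ' = 1`). -/
noncomputable def uHat (i : Fin n) : R k n := 1 - diag k (Diagram.cut {i})

open Classical in
/-- The product `û_X` of the `û_{n,i}`, `i ∈ X`, taken in increasing order (the factors commute). -/
noncomputable def uHatProd (X : Set (Fin n)) : R k n :=
  ((List.finRange n).map fun i => if i ∈ X then uHat k i else 1).prod

/-- The element `⟨d⟩` obtained from `d` by decorating all pair parts: `⟨d⟩ = û_{l(d)} d û_{r(d)}`,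
where `l(d)` and `r(d)` are the sets of non-singletons on the left and on the right. -/
noncomputable def decorated (d : Diagram n) : R k n :=
  uHatProd k {i | ¬ d.IsSingleton (Sum.inl i)} * diag k d *
    uHatProd k {i | ¬ d.IsSingleton (Sum.inr i)}

variable (n)

/-- The idempotent `û_n`, the product of all `û_{n,i}`. -/
noncomputable def uHatAll : R k n := uHatProd k Set.univ

/-- The idempotent `ω = ω_{{1}} = ⟨u_{n,1}⟩` of `R_n`, where `n = m + 1`. -/
noncomputable def omega (m : ℕ) : R k (m + 1) := decorated k (Diagram.cut {0})

/-- The even summand `R_n^0`, spanned by the `⟨d⟩` with `d` even. -/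
noncomputable def evenPart : Submodule k (R k n) :=
  Submodule.span k (decorated k '' {d | d.IsEven})

/-- The odd summand `R_n^1`, spanned by the `⟨d⟩` with `d` odd. -/
noncomputable def oddPart : Submodule k (R k n) :=
  Submodule.span k (decorated k '' {d | ¬ d.IsEven})

end Degenerate

/-! ### Ring summands, corner rings and the functors -/

section Functors

open CategoryTheory

/-- The submodule `S` of `A` is a two-sided ideal that has the identity element `e`.  Then `S` is a
ring with identity `e`, and `A` is the direct product of the rings `S` and `(1 - e)A`. -/
structure IsRingSummand {k A : Type*} [CommRing k] [Ring A] [Algebra k A] (S : Submodule k A)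
    (e : A) : Prop where
  mul_mem_left : ∀ a, ∀ x ∈ S, a * x ∈ S
  mul_mem_right : ∀ a, ∀ x ∈ S, x * a ∈ S
  mem : e ∈ S
  mul_left : ∀ x ∈ S, e * x = x
  mul_right : ∀ x ∈ S, x * e = x

namespace IsRingSummand

variable {k A : Type*} [CommRing k] [Ring A] [Algebra k A] {S : Submodule k A} {e : A}

/-- The ring structure on `S`, with the addition and multiplication of `A` and identity `e`. -/
def Carrier (_ : IsRingSummand S e) : Type _ := S

instance (h : IsRingSummand S e) : AddCommGroup h.Carrier := inferInstanceAs (AddCommGroup S)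

instance (h : IsRingSummand S e) : Ring h.Carrier :=
  { (inferInstance : AddCommGroup h.Carrier) with
    mul := fun x y => ⟨x.1 * y.1, h.mul_mem_left _ _ y.2⟩
    one := ⟨e, h.mem⟩
    left_distrib := fun x y z => Subtype.ext (mul_add x.1 y.1 z.1)
    right_distrib := fun x y z => Subtype.ext (add_mul x.1 y.1 z.1)
    zero_mul := fun x => Subtype.ext (zero_mul x.1)
    mul_zero := fun x => Subtype.ext (mul_zero x.1)
    mul_assoc := fun x y z => Subtype.ext (mul_assoc x.1 y.1 z.1)
    one_mul := fun x => Subtype.ext (h.mul_left x.1 x.2)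
    mul_one := fun x => Subtype.ext (h.mul_right x.1 x.2) }

/-- The projection `a ↦ e a` of `A` onto the ring summand `S`. -/
def proj (h : IsRingSummand S e) : A →+* h.Carrier where
  toFun a := ⟨e * a, h.mul_mem_right _ _ h.mem⟩
  map_one' := Subtype.ext (mul_one e)
  map_mul' a b := Subtype.ext (by
    change e * (a * b) = e * a * (e * b)
    rw [← mul_assoc (e * a) e b, h.mul_right _ (h.mul_mem_right a _ h.mem), mul_assoc])
  map_zero' := Subtype.ext (mul_zero e)
  map_add' a b := Subtype.ext (mul_add e a b)

end IsRingSummand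

section Corner

variable {A : Type u} [Ring A] {e : A}

/-- The corner ring `eAe` is an algebra. -/
instance cornerModule {k : Type*} [CommRing k] [Algebra k A] (h : IsIdempotentElem e) :
    Module k h.Corner where
  smul c x := ⟨c • x.1, by
    obtain ⟨h1, h2⟩ := (Subsemigroup.mem_corner_iff h).1 x.2
    exact (Subsemigroup.mem_corner_iff h).2
      ⟨by rw [mul_smul_comm, h1], by rw [smul_mul_assoc, h2]⟩⟩
  one_smul x := Subtype.ext (one_smul k x.1)
  mul_smul c d x := Subtype.ext (mul_smul c d x.1)
  smul_zero c := Subtype.ext (smul_zero c)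
  smul_add c x y := Subtype.ext (smul_add c x.1 y.1)
  add_smul c d x := Subtype.ext (add_smul c d x.1)
  zero_smul x := Subtype.ext (zero_smul k x.1)

instance cornerAlgebra {k : Type*} [CommRing k] [Algebra k A] (h : IsIdempotentElem e) :
    Algebra k h.Corner :=
  Algebra.ofModule (fun c x y => Subtype.ext (smul_mul_assoc c x.1 y.1))
    (fun c x y => Subtype.ext (mul_smul_comm c x.1 y.1))

/-- Right multiplication by an element `x` of `eAe` on the left ideal `Ae`. -/
def mulRight (h : IsIdempotentElem e) (x : h.Corner) :
    (Ideal.span {e} : Ideal A) →ₗ[A] (Ideal.span {e} : Ideal A) where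
  toFun a := ⟨a.1 * x.1, by
    rw [← ((Subsemigroup.mem_corner_iff h).1 x.2).2, ← mul_assoc]
    exact Ideal.mul_mem_left _ _ (Ideal.mem_span_singleton_self e)⟩
  map_add' a b := Subtype.ext (add_mul a.1 b.1 x.1)
  map_smul' r a := Subtype.ext (mul_assoc r a.1 x.1)

/-- `Hom_A(Ae, M)`. -/
def HomFrom (_ : IsIdempotentElem e) (M : Type*) [AddCommGroup M] [Module A M] : Type _ :=
  (Ideal.span {e} : Ideal A) →ₗ[A] M

variable (h : IsIdempotentElem e)

instance (M : Type*) [AddCommGroup M] [Module A M] : AddCommGroup (HomFrom h M) :=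
  inferInstanceAs (AddCommGroup ((Ideal.span {e} : Ideal A) →ₗ[A] M))

/-- The left action of `eAe` on `Hom_A(Ae, M)`: `(x f)(a) = f(a x)`. -/
instance (M : Type*) [AddCommGroup M] [Module A M] : Module h.Corner (HomFrom h M) where
  smul x f := LinearMap.comp f (mulRight h x)
  one_smul f := LinearMap.ext fun a => by
    change f.toFun ⟨a.1 * e, _⟩ = f.toFun a
    congr 1
    refine Subtype.ext ?_
    obtain ⟨r, hr⟩ := Ideal.mem_span_singleton'.1 a.2
    change a.1 * e = a.1
    rw [← hr, mul_assoc, h.eq]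
  mul_smul x y f := LinearMap.ext fun a =>
    congrArg f.toFun (Subtype.ext (mul_assoc a.1 x.1 y.1).symm)
  smul_zero x := LinearMap.zero_comp _
  smul_add x f g := LinearMap.add_comp _ _ _
  add_smul x y f := LinearMap.ext fun a => by
    refine Eq.trans ?_ (f.map_add' (mulRight h x a) (mulRight h y a))
    exact congrArg f.toFun (Subtype.ext (mul_add a.1 x.1 y.1))
  zero_smul f := LinearMap.ext fun a => by
    refine Eq.trans ?_ (LinearMap.map_zero f)
    exact congrArg f.toFun (Subtype.ext (mul_zero a.1))

/-- Composition with `g : M → N`. -/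
def HomFrom.map {M N : Type*} [AddCommGroup M] [Module A M] [AddCommGroup N] [Module A N]
    (g : M →ₗ[A] N) : HomFrom h M →ₗ[h.Corner] HomFrom h N where
  toFun f := LinearMap.comp g f
  map_add' _ _ := LinearMap.comp_add _ _ _
  map_smul' _ _ := rfl

/-- The functor `Hom_A(Ae, -) : A-Mod ⥤ eAe-Mod`. -/
def homFunctor : ModuleCat.{u} A ⥤ ModuleCat.{u} h.Corner where
  obj M := ModuleCat.of h.Corner (HomFrom h M)
  map g := ModuleCat.ofHom (HomFrom.map h g.hom)
  map_id _ := rfl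
  map_comp _ _ := rfl

end Corner

/-- Let `S` be a ring summand of `A`, and `γ : B ≅ eAe` a ring isomorphism.  The functor
`S-Mod ⥤ A-Mod ⥤ eAe-Mod ≌ B-Mod` induced by `Hom_A(Ae, -)`. -/
noncomputable def inducedFunctor {k A B : Type u} [CommRing k] [Ring A] [Algebra k A] [Ring B] [Algebra k B]
    {S : Submodule k A} {i e : A} (hS : IsRingSummand S i) (he : IsIdempotentElem e)
    (γ : B ≃ₐ[k] he.Corner) : ModuleCat.{u} hS.Carrier ⥤ ModuleCat.{u} B :=
  ModuleCat.restrictScalars hS.proj ⋙ homFunctor he ⋙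
    ModuleCat.restrictScalars γ.toRingEquiv.toRingHom

end Functors

end PartialBrauer

namespace PartialBrauer

/-! Write ε_X = û_X ∏_{i∉X} u_i (`cutIdem`). The diagrams u_i are commuting idempotents, so
expanding ∏ (û_i + u_i) = 1 shows that the ε_X are orthogonal idempotents with sum 1. For every
diagram d, the product ε_X d ε_Y is either 0 or a decorated diagram ⟨c⟩ whose left and right
non-singletons are X and Y (`cutIdem_mul_diag_mul_cutIdem`). The non-singletons of c are matched in
pairs, so |X| + |Y| is even; hence the sum i of the ε_X with |X| odd is a central idempotent. A
parity count of propagating lines identifies iR_n with the even summand when n is odd and with the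
odd summand when n is even, so one argument serves both statements.

The product rule for ⟨d⟩ and ⟨d'⟩ with matching middle supports is the heart of the matter. A factor
u at a vertex of d|d' can be slid along its component (`insertCut_eq_of_connected`). If every middle
support vertex reaches the exterior, each u in the expansion of the middle û slides to the outside
and is killed there, and ⟨d⟩⟨d'⟩ = ⟨dd'⟩. If some middle support vertex lies on a floating
component, cutting this component does not change dd' because δ = δ' = 1, so the factor 1 - u kills
the product. Loops therefore count as 0, and ε_Z R_n ε_Z is the Brauer algebra of rank |Z| with
parameter 0.

Finally, let Z have the largest odd cardinality. If |X| is odd, a zigzag factors the identity on X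
through Z without closed loops (`exists_factorization`), so ε_X lies in R_n ε_Z R_n. Hence i = ∑ a_j
e b_j with e = ε_Z, and Hom(Ae, -) is an equivalence from iA-modules to eAe-modules by Morita
theory, where A = R_n. The same formula transports finite generating sets in both directions. -/

theorem SmallParts.eq_of_ne {V : Type*} {r : Setoid V} (hr : SmallParts r) {a b c : V}
    (hb : r a b) (hc : r a c) (hab : a ≠ b) (hac : a ≠ c) : b = c := by
  rcases hr _ _ _ hb hc with h | h | h
  · exact absurd h hab
  · exact absurd h hac
  · exact h

/-- A vertex that is isolated in two set partitions is isolated in their join. -/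
theorem IsolatedIn.sup {V : Type*} {r s : Setoid V} {v : V} (hr : IsolatedIn r v)
    (hs : IsolatedIn s v) : IsolatedIn (r ⊔ s) v := by
  -- `T` has the parts {v} and its complement. It is the coarsest partition in which `v` is
  -- isolated, so it lies above both `r` and `s`.
  let T : Setoid V := ⟨fun a b => (a = v ↔ b = v),
    ⟨fun _ => Iff.rfl, fun h => h.symm, fun h h' => h.trans h'⟩⟩
  have key : ∀ t : Setoid V, IsolatedIn t v → t ≤ T := by
    intro t ht a b hab
    constructor
    · rintro rfl; exact ht _ hab
    · rintro rfl; exact ht _ (t.symm' hab)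
  intro u hu
  exact ((sup_le (key r hr) (key s hs)) hu).1 rfl

/-- A finite set of vertices, in which every vertex is joined to another one, has even
cardinality. -/
theorem even_card_of_paired {V : Type*} {r : Setoid V} (hr : SmallParts r) (Q : Finset V)
    (hQ : ∀ p ∈ Q, ∃ q ∈ Q, q ≠ p ∧ r p q) : Even Q.card := by
  classical
  choose! g hgQ hgne hg using hQ
  -- The partner map is an involution without fixed points, so the terms cancel in pairs modulo 2.
  have : ∑ _x ∈ Q, (1 : ZMod 2) = 0 := by
    refine Finset.sum_involution (fun p _ => g p) ?_ ?_ ?_ ?_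
    · intro p _; decide
    · intro p hp _; exact hgne p hp
    · intro p hp; exact hgQ p hp
    · intro p hp
      have h1 := hg p hp
      exact hr.eq_of_ne (hg _ (hgQ p hp)) (r.symm' h1) (hgne _ (hgQ p hp)).symm (hgne p hp)
  rw [Finset.sum_const, nsmul_eq_mul, mul_one] at this
  exact (ZMod.natCast_eq_zero_iff_even).1 this

/-! ### Diagrams: splitting parts, supports and parity. -/

namespace Diagram

variable {n : ℕ}

theorem mul_def (d d' : Diagram n) : d * d' = comp d d' := rfl

/-- A pair cannot grow in a coarser partition with small parts, so coarsening could only merge two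
singletons, which the second hypothesis forbids. This reduces equalities of diagrams to one
inclusion and a comparison of singletons, for which `isSingleton_comp` is available. -/
theorem eq_of_le {d d' : Diagram n} (hle : d.rel ≤ d'.rel)
    (hs : ∀ p, d.IsSingleton p → d'.IsSingleton p) : d = d' := by
  ext1
  refine le_antisymm hle ?_
  intro p q hpq
  by_cases h : p = q
  · rw [h]
  · by_cases hp : d.IsSingleton p
    · exact absurd (hs p hp q hpq).symm h
    · simp only [IsSingleton, IsolatedIn, not_forall] at hp
      obtain ⟨q', h1, h2⟩ := hp
      rwa [d'.small.eq_of_ne hpq (hle h1) h (Ne.symm h2)]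

/-- The diagram obtained from `d` by splitting all parts that meet `P` into singletons. -/
def isolate (d : Diagram n) (P : Set (Fin n ⊕ Fin n)) : Diagram n where
  rel :=
    { r := fun p q => p = q ∨ (d.rel p q ∧ p ∉ P ∧ q ∉ P)
      iseqv := by
        refine ⟨fun _ => Or.inl rfl, ?_, ?_⟩
        · rintro p q (h | ⟨h, h1, h2⟩)
          · exact Or.inl h.symm
          · exact Or.inr ⟨d.rel.symm' h, h2, h1⟩
        · rintro p q s (rfl | ⟨h, h1, h2⟩) (rfl | ⟨h', h1', h2'⟩)
          · exact Or.inl rfl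
          · exact Or.inr ⟨h', h1', h2'⟩
          · exact Or.inr ⟨h, h1, h2⟩
          · exact Or.inr ⟨d.rel.trans' h h', h1, h2'⟩ }
  small := by
    rintro p q s (rfl | ⟨h, -⟩) (rfl | ⟨h', -⟩)
    · simp
    · simp
    · simp
    · exact d.small _ _ _ h h'

theorem isolate_le (d : Diagram n) (P : Set (Fin n ⊕ Fin n)) : (d.isolate P).rel ≤ d.rel := by
  rintro p q (rfl | ⟨h, -⟩)
  · exact d.rel.refl' _
  · exact h

theorem isSingleton_isolate {d : Diagram n} {P : Set (Fin n ⊕ Fin n)} {p : Fin n ⊕ Fin n} :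
    (d.isolate P).IsSingleton p ↔ d.IsSingleton p ∨ ∃ q ∈ P, d.rel q p := by
  constructor
  · intro h
    by_contra! hcon
    obtain ⟨h1, h2⟩ := hcon
    simp only [IsSingleton, IsolatedIn, not_forall] at h1
    obtain ⟨q, hq, hne⟩ := h1
    refine hne (h q (Or.inr ⟨hq, fun hp => h2 p hp (d.rel.refl' _),
      fun hp => h2 q hp (d.rel.symm' hq)⟩))
  · rintro (h | ⟨q, hq, hqp⟩) s (rfl | ⟨h1, h2, h3⟩)
    · rfl
    · exact h _ h1
    · rfl
    · by_contra hne
      rcases d.small _ _ _ (d.rel.symm' hqp) h1 with rfl | rfl | rfl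
      · exact h2 hq
      · exact hne rfl
      · exact h3 hq

theorem isolate_eq_self {d : Diagram n} {P : Set (Fin n ⊕ Fin n)}
    (h : ∀ p ∈ P, d.IsSingleton p) : d.isolate P = d := by
  refine eq_of_le (isolate_le d P) fun p hp => ?_
  rcases isSingleton_isolate.1 hp with hp | ⟨q, hq, hqp⟩
  · exact hp
  · obtain rfl := h q hq p hqp
    exact h _ hq

/-- Either operation splits the one part containing both vertices. This is what lets a factor u
slide from one end of a part to the other. -/
theorem isolate_singleton_congr {d : Diagram n} {p q : Fin n ⊕ Fin n} (h : d.rel p q) :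
    d.isolate {p} = d.isolate {q} := by
  have key : ∀ p q, d.rel p q → (d.isolate {p}).rel ≤ (d.isolate {q}).rel := by
    rintro p q h s t (rfl | ⟨h1, h2, h3⟩)
    · exact Or.inl rfl
    · by_cases hst : s = t
      · exact Or.inl hst
      · refine Or.inr ⟨h1, ?_, ?_⟩
        · rintro rfl
          exact h3 (d.small.eq_of_ne (d.rel.symm' h) h1 (fun h' => h2 h') hst).symm
        · rintro rfl
          exact h2 (d.small.eq_of_ne (d.rel.symm' h) (d.rel.symm' h1) (fun h' => h3 h')
            (Ne.symm hst)).symm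
  ext1
  exact le_antisymm (key p q h) (key q p (d.rel.symm' h))

theorem isSingleton_cut {X : Set (Fin n)} {p : Fin n ⊕ Fin n} :
    (cut X).IsSingleton p ↔ Sum.elim id id p ∈ X := by
  constructor
  · intro h
    by_contra hp
    rcases p with p | p
    · have := h (Sum.inr p) (Or.inr ⟨rfl, hp⟩); simp at this
    · have := h (Sum.inl p) (Or.inr ⟨rfl, hp⟩); simp at this
  · rintro h q (rfl | ⟨-, h'⟩)
    · rfl
    · exact absurd h h'

/-- For i outside `X` the left vertex i is carried straight to the equator, so nothing changes
there. For i in `X` both vertices i and i' of the left factor are loose, so the part of `d` at i is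
split. -/
theorem cut_mul (X : Set (Fin n)) (d : Diagram n) : cut X * d = d.isolate (Sum.inl '' X) := by
  refine (eq_of_le ?_ ?_).symm
  · have hc : ∀ p, p ∉ Sum.inl '' X → juxtapose (cut X) d (exterior p) (onRight p) := by
      rintro (p | p) hp
      · exact juxtapose_left (cut X) d (p := Sum.inl p) (q := Sum.inr p)
          (Or.inr ⟨rfl, fun h => hp ⟨p, h, rfl⟩⟩)
      · exact Setoid.refl' _ _
    rintro p q (rfl | ⟨h, h1, h2⟩)
    · exact Setoid.refl' _ _
    · change juxtapose (cut X) d (exterior p) (exterior q)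
      exact Setoid.trans' _ (hc p h1) (Setoid.trans' _ (juxtapose_right _ _ h)
        (Setoid.symm' _ (hc q h2)))
  · intro p hp
    rw [mul_def, isSingleton_comp]
    by_cases hpX : p ∈ Sum.inl '' X
    · obtain ⟨x, hx, rfl⟩ := hpX
      exact ⟨onLeft (Sum.inl x), Or.inl ⟨Sum.inl x, isSingleton_cut.2 hx, rfl⟩, Setoid.refl' _ _⟩
    · have hc : juxtapose (cut X) d (onRight p) (exterior p) := by
        rcases p with p | p
        · exact juxtapose_left (cut X) d (p := Sum.inr p) (q := Sum.inl p)
            (Or.inr ⟨rfl, fun h => hpX ⟨p, h, rfl⟩⟩)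
        · exact Setoid.refl' _ _
      rcases isSingleton_isolate.1 hp with h | ⟨_, ⟨x, hx, rfl⟩, h⟩
      · exact ⟨onRight p, Or.inr ⟨p, h, rfl⟩, hc⟩
      · exact ⟨onLeft (Sum.inr x), Or.inl ⟨Sum.inr x, isSingleton_cut.2 hx, rfl⟩,
          Setoid.trans' _ (juxtapose_right (cut X) d h) hc⟩

theorem mul_cut (X : Set (Fin n)) (d : Diagram n) : d * cut X = d.isolate (Sum.inr '' X) := by
  refine (eq_of_le ?_ ?_).symm
  · have hc : ∀ p, p ∉ Sum.inr '' X → juxtapose d (cut X) (exterior p) (onLeft p) := by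
      rintro (p | p) hp
      · exact Setoid.refl' _ _
      · exact juxtapose_right d (cut X) (p := Sum.inr p) (q := Sum.inl p)
          (Or.inr ⟨rfl, fun h => hp ⟨p, h, rfl⟩⟩)
    rintro p q (rfl | ⟨h, h1, h2⟩)
    · exact Setoid.refl' _ _
    · change juxtapose d (cut X) (exterior p) (exterior q)
      exact Setoid.trans' _ (hc p h1) (Setoid.trans' _ (juxtapose_left _ _ h)
        (Setoid.symm' _ (hc q h2)))
  · intro p hp
    rw [mul_def, isSingleton_comp]
    by_cases hpX : p ∈ Sum.inr '' X
    · obtain ⟨x, hx, rfl⟩ := hpX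
      exact ⟨onRight (Sum.inr x), Or.inr ⟨Sum.inr x, isSingleton_cut.2 hx, rfl⟩, Setoid.refl' _ _⟩
    · have hc : juxtapose d (cut X) (onLeft p) (exterior p) := by
        rcases p with p | p
        · exact Setoid.refl' _ _
        · exact juxtapose_right d (cut X) (p := Sum.inl p) (q := Sum.inr p)
            (Or.inr ⟨rfl, fun h => hpX ⟨p, h, rfl⟩⟩)
      rcases isSingleton_isolate.1 hp with h | ⟨_, ⟨x, hx, rfl⟩, h⟩
      · exact ⟨onLeft p, Or.inl ⟨p, h, rfl⟩, hc⟩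
      · exact ⟨onRight (Sum.inl x), Or.inr ⟨Sum.inl x, isSingleton_cut.2 hx, rfl⟩,
          Setoid.trans' _ (juxtapose_left d (cut X) h) hc⟩

theorem cut_singleton_mul (i : Fin n) (d : Diagram n) : cut {i} * d = d.isolate {Sum.inl i} := by
  rw [cut_mul, Set.image_singleton]

theorem mul_cut_singleton (i : Fin n) (d : Diagram n) : d * cut {i} = d.isolate {Sum.inr i} := by
  rw [mul_cut, Set.image_singleton]

theorem cut_mul_cut (X Y : Set (Fin n)) : cut X * cut Y = cut (X ∪ Y) := by
  rw [cut_mul]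
  refine (eq_of_le ?_ ?_).symm
  · rintro p q (rfl | ⟨h, h'⟩)
    · exact Or.inl rfl
    · simp only [Set.mem_union, not_or] at h'
      refine Or.inr ⟨Or.inr ⟨h, h'.2⟩, ?_, ?_⟩
      · rintro ⟨x, hx, rfl⟩; exact h'.1 hx
      · rintro ⟨x, hx, rfl⟩; exact h'.1 (h ▸ hx)
  · intro p hp
    rw [isSingleton_cut] at hp
    rw [isSingleton_isolate, isSingleton_cut]
    rcases hp with hp | hp
    · by_cases hY : Sum.elim id id p ∈ Y
      · exact Or.inl hY
      · exact Or.inr ⟨Sum.inl (Sum.elim id id p), ⟨_, hp, rfl⟩, Or.inr ⟨rfl, hY⟩⟩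
    · exact Or.inl hp

/-- Every vertex `i` of the equator of `d|d'` with `i ∈ X` is connected to the exterior. -/
def ConnectedOn (d d' : Diagram n) (X : Set (Fin n)) : Prop :=
  ∀ i ∈ X, ∃ p, juxtapose d d' (Sum.inr (Sum.inl i)) (exterior p)

theorem juxtapose_mono {d₁ d₂ d₁' d₂' : Diagram n} (h : d₁.rel ≤ d₂.rel) (h' : d₁'.rel ≤ d₂'.rel) :
    juxtapose d₁ d₁' ≤ juxtapose d₂ d₂' := by
  refine sup_le ?_ ?_
  · rw [map_le_iff]
    exact fun p q hpq => juxtapose_left _ _ (h hpq)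
  · rw [map_le_iff]
    exact fun p q hpq => juxtapose_right _ _ (h' hpq)

/-- The cut only breaks up a component that is invisible from the exterior. -/
theorem mul_cut_mul_of_not_connected {d d' : Diagram n} {i : Fin n}
    (h : ∀ p, ¬ juxtapose d d' (Sum.inr (Sum.inl i)) (exterior p)) :
    d * (cut {i} * d') = d * d' := by
  rw [cut_singleton_mul]
  have hle := juxtapose_mono (le_refl d.rel) (isolate_le d' {Sum.inl i})
  refine eq_of_le (fun p q hpq => hle hpq) fun p hp => ?_
  rw [mul_def, isSingleton_comp] at hp ⊢
  obtain ⟨e, he, hep⟩ := hp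
  rcases he with he | ⟨q, hq, rfl⟩
  · exact ⟨e, Or.inl he, hle hep⟩
  · rcases isSingleton_isolate.1 hq with hq | ⟨_, rfl, hq⟩
    · exact ⟨_, Or.inr ⟨q, hq, rfl⟩, hle hep⟩
    -- A singleton created by the cut lies in the component of the middle vertex `i`, which does not
    -- reach the exterior.
    · exact absurd (Setoid.trans' _ (juxtapose_right d d' hq) (hle hep)) (h p)

/-- The left non-singletons of `d`. -/
def leftSupport (d : Diagram n) : Set (Fin n) := {i | ¬ d.IsSingleton (Sum.inl i)}

/-- The right non-singletons of `d`. -/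
def rightSupport (d : Diagram n) : Set (Fin n) := {i | ¬ d.IsSingleton (Sum.inr i)}

theorem isolated_juxtapose_inl {d d' : Diagram n} {x : Fin n} (h : d.IsSingleton (Sum.inl x)) :
    IsolatedIn (juxtapose d d') (Sum.inl x) :=
  IsolatedIn.sup ((isolatedIn_map onLeft_injective (v := Sum.inl x)).2 h)
    (isolatedIn_map_of_notMem onRight_injective (by rintro ⟨q, hq⟩; simp [onRight] at hq))

theorem isolated_juxtapose_inr {d d' : Diagram n} {x : Fin n} (h : d'.IsSingleton (Sum.inr x)) :
    IsolatedIn (juxtapose d d') (Sum.inr (Sum.inr x)) :=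
  IsolatedIn.sup
    (isolatedIn_map_of_notMem onLeft_injective (by rintro ⟨q | q, hq⟩ <;> simp [onLeft] at hq))
    ((isolatedIn_map onRight_injective (v := Sum.inr x)).2 h)

theorem isolated_juxtapose_mid {d d' : Diagram n} {x : Fin n} (h : d.IsSingleton (Sum.inr x))
    (h' : d'.IsSingleton (Sum.inl x)) : IsolatedIn (juxtapose d d') (Sum.inr (Sum.inl x)) :=
  IsolatedIn.sup ((isolatedIn_map onLeft_injective (v := Sum.inr x)).2 h)
    ((isolatedIn_map onRight_injective (v := Sum.inl x)).2 h')

/-- With equal middle supports, a singleton on the equator is a singleton from both sides and hence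
isolated in the juxtaposition. No string starting on the equator can reach the exterior, so only
exterior singletons of the factors survive. -/
theorem isSingleton_mul_of_support_eq {d d' : Diagram n} (h : d.rightSupport = d'.leftSupport)
    {p : Fin n ⊕ Fin n} : (d * d').IsSingleton p ↔
      Sum.elim (fun i => d.IsSingleton (Sum.inl i)) (fun i => d'.IsSingleton (Sum.inr i)) p := by
  have hX : ∀ x, d.IsSingleton (Sum.inr x) ↔ d'.IsSingleton (Sum.inl x) := fun x =>
    not_iff_not.1 (Set.ext_iff.1 h x)
  have hmid : ∀ x, d.IsSingleton (Sum.inr x) →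
      ¬ juxtapose d d' (Sum.inr (Sum.inl x)) (exterior p) := by
    intro x hx hp
    have := isolated_juxtapose_mid hx ((hX x).1 hx) _ hp
    rcases p with p | p <;> simp [exterior] at this
  rw [mul_def, isSingleton_comp]
  constructor
  · rintro ⟨e, ⟨q | q, hq, rfl⟩ | ⟨q | q, hq, rfl⟩, he⟩
    · have := isolated_juxtapose_inl (d' := d') hq _ he
      obtain rfl := exterior_injective (a₂ := Sum.inl q) this
      exact hq
    · exact absurd he (hmid q hq)
    · exact absurd he (hmid q ((hX q).2 hq))
    · have := isolated_juxtapose_inr (d := d) hq _ he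
      obtain rfl := exterior_injective (a₂ := Sum.inr q) this
      exact hq
  · rcases p with p | p
    · exact fun hp => ⟨_, Or.inl ⟨_, hp, rfl⟩, Setoid.refl' _ _⟩
    · exact fun hp => ⟨_, Or.inr ⟨_, hp, rfl⟩, Setoid.refl' _ _⟩

theorem leftSupport_mul {d d' : Diagram n} (h : d.rightSupport = d'.leftSupport) :
    (d * d').leftSupport = d.leftSupport := by
  ext i; exact not_congr (isSingleton_mul_of_support_eq h)

theorem rightSupport_mul {d d' : Diagram n} (h : d.rightSupport = d'.leftSupport) :
    (d * d').rightSupport = d'.rightSupport := by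
  ext i; exact not_congr (isSingleton_mul_of_support_eq h)

theorem exists_partner_of_not_isSingleton {d : Diagram n} {p : Fin n ⊕ Fin n}
    (hp : ¬ d.IsSingleton p) : ∃ q, q ≠ p ∧ d.rel p q ∧ ¬ d.IsSingleton q := by
  simp only [IsSingleton, IsolatedIn, not_forall] at hp
  obtain ⟨q, hq, hne⟩ := hp
  exact ⟨q, hne, hq, fun h => hne (h p (d.rel.symm' hq)).symm⟩

/-- All non-singletons, on both sides together, are matched by the pairs. This constraint is what
makes the algebra split in two. -/
theorem even_ncard_support_add (d : Diagram n) :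
    Even (d.leftSupport.ncard + d.rightSupport.ncard) := by
  classical
  have h := even_card_of_paired d.small (Finset.univ.filter fun p => ¬ d.IsSingleton p) (by
    intro p hp
    obtain ⟨q, h1, h2, h3⟩ := exists_partner_of_not_isSingleton (Finset.mem_filter.1 hp).2
    exact ⟨q, by simpa using h3, h1, h2⟩)
  have hc : (Finset.univ.filter fun p => ¬ d.IsSingleton p).card =
      d.leftSupport.ncard + d.rightSupport.ncard := by
    rw [Set.ncard_eq_toFinset_card', Set.ncard_eq_toFinset_card', ← Finset.card_disjSum]
    congr 1
    ext (p | p) <;> simp only [Finset.mem_filter, Finset.mem_univ, true_and, Finset.inl_mem_disjSum,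
      Finset.inr_mem_disjSum, Set.mem_toFinset] <;> rfl
  rwa [hc] at h

/-- The left non-singletons off the propagating lines are matched among themselves, so they
contribute an even number. -/
theorem odd_propagatingNumber_iff (d : Diagram n) :
    Odd d.propagatingNumber ↔ Odd d.leftSupport.ncard := by
  classical
  set P : Set (Fin n) := {i : Fin n | ∃ j, d.rel (Sum.inl i) (Sum.inr j)} with hP
  have hPsub : P ⊆ d.leftSupport := by
    rintro i ⟨j, hj⟩ h
    have := h _ hj
    simp at this
  have h := even_card_of_paired d.small
    ((d.leftSupport \ P).toFinset.map ⟨Sum.inl, Sum.inl_injective⟩) (by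
    simp only [Finset.mem_map, Set.mem_toFinset, Function.Embedding.coeFn_mk]
    rintro _ ⟨i, ⟨hi, hiP⟩, rfl⟩
    obtain ⟨q | q, h1, h2, h3⟩ := exists_partner_of_not_isSingleton hi
    · refine ⟨_, ⟨q, ⟨h3, ?_⟩, rfl⟩, h1, h2⟩
      -- If the partner `q` were on a propagating line, its part would contain two different other
      -- vertices.
      rintro ⟨j, hj⟩
      have := d.small.eq_of_ne (d.rel.symm' h2) hj h1 (by simp)
      simp at this
    · exact absurd ⟨q, h2⟩ hiP)
  rw [Finset.card_map, ← Set.ncard_eq_toFinset_card'] at h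
  have h2 := Set.ncard_sdiff_add_ncard_of_subset hPsub (Set.toFinite _)
  change Odd P.ncard ↔ _
  rw [← h2, Nat.odd_add']
  simp [h]

theorem propagatingNumber_le (d : Diagram n) : d.propagatingNumber ≤ n := by
  refine (Set.ncard_le_ncard (Set.subset_univ _) (Set.toFinite _)).trans ?_
  simp

/-- Together with `not_isEven_iff_of_even`, this shows that the summands in the two statements have
the same description: the left support has odd size. -/
theorem IsEven_iff_of_odd (hn : Odd n) (d : Diagram n) : d.IsEven ↔ Odd d.leftSupport.ncard := by
  rw [← odd_propagatingNumber_iff, IsEven, Nat.even_sub d.propagatingNumber_le]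
  have := Nat.not_even_iff_odd.2 hn
  rw [← Nat.not_even_iff_odd]
  tauto

theorem not_isEven_iff_of_even (hn : Even n) (d : Diagram n) :
    ¬ d.IsEven ↔ Odd d.leftSupport.ncard := by
  rw [← odd_propagatingNumber_iff, IsEven, Nat.even_sub d.propagatingNumber_le,
    ← Nat.not_even_iff_odd]
  tauto

/-! ### Transport of partitions along injections of vertices. -/

section Bridge

variable {N M : ℕ} {f : Fin N → Fin n} {g : Fin M → Fin n} (hf : Function.Injective f)
  (hg : Function.Injective g) {r : Setoid (Fin N ⊕ Fin M)} (hr : SmallParts r)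

/-- The diagram given by a partition on the left vertices in the range of `f` and the right vertices
in the range of `g`, with all other vertices singletons. -/
def bridge : Diagram n where
  rel := r.map (Sum.map f g)
  small := hr.map (Sum.map_injective.2 ⟨hf, hg⟩)

theorem bridge_rel {p q : Fin N ⊕ Fin M} (h : r p q) :
    (bridge hf hg hr).rel (Sum.map f g p) (Sum.map f g q) := Setoid.le_comap_map h

theorem isSingleton_bridge {p : Fin N ⊕ Fin M} :
    (bridge hf hg hr).IsSingleton (Sum.map f g p) ↔ IsolatedIn r p :=
  isolatedIn_map (Sum.map_injective.2 ⟨hf, hg⟩)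

theorem isSingleton_bridge_of_notMem {p : Fin n ⊕ Fin n} (h : p ∉ Set.range (Sum.map f g)) :
    (bridge hf hg hr).IsSingleton p :=
  isolatedIn_map_of_notMem (Sum.map_injective.2 ⟨hf, hg⟩) h

theorem leftSupport_bridge (h : ∀ p, ¬ IsolatedIn r p) :
    (bridge hf hg hr).leftSupport = Set.range f := by
  ext i
  constructor
  · intro hi
    by_contra h
    refine hi (isSingleton_bridge_of_notMem hf hg hr ?_)
    rintro ⟨p | p, hp⟩ <;> simp at hp
    exact h ⟨p, hp⟩
  · rintro ⟨j, rfl⟩ h'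
    exact h _ ((isSingleton_bridge hf hg hr (p := Sum.inl j)).1 h')

theorem rightSupport_bridge (h : ∀ p, ¬ IsolatedIn r p) :
    (bridge hf hg hr).rightSupport = Set.range g := by
  ext i
  constructor
  · intro hi
    by_contra h
    refine hi (isSingleton_bridge_of_notMem hf hg hr ?_)
    rintro ⟨p | p, hp⟩ <;> simp at hp
    exact h ⟨p, hp⟩
  · rintro ⟨j, rfl⟩ h'
    exact h _ ((isSingleton_bridge hf hg hr (p := Sum.inr j)).1 h')

end Bridge

section Embed

variable {m : ℕ} {f : Fin m → Fin n} (hf : Function.Injective f)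

/-- The diagram `d` on the vertices in the range of `f`, with all other vertices singletons. -/
def embed (d : Diagram m) : Diagram n := bridge hf hf d.small

theorem embed_id (d : Diagram n) : embed Function.injective_id d = d := by
  ext1
  change d.rel.map (Sum.map id id) = d.rel
  rw [Sum.map_id_id]
  refine le_antisymm ?_ ?_
  · rw [map_le_iff]
    exact fun _ _ h => h
  · exact fun p q h => Setoid.le_comap_map (f := id) h

theorem embed_rel {d : Diagram m} {p q : Fin m ⊕ Fin m} (h : d.rel p q) :
    (embed hf d).rel (Sum.map f f p) (Sum.map f f q) := Setoid.le_comap_map h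

theorem isSingleton_embed {d : Diagram m} {p : Fin m ⊕ Fin m} :
    (embed hf d).IsSingleton (Sum.map f f p) ↔ d.IsSingleton p := isSingleton_bridge hf hf d.small

theorem leftSupport_embed {d : Diagram m} (hd : d.IsBrauer) :
    (embed hf d).leftSupport = Set.range f := leftSupport_bridge hf hf d.small hd

theorem rightSupport_embed {d : Diagram m} (hd : d.IsBrauer) :
    (embed hf d).rightSupport = Set.range f := rightSupport_bridge hf hf d.small hd

theorem embed_one : embed hf 1 = cut (Set.range f)ᶜ := by
  refine eq_of_le ?_ ?_
  · change (identity m).rel.map _ ≤ _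
    rw [map_le_iff]
    intro p q hpq
    rw [identity_rel] at hpq
    refine Or.inr ?_
    rcases p with p | p <;> rcases q with q | q <;> simp_all
  · intro p hp
    rw [isSingleton_cut]
    rintro ⟨x, hx⟩
    -- The constant maps keep the side of `p` and replace its index by the preimage `x`.
    have : p = Sum.map f f (Sum.map (fun _ => x) (fun _ => x) p) := by
      rcases p with p | p <;> simp_all
    rw [this, isSingleton_embed] at hp
    exact identity_isBrauer _ hp

theorem juxtapose_embed (d d' : Diagram m) : juxtapose (embed hf d) (embed hf d') =
    (juxtapose d d').map (Sum.map f (Sum.map f f)) := by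
  simp only [juxtapose, embed, bridge, map_sup, map_map]
  congr 2
  ext1 (x | x) <;> rfl

/-- The vertices outside the range of `f` are isolated in the juxtaposition and create no
connections. For Brauer partitions these are also the only singletons on either side of the
equation. -/
theorem embed_mul {d d' : Diagram m} (hd : d.IsBrauer) (hd' : d'.IsBrauer) :
    embed hf (d * d') = embed hf d * embed hf d' := by
  have h : (embed hf d).rightSupport = (embed hf d').leftSupport := by
    rw [leftSupport_embed hf hd', rightSupport_embed hf hd]
  refine eq_of_le ?_ fun p hp => ?_
  · refine map_le_iff.2 fun p q hpq => ?_
    change juxtapose (embed hf d) (embed hf d') _ _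
    rw [juxtapose_embed]
    have := Setoid.le_comap_map (f := Sum.map f (Sum.map f f)) (show juxtapose d d' _ _ from hpq)
    rcases p with p | p <;> rcases q with q | q <;> exact this
  · have hb : (d * d').IsBrauer := hd.comp hd'
    rw [isSingleton_mul_of_support_eq h]
    by_contra hcon
    rcases p with p | p
    · have : p ∈ (embed hf d).leftSupport := hcon
      rw [leftSupport_embed hf hd, ← leftSupport_embed hf hb] at this
      exact this hp
    · have : p ∈ (embed hf d').rightSupport := hcon
      rw [rightSupport_embed hf hd', ← rightSupport_embed hf hb] at this
      exact this hp

theorem connectedOn_embed {d d' : Diagram m} :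
    ConnectedOn (embed hf d) (embed hf d') (Set.range f) ↔ ConnectedOn d d' Set.univ := by
  have hF : Function.Injective (Sum.map f (Sum.map f f)) :=
    Sum.map_injective.2 ⟨hf, Sum.map_injective.2 ⟨hf, hf⟩⟩
  have hE : ∀ p, exterior (Sum.map f f p) = Sum.map f (Sum.map f f) (exterior p) := by
    rintro (p | p) <;> rfl
  constructor
  · intro h i _
    obtain ⟨p, hp⟩ := h (f i) ⟨i, rfl⟩
    rw [juxtapose_embed, map_apply_of_injective hF] at hp
    rcases hp with ⟨a, b, hab, ha, hb⟩ | hp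
    · obtain rfl : a = Sum.inr (Sum.inl i) := hF ha
      rcases p with p | p <;> rcases b with b | b | b <;> simp [exterior] at hb
      · exact ⟨Sum.inl b, hab⟩
      · exact ⟨Sum.inr b, hab⟩
    · rcases p with p | p <;> simp [exterior] at hp
  · rintro h _ ⟨i, rfl⟩
    obtain ⟨p, hp⟩ := h i trivial
    refine ⟨Sum.map f f p, ?_⟩
    rw [juxtapose_embed, hE]
    exact Setoid.le_comap_map (f := Sum.map f (Sum.map f f)) hp

/-- Pulling `c` back along `f` loses nothing: the partner of a vertex in the range is again a
non-singleton, so it lies in the range. This gives surjectivity onto the corner ring. -/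
theorem exists_embed_eq {c : Diagram n} (hl : c.leftSupport = Set.range f)
    (hr : c.rightSupport = Set.range f) : ∃ d : Diagram m, d.IsBrauer ∧ embed hf d = c := by
  have hF : Function.Injective (Sum.map f f) := Sum.map_injective.2 ⟨hf, hf⟩
  have hmem : ∀ p, ¬ c.IsSingleton p ↔ p ∈ Set.range (Sum.map f f) := by
    rintro (p | p)
    · rw [show (¬ c.IsSingleton (Sum.inl p) ↔ p ∈ c.leftSupport) from Iff.rfl, hl]
      simp
    · rw [show (¬ c.IsSingleton (Sum.inr p) ↔ p ∈ c.rightSupport) from Iff.rfl, hr]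
      simp
  let d : Diagram m :=
    ⟨c.rel.comap (Sum.map f f), fun a b e hab hae => by
      simpa [hF.eq_iff] using c.small _ _ _ hab hae⟩
  have hd : d.IsBrauer := by
    intro p hp
    obtain ⟨q, h1, h2, h3⟩ := exists_partner_of_not_isSingleton ((hmem (Sum.map f f p)).2 ⟨p, rfl⟩)
    obtain ⟨q, rfl⟩ := (hmem q).1 h3
    exact h1 (congrArg _ (hp q h2))
  refine ⟨d, hd, eq_of_le (map_le_iff.2 fun _ _ h => h) fun p hp => ?_⟩
  by_contra hcon
  obtain ⟨p, rfl⟩ := (hmem p).1 hcon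
  exact hd _ ((isSingleton_embed hf).1 hp)

theorem embed_injective : Function.Injective (embed hf) := by
  intro d d' h
  have hF : Function.Injective (Sum.map f f) := Sum.map_injective.2 ⟨hf, hf⟩
  ext p q
  have key : ∀ d : Diagram m, d.rel p q ↔ (embed hf d).rel (Sum.map f f p) (Sum.map f f q) := by
    intro d
    constructor
    · exact embed_rel hf
    · intro h
      change d.rel.map _ _ _ at h
      rw [map_apply_of_injective hF] at h
      rcases h with ⟨a, b, hab, ha, hb⟩ | h
      · rwa [← hF ha, ← hF hb]
      · rw [hF h]
  change d.rel p q ↔ d'.rel p q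
  rw [key, key, h]

end Embed

/-- Without singletons there are no open strings, so every component away from the exterior is a
closed loop. The condition on the right is the one that governs products of decorated diagrams. -/
theorem loops_eq_zero_iff {d d' : Diagram n} (hd : d.IsBrauer) (hd' : d'.IsBrauer) :
    loops d d' = 0 ↔ ConnectedOn d d' Set.univ := by
  have he : strandEnds d d' = ∅ := by
    rw [Set.eq_empty_iff_forall_notMem]
    rintro _ (⟨q, hq, -⟩ | ⟨q, hq, -⟩)
    · exact hd q hq
    · exact hd' q hq
  have hm : partsMeeting (juxtapose d d') (strandEnds d d') = ∅ := by
    rw [he]; ext c; simp [partsMeeting]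
  rw [loops, hm, Set.sdiff_empty, Set.ncard_eq_zero (Set.toFinite _)]
  constructor
  · intro h i _
    by_contra! hi
    rw [Set.eq_empty_iff_forall_notMem] at h
    refine h (Quotient.mk _ (Sum.inr (Sum.inl i))) ?_
    rintro _ ⟨p, rfl⟩ hp
    exact hi p (Setoid.symm' _ (Quotient.exact hp))
  · intro h
    refine inner_eq_empty fun j => ?_
    obtain ⟨p, hp⟩ := h j trivial
    exact ⟨p, Setoid.symm' _ hp⟩

end Diagram

end PartialBrauer

namespace PartialBrauer

open Diagram

/-! ### The orthogonal idempotents of the diagrams u_{n,i}. -/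

section Algebra

variable (k : Type u) [CommRing k] {n : ℕ}

/-- With δ = δ' = 1 all straightening factors are 1, and the algebra is the ordinary monoid algebra
of diagrams. -/
theorem diag_mul_diag (d d' : Diagram n) : diag k d * diag k d' = diag k (d * d') := by
  rw [TwistedAlgebra.of_mul_of]
  change ((1 : k) ^ _ * 1 ^ _) • _ = _
  rw [one_pow, one_pow, one_mul, one_smul]

theorem commute_diag_cut (X Y : Set (Fin n)) :
    Commute (diag k (cut X)) (diag k (cut Y)) := by
  rw [Commute, SemiconjBy, diag_mul_diag, diag_mul_diag, cut_mul_cut, cut_mul_cut, Set.union_comm]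

/-- The diagrams `u_{n,i}` generate a commutative subalgebra, which is an image of a polynomial
ring. -/
theorem exists_cutHom : ∃ Θ : MvPolynomial (Fin n) k →ₐ[k] R k n,
    ∀ i, Θ (MvPolynomial.X i) = diag k (cut {i}) := by
  have hc : ∀ a ∈ Set.range (fun i : Fin n => diag k (cut {i})),
      ∀ b ∈ Set.range (fun i : Fin n => diag k (cut {i})), a * b = b * a := by
    rintro _ ⟨i, rfl⟩ _ ⟨j, rfl⟩
    exact commute_diag_cut k _ _
  have hcomm := Algebra.isMulCommutative_adjoin k hc
  -- Evaluation of polynomials needs a commutative target, hence the passage through the subalgebra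
  -- generated by the u_{n,i}.
  let _ : CommRing (Algebra.adjoin k (Set.range (fun i : Fin n => diag k (cut {i})))) :=
    { (inferInstance : Ring _) with mul_comm := hcomm.is_comm.comm }
  refine ⟨(Subalgebra.val _).comp (MvPolynomial.aeval (R := k) fun i =>
    (⟨diag k (cut {i}), Algebra.subset_adjoin ⟨i, rfl⟩⟩ :
      Algebra.adjoin k (Set.range (fun i : Fin n => diag k (cut {i}))))), fun i => ?_⟩
  simp

/-- The algebra homomorphism with `X_i ↦ u_{n,i}`. -/
noncomputable def cutHom : MvPolynomial (Fin n) k →ₐ[k] R k n := (exists_cutHom k).choose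

theorem cutHom_X (i : Fin n) : cutHom k (MvPolynomial.X i) = diag k (cut {i}) :=
  (exists_cutHom k).choose_spec i

theorem uHat_eq (i : Fin n) : uHat k i = cutHom k (1 - MvPolynomial.X i) := by
  rw [map_sub, map_one, cutHom_X]; rfl

-- This forgets the chosen order of the factors: products of the û_{n,i} can now be computed with
-- finite products and divisibility in a polynomial ring.
open Classical in
theorem uHatProd_eq (X : Set (Fin n)) :
    uHatProd k X = cutHom k (∏ i, if i ∈ X then 1 - MvPolynomial.X i else 1) := by
  rw [Fin.prod_univ_def, map_list_prod, List.map_map]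
  refine congrArg List.prod (List.map_congr_left fun i _ => ?_)
  simp only [Function.comp_apply]
  split_ifs
  · exact uHat_eq k i
  · rw [map_one]

theorem diag_cut_mul_self (i : Fin n) :
    diag k (cut {i}) * diag k (cut {i}) = diag k (cut {i}) := by
  rw [diag_mul_diag, cut_mul_cut, Set.union_self]

theorem cutHom_commute (p q : MvPolynomial (Fin n) k) : Commute (cutHom k p) (cutHom k q) := by
  rw [Commute, SemiconjBy, ← map_mul, ← map_mul, mul_comm]

theorem cutHom_commute_diag (p : MvPolynomial (Fin n) k) (i : Fin n) :
    Commute (cutHom k p) (diag k (cut {i})) := by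
  rw [← cutHom_X]; exact cutHom_commute k _ _

variable {k}

theorem diag_mul_of_isSingleton_left {d : Diagram n} {i : Fin n} (h : d.IsSingleton (Sum.inl i)) :
    diag k (cut {i}) * diag k d = diag k d := by
  rw [diag_mul_diag, cut_singleton_mul, isolate_eq_self]
  rintro p rfl; exact h

theorem diag_mul_of_isSingleton_right {d : Diagram n} {i : Fin n} (h : d.IsSingleton (Sum.inr i)) :
    diag k d * diag k (cut {i}) = diag k d := by
  rw [diag_mul_diag, mul_cut_singleton, isolate_eq_self]
  rintro p rfl; exact h

variable (k)

open Classical in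
/-- The idempotent `û_X u_{Xᶜ}`. -/
noncomputable def cutIdem (X : Set (Fin n)) : R k n :=
  cutHom k ((∏ i ∈ X.toFinset, (1 - MvPolynomial.X i)) * ∏ i ∈ Xᶜ.toFinset, MvPolynomial.X i)

variable {k}

theorem cutHom_mul_diag_cut_of_dvd {p : MvPolynomial (Fin n) k} {i : Fin n}
    (h : 1 - MvPolynomial.X i ∣ p) : cutHom k p * diag k (cut {i}) = 0 := by
  obtain ⟨q, rfl⟩ := h
  rw [mul_comm, map_mul, mul_assoc, map_sub, map_one, cutHom_X, sub_mul, one_mul,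
    diag_cut_mul_self, sub_self, mul_zero]

theorem cutHom_mul_diag_cut_of_X_dvd {p : MvPolynomial (Fin n) k} {i : Fin n}
    (h : MvPolynomial.X i ∣ p) : cutHom k p * diag k (cut {i}) = cutHom k p := by
  obtain ⟨q, rfl⟩ := h
  rw [mul_comm, map_mul, mul_assoc, cutHom_X, diag_cut_mul_self]

theorem cutIdem_mul_diag_of_mem {X : Set (Fin n)} {i : Fin n} (h : i ∈ X) :
    cutIdem k X * diag k (cut {i}) = 0 := by
  classical
  refine cutHom_mul_diag_cut_of_dvd (Dvd.dvd.mul_right ?_ _)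
  exact Finset.dvd_prod_of_mem (fun i => (1 - MvPolynomial.X i : MvPolynomial (Fin n) k))
    (by simpa using h)

theorem cutIdem_mul_diag_of_notMem {X : Set (Fin n)} {i : Fin n} (h : i ∉ X) :
    cutIdem k X * diag k (cut {i}) = cutIdem k X := by
  classical
  refine cutHom_mul_diag_cut_of_X_dvd (Dvd.dvd.mul_left ?_ _)
  exact Finset.dvd_prod_of_mem (fun i => (MvPolynomial.X i : MvPolynomial (Fin n) k))
    (by simpa using h)

theorem cutIdem_commute_diag (X : Set (Fin n)) (i : Fin n) :
    Commute (cutIdem k X) (diag k (cut {i})) := cutHom_commute_diag k _ i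

theorem diag_mul_cutIdem_of_mem {X : Set (Fin n)} {i : Fin n} (h : i ∈ X) :
    diag k (cut {i}) * cutIdem k X = 0 := by
  rw [← (cutIdem_commute_diag X i).eq, cutIdem_mul_diag_of_mem h]

theorem diag_mul_cutIdem_of_notMem {X : Set (Fin n)} {i : Fin n} (h : i ∉ X) :
    diag k (cut {i}) * cutIdem k X = cutIdem k X := by
  rw [← (cutIdem_commute_diag X i).eq, cutIdem_mul_diag_of_notMem h]

/-- Expand the product of (1 - X_i) + X_i = 1 over all i; the terms are indexed by the subsets. -/
theorem sum_cutIdem : ∑ X : Set (Fin n), cutIdem k X = 1 := by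
  classical
  have h := Finset.prod_add (fun i : Fin n => (1 - MvPolynomial.X i : MvPolynomial (Fin n) k))
    (fun i => MvPolynomial.X i) Finset.univ
  simp only [sub_add_cancel, Finset.prod_const_one, Finset.powerset_univ] at h
  rw [← map_one (cutHom k), h, map_sum]
  refine Fintype.sum_bijective (fun X : Set (Fin n) => X.toFinset) ?_ _ _ fun X => ?_
  · refine ⟨fun X Y h => Set.toFinset_inj.1 h, fun s => ⟨s, by simp⟩⟩
  · rw [cutIdem, Set.toFinset_compl, Finset.compl_eq_univ_sdiff]

/-- For an index i lying in exactly one of the two sets, u_i is absorbed by one idempotent and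
killed by the other. -/
theorem cutIdem_mul_cutIdem_of_ne {X Y : Set (Fin n)} (h : X ≠ Y) :
    cutIdem k X * cutIdem k Y = 0 := by
  by_cases hXY : ∃ i ∈ X, i ∉ Y
  · obtain ⟨i, hi, hi'⟩ := hXY
    rw [← diag_mul_cutIdem_of_notMem hi', ← mul_assoc, cutIdem_mul_diag_of_mem hi, zero_mul]
  · push Not at hXY
    obtain ⟨i, hi, hi'⟩ : ∃ i ∈ Y, i ∉ X := by
      by_contra! hYX
      exact h (Set.Subset.antisymm hXY hYX)
    rw [← cutIdem_mul_diag_of_notMem hi', mul_assoc, diag_mul_cutIdem_of_mem hi, mul_zero]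

theorem cutIdem_mul_self (X : Set (Fin n)) : cutIdem k X * cutIdem k X = cutIdem k X := by
  conv_rhs => rw [← mul_one (cutIdem k X), ← sum_cutIdem, Finset.mul_sum]
  rw [Finset.sum_eq_single X (fun Y _ h => cutIdem_mul_cutIdem_of_ne (Ne.symm h)) (by simp)]

open Classical in
theorem uHatProd_eq_prod (X : Set (Fin n)) :
    uHatProd k X = cutHom k (∏ i ∈ X.toFinset, (1 - MvPolynomial.X i)) := by
  rw [uHatProd_eq, Finset.prod_ite, Finset.prod_const_one, mul_one]
  congr 2
  ext i; simp

theorem uHatProd_mul_diag_of_mem {X : Set (Fin n)} {i : Fin n} (h : i ∈ X) :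
    uHatProd k X * diag k (cut {i}) = 0 := by
  classical
  rw [uHatProd_eq_prod]
  exact cutHom_mul_diag_cut_of_dvd
    (Finset.dvd_prod_of_mem (fun i => (1 - MvPolynomial.X i : MvPolynomial (Fin n) k))
      (by simpa using h))

theorem diag_mul_uHatProd_of_mem {X : Set (Fin n)} {i : Fin n} (h : i ∈ X) :
    diag k (cut {i}) * uHatProd k X = 0 := by
  classical
  rw [← uHatProd_mul_diag_of_mem h, uHatProd_eq_prod]
  exact (cutHom_commute_diag k _ i).eq.symm

theorem uHatProd_mul_self (X : Set (Fin n)) : uHatProd k X * uHatProd k X = uHatProd k X := by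
  classical
  have h : ∀ (s : Finset (Fin n)), s ⊆ X.toFinset → uHatProd k X *
      cutHom k (∏ i ∈ s, (1 - MvPolynomial.X i)) = uHatProd k X := by
    intro s
    induction s using Finset.induction_on with
    | empty => simp
    | insert i s hi ih =>
      intro hs
      rw [Finset.prod_insert hi, map_mul, map_sub, map_one, cutHom_X, ← mul_assoc, mul_sub, mul_one,
        uHatProd_mul_diag_of_mem (by simpa using hs (Finset.mem_insert_self i s)), sub_zero,
        ih ((Finset.subset_insert i s).trans hs)]
  nth_rw 2 [uHatProd_eq_prod]
  exact h _ (Finset.Subset.refl _)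

theorem cutHom_prod_X_mul (s : Finset (Fin n)) (x : R k n)
    (h : ∀ i ∈ s, diag k (cut {i}) * x = x) : cutHom k (∏ i ∈ s, MvPolynomial.X i) * x = x := by
  classical
  induction s using Finset.induction_on with
  | empty => simp
  | insert i s hi ih =>
    rw [Finset.prod_insert hi, map_mul, mul_assoc, ih fun j hj => h j (Finset.mem_insert_of_mem hj),
      cutHom_X, h i (Finset.mem_insert_self i s)]

theorem mul_cutHom_prod_X (s : Finset (Fin n)) (x : R k n)
    (h : ∀ i ∈ s, x * diag k (cut {i}) = x) : x * cutHom k (∏ i ∈ s, MvPolynomial.X i) = x := by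
  classical
  induction s using Finset.induction_on with
  | empty => simp
  | insert i s hi ih =>
    rw [Finset.prod_insert hi, map_mul, ← mul_assoc, cutHom_X, h i (Finset.mem_insert_self i s),
      ih fun j hj => h j (Finset.mem_insert_of_mem hj)]

theorem decorated_eq (d : Diagram n) :
    decorated k d = uHatProd k d.leftSupport * diag k d * uHatProd k d.rightSupport := rfl

/-- A diagram with a singleton at i absorbs u_i on that side, so the missing factors u_i can be
inserted for free. This places ⟨d⟩ in a single Peirce component. -/
theorem decorated_eq_cutIdem (d : Diagram n) :
    decorated k d = cutIdem k d.leftSupport * diag k d * cutIdem k d.rightSupport := by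
  classical
  have hl : cutIdem k d.leftSupport * diag k d = uHatProd k d.leftSupport * diag k d := by
    rw [cutIdem, map_mul, ← uHatProd_eq_prod, mul_assoc, cutHom_prod_X_mul]
    intro i hi
    refine diag_mul_of_isSingleton_left ?_
    exact not_not.1 (Set.mem_toFinset.1 hi)
  have hr : diag k d * cutIdem k d.rightSupport = diag k d * uHatProd k d.rightSupport := by
    rw [cutIdem, mul_comm, map_mul, ← uHatProd_eq_prod, ← mul_assoc, mul_cutHom_prod_X]
    intro i hi
    refine diag_mul_of_isSingleton_right ?_
    exact not_not.1 (Set.mem_toFinset.1 hi)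
  rw [decorated_eq, hl, mul_assoc, mul_assoc, hr]

theorem cutIdem_mul_decorated (d : Diagram n) :
    cutIdem k d.leftSupport * decorated k d = decorated k d := by
  rw [decorated_eq_cutIdem, ← mul_assoc, ← mul_assoc, cutIdem_mul_self]

theorem decorated_mul_cutIdem (d : Diagram n) :
    decorated k d * cutIdem k d.rightSupport = decorated k d := by
  rw [decorated_eq_cutIdem, mul_assoc, cutIdem_mul_self]

theorem leftSupport_cut (X : Set (Fin n)) : (cut X).leftSupport = Xᶜ := by
  ext i; exact not_congr isSingleton_cut

theorem rightSupport_cut (X : Set (Fin n)) : (cut X).rightSupport = Xᶜ := by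
  ext i; exact not_congr isSingleton_cut

theorem cutIdem_mul_diag_cut (X : Set (Fin n)) : cutIdem k X * diag k (cut Xᶜ) = cutIdem k X := by
  classical
  have h : ∀ (s : Finset (Fin n)), (↑s : Set (Fin n)) ⊆ Xᶜ →
      cutIdem k X * diag k (cut (↑s)) = cutIdem k X := by
    intro s
    induction s using Finset.induction_on with
    | empty => intro _; rw [Finset.coe_empty]; exact mul_one _
    | insert i s hi ih =>
      intro hs
      rw [Finset.coe_insert, Set.insert_eq, ← cut_mul_cut, ← diag_mul_diag, ← mul_assoc,
        cutIdem_mul_diag_of_notMem (hs (by simp)), ih fun j hj => hs (by simp at hj ⊢; tauto)]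
  have := h Xᶜ.toFinset
  rw [Set.coe_toFinset] at this
  exact this (Set.Subset.refl _)

theorem diag_cut_mul_cutIdem (X : Set (Fin n)) : diag k (cut Xᶜ) * cutIdem k X = cutIdem k X := by
  classical
  have h : ∀ (s : Finset (Fin n)), (↑s : Set (Fin n)) ⊆ Xᶜ →
      diag k (cut (↑s)) * cutIdem k X = cutIdem k X := by
    intro s
    induction s using Finset.induction_on with
    | empty => intro _; rw [Finset.coe_empty]; exact one_mul _
    | insert i s hi ih =>
      intro hs
      rw [Finset.coe_insert, Set.insert_eq, ← cut_mul_cut, ← diag_mul_diag, mul_assoc,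
        ih fun j hj => hs (by simp at hj ⊢; tauto), diag_mul_cutIdem_of_notMem (hs (by simp))]
  have := h Xᶜ.toFinset
  rw [Set.coe_toFinset] at this
  exact this (Set.Subset.refl _)

theorem decorated_cut (X : Set (Fin n)) : decorated k (cut Xᶜ) = cutIdem k X := by
  rw [decorated_eq_cutIdem, leftSupport_cut, rightSupport_cut, compl_compl, cutIdem_mul_diag_cut,
    cutIdem_mul_self]

/-- The idempotents absorb u_i outside `X` and `Y`, so `d` may be cut there. If the result `c` still
has a singleton inside `X` or `Y`, it absorbs a u_i that the idempotent kills; otherwise its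
supports are exactly `X` and `Y`. Hence the decorated diagrams with these supports span the Peirce
component. -/
theorem cutIdem_mul_diag_mul_cutIdem (X Y : Set (Fin n)) (d : Diagram n) :
    cutIdem k X * diag k d * cutIdem k Y = 0 ∨
      ∃ c : Diagram n, c.leftSupport = X ∧ c.rightSupport = Y ∧
        cutIdem k X * diag k d * cutIdem k Y = decorated k c := by
  set c : Diagram n := cut Xᶜ * d * cut Yᶜ with hc
  have h : cutIdem k X * diag k d * cutIdem k Y = cutIdem k X * diag k c * cutIdem k Y := by
    rw [hc, ← diag_mul_diag, ← diag_mul_diag, ← mul_assoc, ← mul_assoc, cutIdem_mul_diag_cut,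
      mul_assoc _ (diag k (cut Yᶜ)), diag_cut_mul_cutIdem]
  have hl : ∀ i ∉ X, c.IsSingleton (Sum.inl i) := by
    intro i hi
    rw [hc, mul_assoc, cut_mul, isSingleton_isolate]
    exact Or.inr ⟨Sum.inl i, ⟨i, hi, rfl⟩, Setoid.refl' _ _⟩
  have hr : ∀ i ∉ Y, c.IsSingleton (Sum.inr i) := by
    intro i hi
    rw [hc, mul_cut, isSingleton_isolate]
    exact Or.inr ⟨Sum.inr i, ⟨i, hi, rfl⟩, Setoid.refl' _ _⟩
  by_cases h1 : ∃ i ∈ X, c.IsSingleton (Sum.inl i)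
  · obtain ⟨i, hi, hs⟩ := h1
    left
    rw [h, ← diag_mul_of_isSingleton_left hs, ← mul_assoc, cutIdem_mul_diag_of_mem hi, zero_mul,
      zero_mul]
  by_cases h2 : ∃ i ∈ Y, c.IsSingleton (Sum.inr i)
  · obtain ⟨i, hi, hs⟩ := h2
    left
    rw [h, ← diag_mul_of_isSingleton_right hs, mul_assoc, mul_assoc, diag_mul_cutIdem_of_mem hi,
      mul_zero, mul_zero]
  push Not at h1 h2
  have hX : c.leftSupport = X := by
    ext i; exact ⟨fun hi => by_contra fun hX => hi (hl i hX), h1 i⟩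
  have hY : c.rightSupport = Y := by
    ext i; exact ⟨fun hi => by_contra fun hX => hi (hr i hX), h2 i⟩
  exact Or.inr ⟨c, hX, hY, by rw [h, decorated_eq_cutIdem, hX, hY]⟩

/-! ### Products of decorated diagrams -/

/-- The product `d b d'`, with `u` inserted at the vertex `v` of `d|d'`. -/
noncomputable def insertCut (d d' : Diagram n) (b : R k n) : Fin n ⊕ Fin n ⊕ Fin n → R k n :=
  Sum.elim (fun i => diag k (cut {i}) * (diag k d * b * diag k d'))
    (Sum.elim (fun i => diag k d * (diag k (cut {i}) * b) * diag k d')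
      (fun i => diag k d * b * diag k d' * diag k (cut {i})))

/-- Inserting u at a vertex splits the part there, and splitting at either end of a part is the
same, so u slides along parts of `d` and of `d'`. At the equator it passes from one diagram to the
other because it commutes with the polynomial in the u_i placed there. Equality of the resulting
products is an equivalence relation, so it contains the join of the two partitions. -/
theorem insertCut_eq_of_connected (d d' : Diagram n) (b : MvPolynomial (Fin n) k)
    {v w : Fin n ⊕ Fin n ⊕ Fin n} (h : juxtapose d d' v w) :
    insertCut d d' (cutHom k b) v = insertCut d d' (cutHom k b) w := by
  have hb := cutHom_commute_diag k b
  suffices juxtapose d d' ≤ Setoid.ker (insertCut d d' (cutHom k b)) from this h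
  have hl : ∀ p, insertCut d d' (cutHom k b) (onLeft p) =
      diag k (d.isolate {p}) * cutHom k b * diag k d' := by
    rintro (p | p)
    · rw [← cut_singleton_mul, ← diag_mul_diag]
      simp only [insertCut, onLeft, Sum.elim_inl, mul_assoc]
    · rw [← mul_cut_singleton, ← diag_mul_diag]
      simp only [insertCut, onLeft, Sum.elim_inl, Sum.elim_inr, mul_assoc]
  have hr : ∀ p, insertCut d d' (cutHom k b) (onRight p) =
      diag k d * cutHom k b * diag k (d'.isolate {p}) := by
    rintro (p | p)
    · rw [← cut_singleton_mul, ← diag_mul_diag]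
      simp only [insertCut, onRight, Sum.elim_inl, Sum.elim_inr]
      rw [← (hb p).eq]
      simp only [mul_assoc]
    · rw [← mul_cut_singleton, ← diag_mul_diag]
      simp only [insertCut, onRight, Sum.elim_inr, mul_assoc]
  refine sup_le ?_ ?_
  · rw [map_le_iff]
    intro p q hpq
    change insertCut _ _ _ (onLeft p) = insertCut _ _ _ (onLeft q)
    rw [hl, hl, isolate_singleton_congr hpq]
  · rw [map_le_iff]
    intro p q hpq
    change insertCut _ _ _ (onRight p) = insertCut _ _ _ (onRight q)
    rw [hr, hr, isolate_singleton_congr hpq]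

/-- Expand the middle factor û one index at a time. Each term with a u_i slides to an exterior
vertex, where the outer û kills it, so only the contribution of 1 remains. -/
theorem decorated_mul_decorated_of_connectedOn {d d' : Diagram n}
    (h : d.rightSupport = d'.leftSupport) (hc : ConnectedOn d d' d.rightSupport) :
    decorated k d * decorated k d' = decorated k (d * d') := by
  classical
  set L := d.leftSupport
  set X := d.rightSupport
  set Q := d'.rightSupport
  have step : ∀ (s : Finset (Fin n)), (∀ i ∈ s, i ∈ X) →
      uHatProd k L * (diag k d * cutHom k (∏ i ∈ s, (1 - MvPolynomial.X i)) * diag k d') *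
        uHatProd k Q = uHatProd k L * diag k (d * d') * uHatProd k Q := by
    intro s
    induction s using Finset.induction_on with
    | empty => intro _; rw [Finset.prod_empty, map_one, mul_one, diag_mul_diag]
    | insert i s hi ih =>
      intro hs
      rw [← ih fun j hj => hs j (Finset.mem_insert_of_mem hj), Finset.prod_insert hi, sub_mul,
        one_mul, map_sub, map_mul, cutHom_X, mul_sub, sub_mul, mul_sub, sub_mul, sub_eq_self]
      set b : MvPolynomial (Fin n) k := ∏ i ∈ s, (1 - MvPolynomial.X i)
      have hiX : i ∈ X := hs i (Finset.mem_insert_self i s)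
      obtain ⟨p, hp⟩ := hc i hiX
      have hins := insertCut_eq_of_connected d d' b hp
      change diag k d * (diag k (cut {i}) * cutHom k b) * diag k d' = _ at hins
      rw [hins]
      rcases p with p | p
      -- An exterior singleton is isolated in the juxtaposition, so it cannot be connected to the
      -- equator.
      · have hpL : p ∈ L := by
          intro hps
          have := isolated_juxtapose_inl (d' := d') hps _ (Setoid.symm' _ hp)
          simp at this
        change uHatProd k L * (diag k (cut {p}) * _) * _ = 0
        rw [← mul_assoc (uHatProd k L), uHatProd_mul_diag_of_mem hpL, zero_mul, zero_mul]
      · have hpQ : p ∈ Q := by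
          intro hps
          have := isolated_juxtapose_inr (d := d) hps _ (Setoid.symm' _ hp)
          simp at this
        change uHatProd k L * (_ * diag k (cut {p})) * _ = 0
        rw [← mul_assoc, mul_assoc _ (diag k (cut {p})), diag_mul_uHatProd_of_mem hpQ, mul_zero]
  have hX := step X.toFinset (by simp)
  rw [← uHatProd_eq_prod] at hX
  rw [decorated_eq (d * d'), leftSupport_mul h, rightSupport_mul h]
  change _ = uHatProd k L * diag k (d * d') * uHatProd k Q
  rw [← hX, decorated_eq, decorated_eq, ← h]
  change uHatProd k L * diag k d * uHatProd k X * (uHatProd k X * diag k d' * uHatProd k Q) = _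
  conv_rhs => rw [← uHatProd_mul_self X]
  simp only [mul_assoc]

/-- Expanding a factor of the product replaces `d` by `d` or by `d * cut {j}`, and the middle vertex
`i` stays disconnected in both. Once the product is used up, cutting at `i` does not change the
composition; as a loop and a string have the same weight 1, the two terms cancel. -/
theorem diag_mul_prod_mul_eq_zero {i : Fin n} (s : Finset (Fin n)) (d d' : Diagram n)
    (h : ∀ p, ¬ juxtapose d d' (Sum.inr (Sum.inl i)) (exterior p)) :
    diag k d * cutHom k (∏ i ∈ s, (1 - MvPolynomial.X i)) * ((1 - diag k (cut {i})) * diag k d')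
      = 0 := by
  classical
  induction s using Finset.induction_on generalizing d with
  | empty =>
    rw [Finset.prod_empty, map_one, mul_one, sub_mul, one_mul, mul_sub, diag_mul_diag,
      diag_mul_diag, diag_mul_diag, mul_cut_mul_of_not_connected h, sub_self]
  | insert j s hj ih =>
    have h' : ∀ p, ¬ juxtapose (d * cut {j}) d' (Sum.inr (Sum.inl i)) (exterior p) := by
      intro p hp
      rw [mul_cut] at hp
      exact h p (juxtapose_mono (isolate_le _ _) (le_refl _) hp)
    have h1 := ih d h
    have h2 := ih _ h'
    rw [← diag_mul_diag] at h2
    rw [Finset.prod_insert hj, map_mul, map_sub, map_one, cutHom_X,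
      ← mul_assoc (diag k d), mul_sub (diag k d), mul_one, sub_mul (diag k d), sub_mul, h1, h2,
      sub_self]

theorem decorated_mul_decorated_of_not_connectedOn {d d' : Diagram n}
    (h : d.rightSupport = d'.leftSupport) (hc : ¬ ConnectedOn d d' d.rightSupport) :
    decorated k d * decorated k d' = 0 := by
  classical
  simp only [ConnectedOn, not_forall, not_exists] at hc
  obtain ⟨i, hi, hc⟩ := hc
  have h1 := diag_mul_prod_mul_eq_zero (k := k) d.rightSupport.toFinset d d' hc
  rw [← uHatProd_eq_prod] at h1
  -- The middle û already contains the factor 1 - u_i, so a second copy of it may be split off.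
  have h2 : uHatProd k d.rightSupport * (1 - diag k (cut {i})) = uHatProd k d.rightSupport := by
    rw [mul_sub, mul_one, uHatProd_mul_diag_of_mem hi, sub_zero]
  have h3 : diag k d * uHatProd k d.rightSupport * diag k d' = 0 := by
    rw [← mul_assoc, mul_assoc (diag k d), h2] at h1
    exact h1
  rw [decorated_eq, decorated_eq, ← h]
  calc _ = uHatProd k d.leftSupport * (diag k d * (uHatProd k d.rightSupport *
        uHatProd k d.rightSupport) * diag k d') * uHatProd k d'.rightSupport := by
        simp only [mul_assoc]
    _ = 0 := by rw [uHatProd_mul_self, h3, mul_zero, zero_mul]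

/-! ### Coefficients of decorated diagrams -/

/-- The coefficient of the diagram `c`. -/
noncomputable def coeff (c : Diagram n) : R k n →ₗ[k] k := Finsupp.lapply c

open Classical in
theorem coeff_diag (c d : Diagram n) : coeff c (diag k d) = if d = c then 1 else 0 :=
  Finsupp.single_apply

/-- Every diagram occurring in u_i `x` has the left singleton i, whereas `c` does not. -/
theorem coeff_diag_cut_mul {c : Diagram n} {i : Fin n} (hi : i ∈ c.leftSupport) (x : R k n) :
    coeff c (diag k (cut {i}) * x) = 0 := by
  induction x using TwistedAlgebra.induction with
  | h0 => simp
  | hadd x y hx hy => rw [mul_add, map_add, hx, hy, add_zero]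
  | hof r d =>
    rw [mul_smul_comm, map_smul, diag_mul_diag, coeff_diag, if_neg, smul_zero]
    rintro rfl
    refine hi ?_
    rw [cut_mul, isSingleton_isolate]
    exact Or.inr ⟨_, ⟨i, rfl, rfl⟩, Setoid.refl' _ _⟩

theorem coeff_mul_diag_cut {c : Diagram n} {i : Fin n} (hi : i ∈ c.rightSupport) (x : R k n) :
    coeff c (x * diag k (cut {i})) = 0 := by
  induction x using TwistedAlgebra.induction with
  | h0 => simp
  | hadd x y hx hy => rw [add_mul, map_add, hx, hy, add_zero]
  | hof r d =>
    rw [smul_mul_assoc, map_smul, diag_mul_diag, coeff_diag, if_neg, smul_zero]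
    rintro rfl
    refine hi ?_
    rw [mul_cut, isSingleton_isolate]
    exact Or.inr ⟨_, ⟨i, rfl, rfl⟩, Setoid.refl' _ _⟩

theorem coeff_uHatProd_mul {c : Diagram n} {X : Set (Fin n)} (hX : X ⊆ c.leftSupport) (x : R k n) :
    coeff c (uHatProd k X * x) = coeff c x := by
  classical
  have h : ∀ s : Finset (Fin n), s ⊆ X.toFinset →
      coeff c (cutHom k (∏ i ∈ s, (1 - MvPolynomial.X i)) * x) = coeff c x := by
    intro s
    induction s using Finset.induction_on with
    | empty => simp
    | insert i s hi ih =>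
      intro hs
      rw [Finset.prod_insert hi, map_mul (cutHom k), map_sub, map_one, cutHom_X, sub_mul, one_mul,
        sub_mul, map_sub, mul_assoc, coeff_diag_cut_mul
          (hX (by simpa using hs (Finset.mem_insert_self i s))), sub_zero,
        ih ((Finset.subset_insert i s).trans hs)]
  rw [uHatProd_eq_prod]
  exact h _ (Finset.Subset.refl _)

theorem coeff_mul_uHatProd {c : Diagram n} {X : Set (Fin n)} (hX : X ⊆ c.rightSupport) (x : R k n) :
    coeff c (x * uHatProd k X) = coeff c x := by
  classical
  have h : ∀ s : Finset (Fin n), s ⊆ X.toFinset →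
      coeff c (x * cutHom k (∏ i ∈ s, (1 - MvPolynomial.X i))) = coeff c x := by
    intro s
    induction s using Finset.induction_on with
    | empty => simp
    | insert i s hi ih =>
      intro hs
      rw [Finset.prod_insert hi, mul_comm (1 - _), map_mul (cutHom k), map_sub (cutHom k), map_one,
        cutHom_X, mul_sub, mul_one, mul_sub, map_sub, ← mul_assoc, coeff_mul_diag_cut
          (hX (by simpa using hs (Finset.mem_insert_self i s))), sub_zero,
        ih ((Finset.subset_insert i s).trans hs)]
  rw [uHatProd_eq_prod]
  exact h _ (Finset.Subset.refl _)

/-- In the expansion of ⟨d⟩ every term other than `d` involves a u_i inside the support and so has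
an additional singleton. Decorated diagrams with given supports are therefore linearly independent.
-/
theorem coeff_decorated {c d : Diagram n} (hl : d.leftSupport = c.leftSupport)
    (hr : d.rightSupport = c.rightSupport) :
    coeff c (decorated k d) = coeff c (diag k d) := by
  rw [decorated_eq, coeff_mul_uHatProd hr.le, coeff_uHatProd_mul hl.le]

end Algebra

end PartialBrauer

namespace PartialBrauer

/-! ### Morita equivalence from a decomposition i = ∑ a_j e b_j. -/

section Morita

variable {k A : Type u} [CommRing k] [Ring A] [Algebra k A] {S : Submodule k A} {i e : A}

/-- Both sides equal `i * a * i`. -/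
theorem IsRingSummand.comm (hS : IsRingSummand S i) (a : A) : i * a = a * i := by
  rw [← hS.mul_left _ (hS.mul_mem_left a _ hS.mem), ← mul_assoc,
    hS.mul_right _ (hS.mul_mem_right a _ hS.mem)]

/-- The element `e y e` of the corner ring. -/
def cornerMk (he : IsIdempotentElem e) (y : A) : he.Corner :=
  ⟨e * y * e, (Subsemigroup.mem_corner_iff he).2
    ⟨by rw [← mul_assoc, ← mul_assoc, he.eq], by rw [mul_assoc, he.eq]⟩⟩

theorem e_mul_corner (he : IsIdempotentElem e) (x : he.Corner) : e * x.1 = x.1 :=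
  ((Subsemigroup.mem_corner_iff he).1 x.2).1

theorem corner_mul_e (he : IsIdempotentElem e) (x : he.Corner) : x.1 * e = x.1 :=
  ((Subsemigroup.mem_corner_iff he).1 x.2).2

theorem cornerMk_add (he : IsIdempotentElem e) (y z : A) :
    cornerMk he (y + z) = cornerMk he y + cornerMk he z :=
  Subtype.ext (by change e * (y + z) * e = e * y * e + e * z * e; rw [mul_add, add_mul])

theorem cornerMk_corner (he : IsIdempotentElem e) (x : he.Corner) : cornerMk he x.1 = x :=
  Subtype.ext (by change e * x.1 * e = x.1; rw [e_mul_corner, corner_mul_e])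

namespace HomFrom

variable (he : IsIdempotentElem e) {M N : Type*} [AddCommGroup M] [Module A M] [AddCommGroup N]
  [Module A N]

/-- Evaluation of a homomorphism `Ae → M` at `e`. -/
def ev : HomFrom he M →+ M where
  toFun f := (show (Ideal.span {e} : Ideal A) →ₗ[A] M from f)
    ⟨e, Ideal.mem_span_singleton_self e⟩
  map_zero' := rfl
  map_add' _ _ := rfl

/-- The homomorphism `Ae → M`, `a ↦ a m`. -/
def mk : M →+ HomFrom he M where
  toFun m := (LinearMap.toSpanSingleton A M m).comp (Submodule.subtype _)
  map_zero' := LinearMap.ext fun a => smul_zero a.1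
  map_add' m m' := LinearMap.ext fun a => smul_add a.1 m m'

theorem ev_mk (m : M) : ev he (mk he m) = e • m := rfl

/-- Every a in Ae satisfies a = a e. Evaluation at `e` thus identifies Hom(Ae, M) with eM, and `ev`
and `mk` replace the homomorphisms by elements from here on. -/
theorem apply_eq (f : HomFrom he M) (a : (Ideal.span {e} : Ideal A)) :
    (show (Ideal.span {e} : Ideal A) →ₗ[A] M from f) a = a.1 • ev he f := by
  obtain ⟨r, hr⟩ := Ideal.mem_span_singleton'.1 a.2
  have h : a = r • (⟨e, Ideal.mem_span_singleton_self e⟩ : (Ideal.span {e} : Ideal A)) :=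
    Subtype.ext hr.symm
  have h2 : a = a.1 • (⟨e, Ideal.mem_span_singleton_self e⟩ : (Ideal.span {e} : Ideal A)) := by
    refine Subtype.ext ?_
    change a.1 = a.1 * e
    rw [← hr, mul_assoc, he.eq]
  conv_lhs => rw [h2]
  exact LinearMap.map_smul _ _ _

theorem ev_injective : Function.Injective (ev he (M := M)) := by
  intro f g h
  refine LinearMap.ext fun a => ?_
  have h1 := apply_eq he f a
  rw [h, ← apply_eq he g a] at h1
  exact h1

theorem e_smul_ev (f : HomFrom he M) : e • ev he f = ev he f :=
  (apply_eq he f ⟨e, Ideal.mem_span_singleton_self e⟩).symm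

theorem mk_ev (f : HomFrom he M) : mk he (ev he f) = f :=
  ev_injective he (by rw [ev_mk, e_smul_ev])

theorem ev_smul (x : he.Corner) (f : HomFrom he M) : ev he (x • f) = x.1 • ev he f := by
  have h := apply_eq he f (mulRight he x ⟨e, Ideal.mem_span_singleton_self e⟩)
  refine Eq.trans h ?_
  change (e * x.1) • _ = _
  rw [e_mul_corner]

theorem ev_map (g : M →ₗ[A] N) (f : HomFrom he M) : ev he (map he g f) = g (ev he f) := rfl

theorem mk_smul_e_smul (x : A) (m : M) : mk he (x • e • m) = cornerMk he x • mk he m := by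
  refine ev_injective he ?_
  rw [ev_smul, ev_mk, ev_mk]
  change _ = (e * x * e) • e • m
  rw [smul_smul, smul_smul, smul_smul, mul_assoc (e * x), he.eq]

theorem mk_smul_ev (x : A) (f : HomFrom he M) : mk he (x • ev he f) = cornerMk he x • f := by
  conv_rhs => rw [← mk_ev he f]
  rw [← mk_smul_e_smul, e_smul_ev]

variable {he} {ι : Type*} [Fintype ι] {a b : ι → A} (hi : ∑ j, a j * e * b j = i)
  (hM : ∀ m : M, i • m = m)

include hi hM in
-- This is m = i m = ∑ a_j e b_j m: the module is recovered from eM.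
theorem sum_smul_ev_mk (m : M) : ∑ j, a j • ev he (mk he (b j • m)) = m := by
  conv_rhs => rw [← hM m, ← hi, Finset.sum_smul]
  exact Finset.sum_congr rfl fun j _ => by rw [ev_mk, smul_smul, smul_smul]

include hi hM in
theorem map_surjective (hN : ∀ m : N, i • m = m)
    (φ : HomFrom he M →ₗ[he.Corner] HomFrom he N) : ∃ g : M →ₗ[A] N, map he g = φ := by
  let g : M →+ N :=
    { toFun := fun m => ∑ j, a j • ev he (φ (mk he (b j • m)))
      map_zero' := by simp
      map_add' := fun m m' => by
        simp only [smul_add, map_add, Finset.sum_add_distrib] }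
  have hg : ∀ m, g m = ∑ j, a j • ev he (φ (mk he (b j • m))) := fun _ => rfl
  -- The formula for `g` is forced by m = ∑ a_j e b_j m. On x f(e) it gives ∑ a_j (e b_j x e)
  -- φ(f)(e) = i x φ(f)(e) by linearity of `φ` over eAe. Such elements generate `M` additively, so
  -- linearity over `A` follows, and x = 1 recovers `φ`.
  have key : ∀ (x : A) (f : HomFrom he M), g (x • ev he f) = x • ev he (φ f) := by
    intro x f
    rw [hg, ← hN (x • _), ← hi, Finset.sum_smul]
    refine Finset.sum_congr rfl fun j _ => ?_
    rw [smul_smul, mk_smul_ev, map_smul, ev_smul]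
    change a j • (e * (b j * x) * e) • _ = _
    rw [mul_smul (e * (b j * x)), e_smul_ev, smul_smul, smul_smul]
    simp only [mul_assoc]
  refine ⟨{ g with map_smul' := fun x m => ?_ }, LinearMap.ext fun f => ev_injective he ?_⟩
  · change g (x • m) = x • g m
    conv_lhs => rw [← sum_smul_ev_mk (he := he) hi hM m, Finset.smul_sum]
    rw [map_sum, hg, Finset.smul_sum]
    exact Finset.sum_congr rfl fun j _ => by rw [smul_smul, key, mul_smul]
  · rw [ev_map]
    change g (ev he f) = _
    have := key 1 f
    rwa [one_smul, one_smul] at this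

end HomFrom

section Summand

variable (hS : IsRingSummand S i) (he : IsIdempotentElem e)

theorem IsRingSummand.proj_coe (x : hS.Carrier) : hS.proj x.1 = x :=
  Subtype.ext (hS.mul_left _ x.2)

theorem IsRingSummand.proj_self : hS.proj i = 1 := Subtype.ext (hS.mul_left _ hS.mem)

variable {M : Type*} [AddCommGroup M] [Module hS.Carrier M] [Module A M]
  (hAM : ∀ (x : A) (m : M), x • m = hS.proj x • m)
  {ι : Type*} [Fintype ι] {a b : ι → A} (hi : ∑ j, a j * e * b j = i)

include hAM in
theorem IsRingSummand.smul_eq (x : hS.Carrier) (m : M) : x • m = x.1 • m := by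
  rw [hAM, hS.proj_coe]

include hAM hi in
-- If the elements m generate `M`, then the e b_j m generate eM, because e x m = ∑ (e x a_j e)(e b_j
-- m). Conversely, generators of eM generate `M`, because m = ∑ a_j (e b_j m).
theorem finite_iff_finite_homFrom :
    Module.Finite hS.Carrier M ↔ Module.Finite he.Corner (HomFrom he M) := by
  have hM : ∀ m : M, i • m = m := fun m => by rw [hAM, hS.proj_self, one_smul]
  constructor
  · rintro ⟨s, hs⟩
    let T : Set (HomFrom he M) :=
      (fun p : ι × M => HomFrom.mk he (b p.1 • p.2)) '' (Set.univ ×ˢ (↑s : Set M))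
    have hT : T.Finite := ((Set.finite_univ (α := ι)).prod s.finite_toSet).image _
    set W := Submodule.span he.Corner T with hW
    have key : ∀ m : M, ∀ x : A, HomFrom.mk he (x • m) ∈ W := by
      intro m
      have hm : m ∈ Submodule.span hS.Carrier (↑s : Set M) := by rw [hs]; trivial
      induction hm using Submodule.span_induction with
      | mem m hm =>
        intro x
        conv => rw [← HomFrom.sum_smul_ev_mk (he := he) hi hM m, Finset.smul_sum, map_sum]
        refine Submodule.sum_mem _ fun j _ => ?_
        rw [smul_smul, HomFrom.mk_smul_ev]
        exact Submodule.smul_mem _ _ (Submodule.subset_span ⟨(j, m), ⟨trivial, hm⟩, rfl⟩)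
      | zero => intro x; simp
      | add m m' _ _ hm hm' => intro x; rw [smul_add, map_add]; exact W.add_mem (hm x) (hm' x)
      | smul t m _ hm => intro x; rw [hS.smul_eq hAM, smul_smul]; exact hm _
    refine Module.Finite.of_fg_top ?_
    rw [Submodule.fg_def]
    refine ⟨T, hT, ?_⟩
    rw [← hW, eq_top_iff]
    intro f _
    have := key (HomFrom.ev he f) 1
    rwa [one_smul, HomFrom.mk_ev] at this
  · rintro ⟨s, hs⟩
    let T : Set M := HomFrom.ev he '' (↑s : Set (HomFrom he M))
    have hT : T.Finite := s.finite_toSet.image _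
    set W := Submodule.span hS.Carrier T with hW
    have hA : ∀ (x : A) (m : M), m ∈ W → x • m ∈ W := fun x m hm => by
      rw [hAM]; exact W.smul_mem _ hm
    have key : ∀ f, HomFrom.ev he f ∈ W := by
      intro f
      have hf : f ∈ Submodule.span he.Corner (↑s : Set (HomFrom he M)) := by rw [hs]; trivial
      induction hf using Submodule.span_induction with
      | mem f hf => exact Submodule.subset_span ⟨f, hf, rfl⟩
      | zero => rw [map_zero]; exact W.zero_mem
      | add f f' _ _ hf hf' => rw [map_add]; exact W.add_mem hf hf'
      | smul t f _ hf => rw [HomFrom.ev_smul]; exact hA _ _ hf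
    refine Module.Finite.of_fg_top ?_
    rw [Submodule.fg_def]
    refine ⟨T, hT, ?_⟩
    rw [← hW, eq_top_iff]
    intro m _
    rw [← HomFrom.sum_smul_ev_mk (he := he) hi hM m]
    exact W.sum_mem fun j _ => hA _ _ (key _)

/-- `Hom_{eAe}(eA, N)`, as the group of additive maps `f : A → N` with `f (x y) = x f(y)` for
`x ∈ eAe`. -/
def coind (N : Type*) [AddCommGroup N] [Module he.Corner N] : AddSubgroup (A →+ N) where
  carrier := {f | ∀ (x : he.Corner) (y : A), f (x.1 * y) = x • f y}
  zero_mem' := fun x y => (smul_zero x).symm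
  add_mem' := fun {f g} hf hg x y => by
    rw [AddMonoidHom.add_apply, AddMonoidHom.add_apply, hf, hg, smul_add]
  neg_mem' := fun {f} hf x y => by
    rw [AddMonoidHom.neg_apply, AddMonoidHom.neg_apply, hf, smul_neg]

variable (N : Type*) [AddCommGroup N] [Module he.Corner N]

/-- The defining condition at the identity e of the corner ring shows that f depends only on e y.
This is why additive maps on all of `A` can model maps on eA. -/
theorem coind_e_mul (f : coind he N) (y : A) : f.1 (e * y) = f.1 y := by
  have := f.2 1 y
  rwa [one_smul] at this

/-- The action `(x f)(y) = f (y x)` on `Hom_{eAe}(eA, N)`. -/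
abbrev coindModule (hie : i * e = e) : Module hS.Carrier (coind he N) where
  smul x f := ⟨f.1.comp (AddMonoidHom.mulRight x.1), fun c y => by
    change f.1 (c.1 * y * x.1) = c • f.1 (y * x.1)
    rw [mul_assoc, f.2]⟩
  one_smul f := Subtype.ext (AddMonoidHom.ext fun y => by
    change f.1 (y * i) = f.1 y
    rw [← coind_e_mul he N f, ← hS.comm, ← mul_assoc, ← hS.comm, hie, coind_e_mul])
  mul_smul x x' f := Subtype.ext (AddMonoidHom.ext fun y =>
    congrArg f.1 (mul_assoc y x.1 x'.1).symm)
  smul_zero x := rfl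
  smul_add x f g := rfl
  add_smul x x' f := Subtype.ext (AddMonoidHom.ext fun y => by
    change f.1 (y * (x.1 + x'.1)) = f.1 (y * x.1) + f.1 (y * x'.1)
    rw [mul_add, map_add])
  zero_smul f := Subtype.ext (AddMonoidHom.ext fun y => by
    change f.1 (y * 0) = 0
    rw [mul_zero, map_zero])

end Summand

open CategoryTheory

variable (hS : IsRingSummand S i) (he : IsIdempotentElem e)

/-- The preimage of `N` is Hom_{eAe}(eA, N), and f ↦ f(1) identifies its part under `e` with `N`: if
e f = f, then f(y) = f(y e) = (e y e) f(1). -/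
theorem essSurj_homFunctor (hie : i * e = e) :
    (ModuleCat.restrictScalars hS.proj ⋙ homFunctor he).EssSurj where
  mem_essImage N := by
    let _ := coindModule hS he N hie
    let M : ModuleCat.{u} hS.Carrier := ModuleCat.of hS.Carrier (coind he N)
    let M' : ModuleCat.{u} A := (ModuleCat.restrictScalars hS.proj).obj M
    let val : M' → coind he N := fun f => f
    have hix : ∀ x : he.Corner, i * x.1 = x.1 := fun x => by
      rw [← e_mul_corner he x, ← mul_assoc, hie]
    have hsmul : ∀ (x : A) (f : M') (y : A), (val (x • f)).1 y =
        (val f).1 (y * (i * x)) := fun _ _ _ => rfl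
    let ψ : HomFrom he M' →ₗ[he.Corner] N :=
      { toFun := fun f => (val (HomFrom.ev he f)).1 1
        map_add' := fun f g => by rw [map_add]; rfl
        map_smul' := fun x f => by
          rw [HomFrom.ev_smul, hsmul, one_mul, hix, RingHom.id_apply]
          conv_lhs => rw [← mul_one x.1]
          exact (val (HomFrom.ev he f)).2 x 1 }
    have hψ : Function.Bijective ψ := by
      constructor
      · rw [injective_iff_map_eq_zero]
        intro f hf
        refine HomFrom.ev_injective he ?_
        rw [map_zero, ← HomFrom.e_smul_ev he f]
        refine Subtype.ext (AddMonoidHom.ext fun y => ?_)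
        refine (hsmul _ _ _).trans ?_
        set F := (val (HomFrom.ev he f))
        change F.1 1 = 0 at hf
        change F.1 (y * (i * e)) = 0
        rw [hie, ← coind_e_mul he N F, ← mul_assoc]
        have := F.2 (cornerMk he y) 1
        rwa [mul_one, hf, smul_zero] at this
      · intro n
        -- The preimage of `n` is dictated by the formula f(y) = (e y e) f(1).
        let f₀ : coind he N := ⟨AddMonoidHom.mk' (fun y => cornerMk he y • n) (fun y z => by
          rw [cornerMk_add, add_smul]), fun x y => by
            change cornerMk he (x.1 * y) • n = x • cornerMk he y • n
            rw [smul_smul]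
            congr 1
            refine Subtype.ext ?_
            change e * (x.1 * y) * e = x.1 * (e * y * e)
            rw [← mul_assoc, e_mul_corner, ← mul_assoc, ← mul_assoc, corner_mul_e]⟩
        let f₁ : M' := f₀
        refine ⟨HomFrom.mk he f₁, (hsmul e f₁ 1).trans ?_⟩
        rw [hie, one_mul]
        change cornerMk he e • n = n
        rw [show cornerMk he e = 1 from cornerMk_corner he 1, one_smul]
    exact ⟨M, ⟨(LinearEquiv.ofBijective ψ hψ).toModuleIso⟩⟩

variable {ι : Type*} [Fintype ι] {a b : ι → A}

theorem isEquivalence_homFunctor (hi : ∑ j, a j * e * b j = i) (hie : i * e = e) :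
    (ModuleCat.restrictScalars hS.proj ⋙ homFunctor he).IsEquivalence := by
  have hM : ∀ (M : ModuleCat.{u} hS.Carrier) (m : (ModuleCat.restrictScalars hS.proj).obj M),
      i • m = m := fun M m => by
    change hS.proj i • (show M from m) = m
    rw [hS.proj_self, one_smul]
  have hfaith : (ModuleCat.restrictScalars hS.proj ⋙ homFunctor he).Faithful := by
    refine ⟨fun {M M'} g g' h => ?_⟩
    refine (ModuleCat.restrictScalars hS.proj).map_injective ?_
    ext m
    rw [← HomFrom.sum_smul_ev_mk (he := he) hi (hM M) m, map_sum, map_sum]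
    refine Finset.sum_congr rfl fun j _ => ?_
    refine (LinearMap.map_smul _ _ _).trans (Eq.trans ?_ (LinearMap.map_smul _ _ _).symm)
    exact congrArg (fun φ => a j • HomFrom.ev he (φ.hom (HomFrom.mk he (b j • m)))) h
  have hfull : (ModuleCat.restrictScalars hS.proj ⋙ homFunctor he).Full := by
    refine ⟨fun {M M'} φ => ?_⟩
    obtain ⟨g, hg⟩ := HomFrom.map_surjective (he := he) hi (hM M) (hM M') φ.hom
    -- An `A`-linear map is linear over the summand, since an element of the summand acts as it does
    -- in `A`.
    refine ⟨ModuleCat.ofHom (X := M) (Y := M')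
      { toFun := g, map_add' := g.map_add, map_smul' := fun x m => ?_ }, ?_⟩
    · have h1 := g.map_smul x.1 m
      have h2 : ∀ (M : ModuleCat.{u} hS.Carrier) (m : M),
          (show (ModuleCat.restrictScalars hS.proj).obj M from x • m) =
          x.1 • (show (ModuleCat.restrictScalars hS.proj).obj M from m) := fun M m => by
        change x • m = hS.proj x.1 • m
        rw [hS.proj_coe]
      exact (congrArg g (h2 M m)).trans (h1.trans (h2 M' (g m)).symm)
    · refine ModuleCat.hom_ext ?_
      rw [← hg]
      rfl
  have hess := essSurj_homFunctor hS he hie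
  exact { }

variable {B : Type u} [Ring B] [Algebra k B] (γ : B ≃ₐ[k] he.Corner)

theorem isEquivalence_inducedFunctor (hi : ∑ j, a j * e * b j = i) (hie : i * e = e) :
    (inducedFunctor hS he γ).IsEquivalence := by
  have h1 := isEquivalence_homFunctor hS he hi hie
  have h2 : (ModuleCat.restrictScalars γ.toRingEquiv.toRingHom).IsEquivalence :=
    ModuleCat.restrictScalars_isEquivalence_of_ringEquiv γ.toRingEquiv
  exact Functor.isEquivalence_trans (ModuleCat.restrictScalars hS.proj ⋙ homFunctor he)
    (ModuleCat.restrictScalars γ.toRingEquiv.toRingHom)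

/-- The identity map is semilinear in both directions along the ring isomorphism. -/
theorem finite_restrictScalars_iff {R R' : Type u} [Ring R] [Ring R'] (σ : R ≃+* R')
    (N : ModuleCat.{u} R') :
    Module.Finite R' N ↔ Module.Finite R ((ModuleCat.restrictScalars σ.toRingHom).obj N) := by
  have := RingHomInvPair.of_ringEquiv σ
  have := RingHomInvPair.symm (↑σ : R →+* R') (↑σ.symm)
  constructor
  · intro h
    let id' : N →ₛₗ[(↑σ.symm : R' →+* R)] ((ModuleCat.restrictScalars σ.toRingHom).obj N) :=
      { toFun := fun x => x
        map_add' := fun _ _ => rfl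
        map_smul' := fun r x => by
          change r • x = σ (σ.symm r) • x
          rw [σ.apply_symm_apply] }
    exact Module.Finite.of_surjective id' Function.surjective_id
  · intro h
    let id' : ((ModuleCat.restrictScalars σ.toRingHom).obj N) →ₛₗ[(↑σ : R →+* R')] N :=
      { toFun := fun x => x
        map_add' := fun _ _ => rfl
        map_smul' := fun r x => rfl }
    exact Module.Finite.of_surjective id' Function.surjective_id

theorem finite_iff_finite_inducedFunctor (hi : ∑ j, a j * e * b j = i)
    (M : ModuleCat.{u} hS.Carrier) :
    Module.Finite hS.Carrier M ↔ Module.Finite B ((inducedFunctor hS he γ).obj M) := by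
  let _ : Module A M := Module.compHom M hS.proj
  exact (finite_iff_finite_homFrom hS he (M := M) (fun _ _ => rfl) hi).trans
    (finite_restrictScalars_iff γ.toRingEquiv
      ((homFunctor he).obj ((ModuleCat.restrictScalars hS.proj).obj M)))

end Morita

end PartialBrauer

namespace PartialBrauer

open Diagram

/-! ### A factorization through a larger set of vertices by a zigzag. -/

section Zigzag

variable {n p q : ℕ} {f : Fin (2 * p + 1) → Fin n} {g : Fin (2 * q + 1) → Fin n}

/-- The partition with the parts `{a, a'}` for `a ≤ 2p` and `{b', (b+1)'}` for odd `b > 2p`. -/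
def cupsRel (p q : ℕ) : Setoid (Fin (2 * p + 1) ⊕ Fin (2 * q + 1)) :=
  Setoid.ker (Sum.elim (fun a => a.1) fun b => if b.1 ≤ 2 * p then b.1 else 2 * ((b.1 + 1) / 2))

/-- The partition with the parts `{a, a'}` for `a < 2p`, `{b, b+1}` for even `b` with
`2p ≤ b < 2q`, and `{2q, (2p)'}`. -/
def capsRel (p q : ℕ) : Setoid (Fin (2 * q + 1) ⊕ Fin (2 * p + 1)) :=
  Setoid.ker (Sum.elim (fun b => if b.1 < 2 * p then b.1 else 2 * (b.1 / 2))
    fun a => if a.1 < 2 * p then a.1 else 2 * q)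

theorem cupsRel_iff {u v : Fin (2 * p + 1) ⊕ Fin (2 * q + 1)} : cupsRel p q u v ↔
    Sum.elim (fun a => a.1) (fun b => if b.1 ≤ 2 * p then b.1 else 2 * ((b.1 + 1) / 2)) u =
      Sum.elim (fun a => a.1) (fun b => if b.1 ≤ 2 * p then b.1 else 2 * ((b.1 + 1) / 2)) v :=
  Iff.rfl

theorem capsRel_iff {u v : Fin (2 * q + 1) ⊕ Fin (2 * p + 1)} : capsRel p q u v ↔
    Sum.elim (fun b => if b.1 < 2 * p then b.1 else 2 * (b.1 / 2))
      (fun a => if a.1 < 2 * p then a.1 else 2 * q) u =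
    Sum.elim (fun b => if b.1 < 2 * p then b.1 else 2 * (b.1 / 2))
      (fun a => if a.1 < 2 * p then a.1 else 2 * q) v :=
  Iff.rfl

theorem cupsRel_small (p q : ℕ) : SmallParts (cupsRel p q) := by
  rintro (⟨a, ha⟩ | ⟨a, ha⟩) (⟨b, hb⟩ | ⟨b, hb⟩) (⟨c, hc⟩ | ⟨c, hc⟩) h1 h2 <;>
    simp only [cupsRel_iff, Sum.elim_inl, Sum.elim_inr] at h1 h2 <;>
    simp only [Sum.inl.injEq, Sum.inr.injEq, Fin.mk.injEq, reduceCtorEq, false_or, or_false] <;>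
    (try split_ifs at h1 h2) <;> omega

theorem capsRel_small (h : p ≤ q) : SmallParts (capsRel p q) := by
  rintro (⟨a, ha⟩ | ⟨a, ha⟩) (⟨b, hb⟩ | ⟨b, hb⟩) (⟨c, hc⟩ | ⟨c, hc⟩) h1 h2 <;>
    simp only [capsRel_iff, Sum.elim_inl, Sum.elim_inr] at h1 h2 <;>
    simp only [Sum.inl.injEq, Sum.inr.injEq, Fin.mk.injEq, reduceCtorEq, false_or, or_false] <;>
    (try split_ifs at h1 h2) <;> omega

theorem cupsRel_inl_inr {a b : ℕ} (ha : a < 2 * p + 1) (hb : b < 2 * q + 1) (h : a = b) :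
    cupsRel p q (Sum.inl ⟨a, ha⟩) (Sum.inr ⟨b, hb⟩) := by
  simp only [cupsRel_iff, Sum.elim_inl, Sum.elim_inr]
  split_ifs <;> omega

theorem cupsRel_inr_inr {b : ℕ} (hb : b + 1 < 2 * q + 1) (h : 2 * p < b) (ho : b % 2 = 1) :
    cupsRel p q (Sum.inr ⟨b, by omega⟩) (Sum.inr ⟨b + 1, hb⟩) := by
  simp only [cupsRel_iff, Sum.elim_inr]
  split_ifs <;> omega

theorem capsRel_inl_inr {a b : ℕ} (ha : a < 2 * p + 1) (hb : b < 2 * q + 1) (h : a = b)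
    (h' : a < 2 * p) : capsRel p q (Sum.inl ⟨b, hb⟩) (Sum.inr ⟨a, ha⟩) := by
  simp only [capsRel_iff, Sum.elim_inl, Sum.elim_inr]
  split_ifs <;> omega

theorem capsRel_inl_inl {b : ℕ} (hb : b + 1 < 2 * q + 1) (h : 2 * p ≤ b) (ho : b % 2 = 0) :
    capsRel p q (Sum.inl ⟨b, by omega⟩) (Sum.inl ⟨b + 1, hb⟩) := by
  simp only [capsRel_iff, Sum.elim_inl]
  split_ifs <;> omega

theorem capsRel_last (h : p ≤ q) :
    capsRel p q (Sum.inl ⟨2 * q, by omega⟩) (Sum.inr ⟨2 * p, by omega⟩) := by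
  simp only [capsRel_iff, Sum.elim_inl, Sum.elim_inr]
  split_ifs <;> omega

theorem not_isolatedIn_of_rel {V : Type*} {r : Setoid V} {u v : V} (h : r u v) (hne : u ≠ v) :
    ¬ IsolatedIn r u := fun hi => hne (hi v h).symm

theorem not_isolatedIn_cupsRel (hpq : p ≤ q) (v : Fin (2 * p + 1) ⊕ Fin (2 * q + 1)) :
    ¬ IsolatedIn (cupsRel p q) v := by
  rcases v with ⟨a, ha⟩ | ⟨b, hb⟩
  · exact not_isolatedIn_of_rel (cupsRel_inl_inr ha (by omega : a < _) rfl) (by simp)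
  · by_cases h : b ≤ 2 * p
    · exact not_isolatedIn_of_rel (Setoid.symm' _ (cupsRel_inl_inr (by omega : b < _) hb rfl))
        (by simp)
    · rcases Nat.mod_two_eq_zero_or_one b with ho | ho
      · obtain ⟨c, rfl⟩ : ∃ c, b = c + 1 := ⟨b - 1, by omega⟩
        exact not_isolatedIn_of_rel (Setoid.symm' _ (cupsRel_inr_inr hb (by omega) (by omega)))
          (by simp)
      · exact not_isolatedIn_of_rel (cupsRel_inr_inr (by omega) (by omega) ho) (by simp)

theorem not_isolatedIn_capsRel (hpq : p ≤ q) (v : Fin (2 * q + 1) ⊕ Fin (2 * p + 1)) :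
    ¬ IsolatedIn (capsRel p q) v := by
  rcases v with ⟨b, hb⟩ | ⟨a, ha⟩
  · by_cases h : b < 2 * p
    · exact not_isolatedIn_of_rel (capsRel_inl_inr (by omega : b < _) hb rfl h) (by simp)
    · rcases Nat.mod_two_eq_zero_or_one b with ho | ho
      · by_cases hq : b = 2 * q
        · subst hq
          exact not_isolatedIn_of_rel (capsRel_last hpq) (by simp)
        · exact not_isolatedIn_of_rel (capsRel_inl_inl (by omega) (by omega) ho) (by simp)
      · obtain ⟨c, rfl⟩ : ∃ c, b = c + 1 := ⟨b - 1, by omega⟩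
        exact not_isolatedIn_of_rel (Setoid.symm' _ (capsRel_inl_inl hb (by omega) (by omega)))
          (by simp)
  · by_cases h : a < 2 * p
    · exact not_isolatedIn_of_rel (Setoid.symm' _ (capsRel_inl_inr ha (by omega : a < _) rfl h))
        (by simp)
    · obtain rfl : a = 2 * p := by omega
      exact not_isolatedIn_of_rel (Setoid.symm' _ (capsRel_last hpq)) (by simp)

/-- The identity of the range of `f` factors through the range of `g`, without closed loops. -/
theorem exists_factorization (hf : Function.Injective f) (hg : Function.Injective g) (hpq : p ≤ q) :
    ∃ c c' : Diagram n, c.rightSupport = Set.range g ∧ c'.leftSupport = Set.range g ∧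
      ConnectedOn c c' (Set.range g) ∧ c * c' = cut (Set.range f)ᶜ := by
  set c : Diagram n := bridge hf hg (cupsRel_small p q)
  set c' : Diagram n := bridge hg hf (capsRel_small hpq)
  have hcl : c.leftSupport = Set.range f := leftSupport_bridge _ _ _ (not_isolatedIn_cupsRel hpq)
  have hcr : c.rightSupport = Set.range g := rightSupport_bridge _ _ _ (not_isolatedIn_cupsRel hpq)
  have hcl' : c'.leftSupport = Set.range g := leftSupport_bridge _ _ _ (not_isolatedIn_capsRel hpq)
  have hcr' : c'.rightSupport = Set.range f :=
    rightSupport_bridge _ _ _ (not_isolatedIn_capsRel hpq)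
  have hs : c.rightSupport = c'.leftSupport := hcr.trans hcl'.symm
  set J := juxtapose c c' with hJ
  have jl : ∀ {u v}, cupsRel p q u v → J (onLeft (Sum.map f g u)) (onLeft (Sum.map f g v)) :=
    fun h => juxtapose_left c c' (bridge_rel hf hg (cupsRel_small p q) h)
  have jr : ∀ {u v}, capsRel p q u v → J (onRight (Sum.map g f u)) (onRight (Sum.map g f v)) :=
    fun h => juxtapose_right c c' (bridge_rel hg hf (capsRel_small hpq) h)
  have start : ∀ a (ha : a < 2 * p + 1),
      J (Sum.inl (f ⟨a, ha⟩)) (Sum.inr (Sum.inl (g ⟨a, by omega⟩))) := fun a ha =>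
    jl (cupsRel_inl_inr ha (by omega) rfl)
  -- The last strand runs through the surplus middle vertices 2p, 2p+1, …, 2q in this order. Steps
  -- from even b use the pairs of `c'`, steps from odd b those of `c`. Hence no middle vertex in the
  -- range of `g` lies on a closed loop.
  have zigzag : ∀ b, 2 * p ≤ b → ∀ hb : b < 2 * q + 1,
      J (Sum.inl (f ⟨2 * p, by omega⟩)) (Sum.inr (Sum.inl (g ⟨b, hb⟩))) := by
    intro b hpb
    induction b, hpb using Nat.le_induction with
    | base => exact fun _ => start (2 * p) (by omega)
    | succ b hpb ih =>
      intro hb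
      refine Setoid.trans' _ (ih (by omega)) ?_
      rcases Nat.mod_two_eq_zero_or_one b with ho | ho
      · exact jr (capsRel_inl_inl hb hpb ho)
      · exact jl (cupsRel_inr_inr hb (by omega) ho)
  have through : ∀ a, J (Sum.inl (f a)) (Sum.inr (Sum.inr (f a))) := by
    rintro ⟨a, ha⟩
    by_cases h : a < 2 * p
    · exact Setoid.trans' _ (start a ha) (jr (capsRel_inl_inr ha (by omega) rfl h))
    · obtain rfl : a = 2 * p := by omega
      exact Setoid.trans' _ (zigzag (2 * q) (by omega) (by omega)) (jr (capsRel_last hpq))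
  refine ⟨c, c', hcr, hcl', ?_, (eq_of_le ?_ ?_).symm⟩
  · rintro _ ⟨⟨b, hb⟩, rfl⟩
    by_cases h : b < 2 * p + 1
    · exact ⟨Sum.inl (f ⟨b, h⟩), Setoid.symm' _ (start b h)⟩
    · exact ⟨Sum.inl (f ⟨2 * p, by omega⟩), Setoid.symm' _ (zigzag b (by omega) hb)⟩
  · rintro u v (rfl | ⟨h, h'⟩)
    · exact Setoid.refl' _ _
    · change J (exterior u) (exterior v)
      obtain ⟨a, ha⟩ := not_not.1 h'
      rcases u with u | u <;> rcases v with v | v <;>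
        simp only [Sum.elim_inl, Sum.elim_inr, id] at h ha <;> subst h ha
      · exact Setoid.refl' _ _
      · exact through a
      · exact Setoid.symm' _ (through a)
      · exact Setoid.refl' _ _
  · intro u hu
    rw [isSingleton_cut] at hu
    rw [isSingleton_mul_of_support_eq hs]
    rcases u with u | u
    · rw [← hcl] at hu
      exact not_not.1 hu
    · rw [← hcr'] at hu
      exact not_not.1 hu

end Zigzag

/-! ### The ideal of odd supports and its identity element. -/

section Summand

variable (k : Type u) [CommRing k] {n : ℕ}

theorem exists_injective_range (X : Set (Fin n)) {N : ℕ} (h : X.ncard = N) :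
    ∃ f : Fin N → Fin n, Function.Injective f ∧ Set.range f = X := by
  classical
  rw [Set.ncard_eq_toFinset_card'] at h
  exact ⟨X.toFinset.orderEmbOfFin h, (X.toFinset.orderEmbOfFin h).injective, by
    rw [Finset.range_orderEmbOfFin, Set.coe_toFinset]⟩

/-- The zigzag has no closed loops, so the product rule turns its two halves into a factorization
ε_X = ⟨c⟩ ε_Z ⟨c'⟩. Oddness guarantees a through strand on `X` and an even surplus |Z| - |X| that
this strand can absorb. -/
theorem exists_cutIdem_eq {X Z : Set (Fin n)} (hX : Odd X.ncard) (hZ : Odd Z.ncard)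
    (h : X.ncard ≤ Z.ncard) : ∃ a b : R k n, a * cutIdem k Z * b = cutIdem k X := by
  obtain ⟨p, hp⟩ := hX
  obtain ⟨q, hq⟩ := hZ
  obtain ⟨f, hf, rfl⟩ := exists_injective_range X hp
  obtain ⟨g, hg, rfl⟩ := exists_injective_range Z hq
  obtain ⟨c, c', hr, hl, hc, hcc⟩ := exists_factorization hf hg (by omega)
  refine ⟨decorated k c, decorated k c', ?_⟩
  rw [← hr, decorated_mul_cutIdem, decorated_mul_decorated_of_connectedOn (hr.trans hl.symm)
    (by rwa [hr]), hcc, decorated_cut]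

variable (n)

/-- The span of the `⟨d⟩` for which the number of left non-singletons of `d` is odd. -/
noncomputable def oddSupportPart : Submodule k (R k n) :=
  Submodule.span k (decorated k '' {d | Odd d.leftSupport.ncard})

open Classical in
/-- The identity element of the ideal `oddSupportPart`. -/
noncomputable def oddSupportUnit : R k n :=
  ∑ X ∈ Finset.univ.filter fun X : Set (Fin n) => Odd X.ncard, cutIdem k X

variable {k n}

theorem oddSupportUnit_mul_cutIdem {X : Set (Fin n)} (hX : Odd X.ncard) :
    oddSupportUnit k n * cutIdem k X = cutIdem k X := by
  classical
  rw [oddSupportUnit, Finset.sum_mul, Finset.sum_eq_single X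
    (fun Y _ h => cutIdem_mul_cutIdem_of_ne h) (fun h => absurd (by simpa using hX) h),
    cutIdem_mul_self]

/-- The component is spanned by decorated diagrams with supports `X` and `Y`, whose sizes have the
same parity. -/
theorem cutIdem_mul_mul_cutIdem_of_parity {X Y : Set (Fin n)} (h : ¬ (Odd X.ncard ↔ Odd Y.ncard))
    (x : R k n) : cutIdem k X * x * cutIdem k Y = 0 := by
  induction x using TwistedAlgebra.induction with
  | h0 => simp
  | hadd x y hx hy => rw [mul_add, add_mul, hx, hy, add_zero]
  | hof r d =>
    rw [mul_smul_comm, smul_mul_assoc]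
    rcases cutIdem_mul_diag_mul_cutIdem (k := k) X Y d with h0 | ⟨c, rfl, rfl, -⟩
    · rw [h0, smul_zero]
    · exact absurd (Nat.even_add'.1 c.even_ncard_support_add) h

open Classical in
theorem one_sub_oddSupportUnit : 1 - oddSupportUnit k n =
    ∑ X ∈ Finset.univ.filter fun X : Set (Fin n) => ¬ Odd X.ncard, cutIdem k X := by
  rw [sub_eq_iff_eq_add', oddSupportUnit, Finset.sum_filter_add_sum_filter_not, sum_cutIdem]

/-- The difference i x (1 - i) is a sum of Peirce components between supports of opposite parity.
The mirror statement follows, and the two together make i central. -/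
theorem oddSupportUnit_mul (x : R k n) :
    oddSupportUnit k n * x = oddSupportUnit k n * x * oddSupportUnit k n := by
  classical
  refine sub_eq_zero.1 ?_
  nth_rw 1 [← mul_one (oddSupportUnit k n * x)]
  rw [← mul_sub, one_sub_oddSupportUnit, oddSupportUnit, Finset.mul_sum]
  refine Finset.sum_eq_zero fun Y hY => ?_
  rw [Finset.sum_mul, Finset.sum_mul]
  refine Finset.sum_eq_zero fun X hX => cutIdem_mul_mul_cutIdem_of_parity (fun h => ?_) x
  exact (Finset.mem_filter.1 hY).2 (h.1 (Finset.mem_filter.1 hX).2)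

theorem mul_oddSupportUnit (x : R k n) :
    x * oddSupportUnit k n = oddSupportUnit k n * x * oddSupportUnit k n := by
  classical
  refine sub_eq_zero.1 ?_
  nth_rw 1 [← one_mul (x * oddSupportUnit k n)]
  rw [mul_assoc, ← sub_mul, one_sub_oddSupportUnit, oddSupportUnit, ← mul_assoc, Finset.mul_sum]
  refine Finset.sum_eq_zero fun Y hY => ?_
  rw [Finset.sum_mul, Finset.sum_mul]
  refine Finset.sum_eq_zero fun X hX => cutIdem_mul_mul_cutIdem_of_parity (fun h => ?_) x
  exact (Finset.mem_filter.1 hX).2 (h.2 (Finset.mem_filter.1 hY).2)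

theorem oddSupportUnit_comm (x : R k n) : oddSupportUnit k n * x = x * oddSupportUnit k n :=
  (oddSupportUnit_mul x).trans (mul_oddSupportUnit x).symm

theorem oddSupportUnit_mul_mem (x : R k n) : oddSupportUnit k n * x ∈ oddSupportPart k n := by
  classical
  induction x using TwistedAlgebra.induction with
  | h0 => simp
  | hadd x y hx hy => rw [mul_add]; exact Submodule.add_mem _ hx hy
  | hof r d =>
    rw [mul_smul_comm, oddSupportUnit_mul]
    refine Submodule.smul_mem _ _ ?_
    rw [oddSupportUnit, Finset.mul_sum]
    refine Submodule.sum_mem _ fun Y _ => ?_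
    rw [Finset.sum_mul, Finset.sum_mul]
    refine Submodule.sum_mem _ fun X hX => ?_
    rcases cutIdem_mul_diag_mul_cutIdem (k := k) X Y d with h0 | ⟨c, hc, -, h⟩
    · rw [h0]; exact Submodule.zero_mem _
    · rw [h]
      refine Submodule.subset_span ⟨c, ?_, rfl⟩
      change Odd c.leftSupport.ncard
      rw [hc]
      exact (Finset.mem_filter.1 hX).2

/-- The span is the set of elements fixed by a central idempotent, which makes the axioms of a ring
summand formal. -/
theorem mem_oddSupportPart_iff {x : R k n} :
    x ∈ oddSupportPart k n ↔ oddSupportUnit k n * x = x := by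
  constructor
  · intro hx
    induction hx using Submodule.span_induction with
    | mem x hx =>
      obtain ⟨d, hd, rfl⟩ := hx
      rw [← cutIdem_mul_decorated, ← mul_assoc, oddSupportUnit_mul_cutIdem hd]
    | zero => rw [mul_zero]
    | add x y _ _ hx hy => rw [mul_add, hx, hy]
    | smul r x _ hx => rw [mul_smul_comm, hx]
  · intro hx
    rw [← hx]
    exact oddSupportUnit_mul_mem x

theorem isRingSummand_oddSupportPart :
    IsRingSummand (oddSupportPart k n) (oddSupportUnit k n) where
  mul_mem_left a x hx := by
    rw [mem_oddSupportPart_iff] at hx ⊢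
    rw [← mul_assoc, oddSupportUnit_comm, mul_assoc, hx]
  mul_mem_right a x hx := by
    rw [mem_oddSupportPart_iff] at hx ⊢
    rw [← mul_assoc, hx]
  mem := by
    have := oddSupportUnit_mul_mem (1 : R k n)
    rwa [mul_one] at this
  mul_left x hx := mem_oddSupportPart_iff.1 hx
  mul_right x hx := by rw [← oddSupportUnit_comm]; exact mem_oddSupportPart_iff.1 hx

end Summand

/-! ### The Brauer algebra with parameter 0 as a corner ring, and the equivalence. -/

section CornerIso

variable (k : Type u) [CommRing k] {m n : ℕ} {f : Fin m → Fin n} (hf : Function.Injective f)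

/-- The linear map `d ↦ ⟨d⟩` on the Brauer algebra, after embedding `d` along `f`. -/
noncomputable def decoratedMap : BrauerAlgebra m (0 : k) →ₗ[k] R k n :=
  Finsupp.linearCombination k fun d : Diagram.brauer m => decorated k (embed hf d.1)

theorem decoratedMap_of (d : Diagram.brauer m) :
    decoratedMap k hf (TwistedAlgebra.of _ d) = decorated k (embed hf d.1) :=
  (Finsupp.linearCombination_single k 1 d).trans (one_smul k _)

/-- The factor 0^k is 1 without loops and 0 otherwise, which is the dichotomy in the product rule
for decorated diagrams. -/
theorem decoratedMap_mul (x y : BrauerAlgebra m (0 : k)) :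
    decoratedMap k hf (x * y) = decoratedMap k hf x * decoratedMap k hf y := by
  induction x using TwistedAlgebra.induction with
  | h0 => simp
  | hadd x x' hx hx' => rw [add_mul, map_add, map_add, hx, hx', add_mul]
  | hof r d =>
    induction y using TwistedAlgebra.induction with
    | h0 => simp
    | hadd y y' hy hy' => rw [mul_add, map_add, map_add, hy, hy', mul_add]
    | hof s d' =>
      rw [smul_mul_smul_comm, map_smul, map_smul, map_smul, smul_mul_smul_comm,
        TwistedAlgebra.of_mul_of, map_smul, decoratedMap_of, decoratedMap_of, decoratedMap_of]
      congr 1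
      change (0 : k) ^ loops d.1 d'.1 • decorated k (embed hf (d.1 * d'.1)) = _
      have hs : (embed hf d.1).rightSupport = (embed hf d'.1).leftSupport := by
        rw [rightSupport_embed hf d.2, leftSupport_embed hf d'.2]
      have hc : ConnectedOn (embed hf d.1) (embed hf d'.1) (embed hf d.1).rightSupport ↔
          loops d.1 d'.1 = 0 := by
        rw [rightSupport_embed hf d.2, connectedOn_embed, loops_eq_zero_iff d.2 d'.2]
      by_cases h : loops d.1 d'.1 = 0
      · rw [h, pow_zero, one_smul, decorated_mul_decorated_of_connectedOn hs (hc.2 h),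
          embed_mul hf d.2 d'.2]
      · rw [zero_pow h, zero_smul,
          decorated_mul_decorated_of_not_connectedOn hs (fun h' => h (hc.1 h'))]

theorem decoratedMap_one : decoratedMap k hf 1 = cutIdem k (Set.range f) := by
  rw [TwistedAlgebra.one_def, decoratedMap_of, ← decorated_cut, ← embed_one hf]
  rfl

/-- All embedded Brauer partitions have the same supports, so the coefficient of the image at an
embedded diagram reads off the original coefficient. -/
theorem decoratedMap_injective : Function.Injective (decoratedMap k hf) := by
  classical
  have key : ∀ (x : BrauerAlgebra m (0 : k)) (d : Diagram.brauer m),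
      coeff (embed hf d.1) (decoratedMap k hf x) = (show Diagram.brauer m →₀ k from x) d := by
    intro x d
    induction x using TwistedAlgebra.induction with
    | h0 => rw [map_zero, map_zero]; rfl
    | hadd x y hx hy => rw [map_add, map_add, hx, hy]; rfl
    | hof r d' =>
      rw [map_smul, map_smul, decoratedMap_of, coeff_decorated, coeff_diag, smul_eq_mul]
      · refine Eq.trans ?_ (congrArg (r * ·) (Finsupp.single_apply (a := d') (a' := d)).symm)
        congr 2
        rw [(embed_injective hf).eq_iff, Subtype.ext_iff]
      · rw [leftSupport_embed hf d.2, leftSupport_embed hf d'.2]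
      · rw [rightSupport_embed hf d.2, rightSupport_embed hf d'.2]
  rw [injective_iff_map_eq_zero]
  intro x hx
  refine Finsupp.ext fun d => ?_
  have := key x d
  rw [hx, map_zero] at this
  exact this.symm

theorem exists_decoratedMap_eq (x : R k n) : ∃ y, decoratedMap k hf y =
    cutIdem k (Set.range f) * x * cutIdem k (Set.range f) := by
  induction x using TwistedAlgebra.induction with
  | h0 => exact ⟨0, by simp⟩
  | hadd x x' hx hx' =>
    obtain ⟨y, hy⟩ := hx
    obtain ⟨y', hy'⟩ := hx'
    exact ⟨y + y', by rw [map_add, hy, hy', mul_add, add_mul]⟩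
  | hof r d =>
    rcases cutIdem_mul_diag_mul_cutIdem (k := k) (Set.range f) (Set.range f) d with
      h0 | ⟨c, hl, hr, h⟩
    · exact ⟨0, by rw [mul_smul_comm, smul_mul_assoc, h0, smul_zero, map_zero]⟩
    · obtain ⟨d', hd', rfl⟩ := exists_embed_eq hf hl hr
      exact ⟨r • TwistedAlgebra.of _ ⟨d', hd'⟩, by
        rw [mul_smul_comm, smul_mul_assoc, h, map_smul, decoratedMap_of]⟩

theorem isIdempotentElem_cutIdem (X : Set (Fin n)) : IsIdempotentElem (cutIdem k X) :=
  cutIdem_mul_self X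

/-- The isomorphism `d ↦ ⟨d⟩` from the Brauer algebra onto the corner ring. -/
noncomputable def cornerEquiv : BrauerAlgebra m (0 : k) ≃ₐ[k]
    (isIdempotentElem_cutIdem k (Set.range f)).Corner :=
  AlgEquiv.ofBijective
    (AlgHom.ofLinearMap
      { toFun := fun x => ⟨decoratedMap k hf x, (Subsemigroup.mem_corner_iff
          (isIdempotentElem_cutIdem k (Set.range f))).2
          ⟨by rw [← decoratedMap_one k hf, ← decoratedMap_mul, one_mul],
            by rw [← decoratedMap_one k hf, ← decoratedMap_mul, mul_one]⟩⟩
        map_add' := fun x y => Subtype.ext (map_add _ x y)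
        map_smul' := fun r x => Subtype.ext (map_smul _ r x) }
      (Subtype.ext (decoratedMap_one k hf))
      (fun x y => Subtype.ext (decoratedMap_mul k hf x y)))
    ⟨fun x y h => decoratedMap_injective k hf (congrArg Subtype.val h), fun y => by
      obtain ⟨x, hx⟩ := exists_decoratedMap_eq k hf y.1
      refine ⟨x, Subtype.ext (hx.trans ?_)⟩
      rw [e_mul_corner, corner_mul_e]⟩

theorem cornerEquiv_of (d : Diagram.brauer m) :
    (cornerEquiv k hf (TwistedAlgebra.of _ d)).1 = decorated k (embed hf d.1) :=
  decoratedMap_of k hf d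

/-- The common form of both statements: the range of `f` is a set of maximal odd size, so each ε_X
with |X| odd factors through `e`. -/
theorem exists_equivalence (hm : Odd m) (hn : ∀ X : Set (Fin n), Odd X.ncard → X.ncard ≤ m)
    {S : Submodule k (R k n)} (hS : S = oddSupportPart k n) {e : R k n}
    (he : e = cutIdem k (Set.range f)) :
    ∃ (i : R k n) (hS : IsRingSummand S i) (he : IsIdempotentElem e)
      (γ : BrauerAlgebra m (0 : k) ≃ₐ[k] he.Corner),
      (∀ d : Diagram.brauer m, (γ (TwistedAlgebra.of _ d)).1 = decorated k (embed hf d.1)) ∧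
      (inducedFunctor hS he γ).IsEquivalence ∧
      ∀ M : ModuleCat.{u} hS.Carrier, Module.Finite hS.Carrier M ↔
        Module.Finite (BrauerAlgebra m (0 : k)) ((inducedFunctor hS he γ).obj M) := by
  classical
  subst hS he
  have hc : (Set.range f).ncard = m := by
    rw [← Set.image_univ, Set.ncard_image_of_injective _ hf, Set.ncard_univ, Nat.card_fin]
  have hZ : Odd (Set.range f).ncard := by rwa [hc]
  have hfac : ∀ X : {X : Set (Fin n) // Odd X.ncard}, ∃ a b : R k n,
      a * cutIdem k (Set.range f) * b = cutIdem k X.1 := fun X =>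
    exists_cutIdem_eq k X.2 hZ (by rw [hc]; exact hn X.1 X.2)
  choose a b hab using hfac
  -- Summing the factorizations over all odd sets writes the identity of the summand as an element
  -- of AeA.
  have hi : ∑ X, a X * cutIdem k (Set.range f) * b X = oddSupportUnit k n := by
    rw [Finset.sum_congr rfl fun X _ => hab X, oddSupportUnit]
    exact (Finset.sum_subtype _ (by simp) _).symm
  refine ⟨oddSupportUnit k n, isRingSummand_oddSupportPart, isIdempotentElem_cutIdem k _,
    cornerEquiv k hf, cornerEquiv_of k hf, ?_, ?_⟩
  · exact isEquivalence_inducedFunctor _ _ _ hi (oddSupportUnit_mul_cutIdem hZ)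
  · exact finite_iff_finite_inducedFunctor _ _ _ hi

/-! ### The two parities of n. -/

theorem evenPart_eq_of_odd (hn : Odd n) : evenPart k n = oddSupportPart k n := by
  simp only [evenPart, oddSupportPart, IsEven_iff_of_odd hn]

theorem oddPart_eq_of_even (hn : Even n) : oddPart k n = oddSupportPart k n := by
  simp only [oddPart, oddSupportPart, not_isEven_iff_of_even hn]

theorem uHatAll_eq : uHatAll k n = cutIdem k Set.univ := by
  classical
  rw [uHatAll, uHatProd_eq_prod, cutIdem]
  simp

theorem omega_eq (m : ℕ) : omega k m = cutIdem k {0}ᶜ := by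
  rw [← decorated_cut, compl_compl, omega]

end CornerIso

end PartialBrauer

theorem proposition521 (k : Type u) [CommRing k] :
    (∀ n : ℕ, Odd n →
      ∃ (i : PartialBrauer.R k n) (hS : PartialBrauer.IsRingSummand (PartialBrauer.evenPart k n) i)
        (he : IsIdempotentElem (PartialBrauer.uHatAll k n))
        (γ : PartialBrauer.BrauerAlgebra n (0 : k) ≃ₐ[k] he.Corner),
        (∀ d : PartialBrauer.Diagram.brauer n,
          (γ (PartialBrauer.TwistedAlgebra.of _ d)).1 = PartialBrauer.decorated k d.1) ∧
        (PartialBrauer.inducedFunctor hS he γ).IsEquivalence ∧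
        ∀ M : ModuleCat.{u} hS.Carrier, Module.Finite hS.Carrier M ↔
          Module.Finite (PartialBrauer.BrauerAlgebra n (0 : k))
            ((PartialBrauer.inducedFunctor hS he γ).obj M)) ∧
    (∀ m : ℕ, Even (m + 1) →
      ∃ (i : PartialBrauer.R k (m + 1))
        (hS : PartialBrauer.IsRingSummand (PartialBrauer.oddPart k (m + 1)) i)
        (he : IsIdempotentElem (PartialBrauer.omega k m))
        (γ : PartialBrauer.BrauerAlgebra m (0 : k) ≃ₐ[k] he.Corner),
        (∀ d : PartialBrauer.Diagram.brauer m,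
          (γ (PartialBrauer.TwistedAlgebra.of _ d)).1 =
            PartialBrauer.decorated k (PartialBrauer.Diagram.adjoin d.1)) ∧
        (PartialBrauer.inducedFunctor hS he γ).IsEquivalence ∧
        ∀ M : ModuleCat.{u} hS.Carrier, Module.Finite hS.Carrier M ↔
          Module.Finite (PartialBrauer.BrauerAlgebra m (0 : k))
            ((PartialBrauer.inducedFunctor hS he γ).obj M)) := by
  refine ⟨fun n hn => ?_, fun m hm => ?_⟩
  -- For odd n the full vertex set is itself odd, so `f` is the identity.
  · have h := PartialBrauer.exists_equivalence k (Function.injective_id (α := Fin n)) hn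
      (fun X _ => (Set.ncard_le_card X).trans_eq (Nat.card_fin n))
      (PartialBrauer.evenPart_eq_of_odd k hn)
      ((PartialBrauer.uHatAll_eq k).trans (by rw [Set.range_id]))
    simpa only [PartialBrauer.Diagram.embed_id] using h
  -- For even n = m + 1 the largest odd size is m. The shift `Fin.succ` misses only 0, and embedding
  -- along it is `adjoin` by definition.
  · refine PartialBrauer.exists_equivalence k (Fin.succ_injective m) ?_ (fun X hX => ?_)
      (PartialBrauer.oddPart_eq_of_even k hm)
      ((PartialBrauer.omega_eq k m).trans (by rw [Fin.range_succ]))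
    · exact Nat.not_even_iff_odd.1 fun h => by
        have := Nat.even_add_one.1 hm
        exact this h
    · have h1 : X.ncard ≤ m + 1 := (Set.ncard_le_card X).trans_eq (Nat.card_fin _)
      -- An odd set cannot consist of all m + 1 points, so its size is at most m.
      have h2 : X.ncard ≠ m + 1 := fun h => by
        rw [h] at hX
        exact Nat.not_even_iff_odd.2 hX hm
      omega
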